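/- Setting. Formulae of multiplicative linear logic with units: $A ::= X \mid 1 \mid \bot \mid A\otimes A \mid A ⅋ A$, where $X$ ranges over countably many atoms, on which linear negation $(\cdot)^\perp$ is an involution without fixed points. The fragment $(\neg\bot\otimes)\mathrm{LL}$ consists of the formulae $A$ and $E$ of the grammar $$A ::= X \mid 1 \mid A\otimes A \mid A ⅋ A \mid A ⅋ E \mid E ⅋ A, \qquad E ::= \bot \mid E ⅋ E .$$ Sequent calculus proofs (rules: axiom $\vdash A, A^\perp$ for every $A$, exchange, $\otimes$, $1$, $⅋$, $\bot$) and proof-structures are cut-free. Proof-structures are typed, finite, and considered up to isomorphism; their conclusions and the premises of each $\otimes$ and $⅋$ node are ordered. A proof-structure $R$ comes with a partial jump function from its $\bot$ nodes to its nodes; it is jump-total if this function is defined on all $\bot$ nodes, and jump-correct if moreover, for every switching (choice of one premise of every $⅋$ node, the other premise being disconnected from the node), the resulting graph, with the jumps added as arcs, is acyclic and has exactly one connected component. The desequentialization $\pi^\circ$ of a proof $\pi$ is the usual jump-free proof-structure. One writes $\pi ⟾ R$ if $R$ is a jump-total proof-structure obtained by desequentializing $\pi$ and letting the $\bot$ node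 introduced by each $\bot$ rule jump to any node of the proof-structure of the premise of that rule. The relation $\sim$ is the equivalence between proofs, taken modulo exchange, that is generated by the permutations of two consecutive rules. The relation $\approx$ is the smallest equivalence relation between jump-correct proof-structures that relates $R$ to $R'$ whenever $R'$ is obtained from $R$ by redirecting exactly one jump. Corollary. Let $\pi_1, \pi_2$ be sequent calculus proofs in $(\neg\bot\otimes)\mathrm{LL}$, and let $R_1, R_2$ be jump-total proof-structures of $(\neg\bot\otimes)\mathrm{LL}$ such that $\pi_1 ⟾ R_1$ and $\pi_2 ⟾ R_2$. Then $R_1$ and $R_2$ are jump-correct, and $$\pi_1 \sim \pi_2 \iff R_1 \approx R_2 \iff \pi_1^\circ = \pi_2^\circ .$$ -/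

import Mathlib

namespace MLL

/-! ### Formulae and fragments -/

/-- Formulae of multiplicative linear logic with units. The atomic formulae are `atom i b`
with `i : ℕ` and `b : Bool`; linear negation on them is the fixed-point-free involution
that flips `b`. -/
inductive Formula : Type
  | atom (i : ℕ) (b : Bool)
  | one
  | bot
  | tens (A B : Formula)
  | par (A B : Formula)

/-- Linear negation. -/
def Formula.dual : Formula → Formula
  | .atom i b => .atom i (!b)
  | .one => .bot
  | .bot => .one
  | .tens A B => .par A.dual B.dual
  | .par A B => .tens A.dual B.dual

/-- The formulae `E ::= ⊥ | E ⅋ E`. -/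
inductive IsE : Formula → Prop
  | bot : IsE .bot
  | par {E F : Formula} : IsE E → IsE F → IsE (.par E F)

/-- The formulae `A ::= X | 1 | A ⊗ A | A ⅋ A | A ⅋ E | E ⅋ A`. -/
inductive IsA : Formula → Prop
  | atom (i : ℕ) (b : Bool) : IsA (.atom i b)
  | one : IsA .one
  | tens {A B : Formula} : IsA A → IsA B → IsA (.tens A B)
  | parAA {A B : Formula} : IsA A → IsA B → IsA (.par A B)
  | parAE {A E : Formula} : IsA A → IsE E → IsA (.par A E)
  | parEA {E A : Formula} : IsE E → IsA A → IsA (.par E A)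

/-- The fragment `(¬⊥⊗)LL`. -/
def NBTLL : Set Formula := {F | IsA F ∨ IsE F}

/-! ### Cut-free sequent calculus -/

/-- Cut-free sequent calculus proofs; `Proof Γ` is the type of proofs with conclusion `Γ`.
Sequents are finite sequences of formulae, and exchange is an explicit rule. -/
inductive Proof : List Formula → Type
  | ax (A : Formula) : Proof [A, A.dual]
  | ex (Γ : List Formula) (A B : Formula) (Δ : List Formula)
      (p : Proof (Γ ++ A :: B :: Δ)) : Proof (Γ ++ B :: A :: Δ)
  | tens (Γ : List Formula) (A B : Formula) (Δ : List Formula)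
      (p : Proof (Γ ++ [A])) (q : Proof (B :: Δ)) : Proof (Γ ++ .tens A B :: Δ)
  | one : Proof [.one]
  | par (Γ : List Formula) (A B : Formula)
      (p : Proof (Γ ++ [A, B])) : Proof (Γ ++ [.par A B])
  | bot (Γ : List Formula) (p : Proof Γ) : Proof (Γ ++ [.bot])

/-- `p` is a proof in the fragment `F`: all the sequents of `p` are sequents of `F`. -/
def Proof.InFragment (F : Set Formula) : {Γ : List Formula} → Proof Γ → Prop
  | _, .ax A => A ∈ F ∧ A.dual ∈ F
  | _, .ex Γ A B Δ p => (∀ C ∈ Γ ++ B :: A :: Δ, C ∈ F) ∧ p.InFragment F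
  | _, .tens Γ A B Δ p q =>
      (∀ C ∈ Γ ++ .tens A B :: Δ, C ∈ F) ∧ p.InFragment F ∧ q.InFragment F
  | _, .one => .one ∈ F
  | _, .par Γ A B p => (∀ C ∈ Γ ++ [.par A B], C ∈ F) ∧ p.InFragment F
  | _, .bot Γ p => (∀ C ∈ Γ ++ [.bot], C ∈ F) ∧ p.InFragment F

/-- Exchange of the entries at positions `i` and `i + 1` of a list. -/
def swapAt {α : Type} : ℕ → List α → List α
  | 0, a :: b :: l => b :: a :: l
  | i + 1, a :: l => a :: swapAt i l
  | _, l => l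

/-! ### Equivalence of proofs by rule permutations

Rule permutations act on proofs taken modulo exchange. A formula occurrence in a cut-free proof
of `Γ` is traced down to a subformula occurrence of `Γ`, which serves as its name; the tree of
the names of the principal formulae of the rules is the proof modulo exchange. -/

/-- An occurrence of a subformula of a sequent: a position in the sequent, and a path in the
syntax tree of the formula at that position (`false` is left, `true` is right; the last step of
the path comes first). -/
abbrev Occ : Type := ℕ × List Bool

/-- The left immediate subformula occurrence. -/
def Occ.l (a : Occ) : Occ := (a.1, false :: a.2)

/-- The right immediate subformula occurrence. -/
def Occ.r (a : Occ) : Occ := (a.1, true :: a.2)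

/-- Trees of logical rules, each rule with the name of its principal formula (for an axiom, the
unordered pair of the names of its two formulae). -/
inductive RuleTree : Type
  | ax (s : Sym2 Occ)
  | one (a : Occ)
  | bot (a : Occ) (t : RuleTree)
  | par (a : Occ) (t : RuleTree)
  | tens (a : Occ) (t u : RuleTree)

/-- The rule tree of a proof of `Γ`, where `ν i` names the `i`-th formula of `Γ`. -/
def Proof.ruleTreeAux : {Γ : List Formula} → Proof Γ → (ν : List Occ) → RuleTree
  | _, .ax _, ν => .ax s(ν.getD 0 (0, []), ν.getD 1 (0, []))
  | _, .ex Γ _ _ _ p, ν => p.ruleTreeAux (swapAt Γ.length ν)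
  | _, .tens Γ _ _ _ p q, ν =>
      let a := ν.getD Γ.length (0, [])
      .tens a (p.ruleTreeAux (ν.take Γ.length ++ [a.l]))
        (q.ruleTreeAux (a.r :: ν.drop (Γ.length + 1)))
  | _, .one, ν => .one (ν.getD 0 (0, []))
  | _, .par Γ _ _ p, ν =>
      let a := ν.getD Γ.length (0, [])
      .par a (p.ruleTreeAux (ν.take Γ.length ++ [a.l, a.r]))
  | _, .bot Γ p, ν => .bot (ν.getD Γ.length (0, [])) (p.ruleTreeAux (ν.take Γ.length))

/-- The rule tree of a proof of `Γ`; the formulae of `Γ` are named by their positions. Two proofs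
of `Γ` have the same rule tree exactly when they are equal modulo exchange. -/
def Proof.ruleTree {Γ : List Formula} (p : Proof Γ) : RuleTree :=
  p.ruleTreeAux ((List.range Γ.length).map fun i => (i, []))

/-- Interchange of two consecutive rules, anywhere in a tree. -/
inductive RuleTree.Swap : RuleTree → RuleTree → Prop
  | bot_bot (a b : Occ) (t : RuleTree) : Swap (.bot a (.bot b t)) (.bot b (.bot a t))
  | bot_par (a b : Occ) (t : RuleTree) : Swap (.bot a (.par b t)) (.par b (.bot a t))
  | bot_tens_left (a b : Occ) (t u : RuleTree) :
      Swap (.bot a (.tens b t u)) (.tens b (.bot a t) u)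
  | bot_tens_right (a b : Occ) (t u : RuleTree) :
      Swap (.bot a (.tens b t u)) (.tens b t (.bot a u))
  | par_par (a b : Occ) (t : RuleTree) : Swap (.par a (.par b t)) (.par b (.par a t))
  | par_tens_left (a b : Occ) (t u : RuleTree) :
      Swap (.par a (.tens b t u)) (.tens b (.par a t) u)
  | par_tens_right (a b : Occ) (t u : RuleTree) :
      Swap (.par a (.tens b t u)) (.tens b t (.par a u))
  | tens_tens_left (a b : Occ) (t u v : RuleTree) :
      Swap (.tens a (.tens b t u) v) (.tens b (.tens a t v) u)
  | tens_tens_middle (a b : Occ) (t u v : RuleTree) :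
      Swap (.tens a (.tens b t u) v) (.tens b t (.tens a u v))
  | tens_tens_right (a b : Occ) (t u v : RuleTree) :
      Swap (.tens a t (.tens b u v)) (.tens b u (.tens a t v))
  | congr_bot (a : Occ) {t t' : RuleTree} : Swap t t' → Swap (.bot a t) (.bot a t')
  | congr_par (a : Occ) {t t' : RuleTree} : Swap t t' → Swap (.par a t) (.par a t')
  | congr_tens_left (a : Occ) {t t' : RuleTree} (u : RuleTree) :
      Swap t t' → Swap (.tens a t u) (.tens a t' u)
  | congr_tens_right (a : Occ) (t : RuleTree) {u u' : RuleTree} :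
      Swap u u' → Swap (.tens a t u) (.tens a t u')

/-- The proofs `p` and `q` have the same conclusion and, modulo exchange, either they are equal or
`q` is obtained from `p` by interchanging two consecutive rules. Since both `p` and `q` are proofs,
an interchange is allowed only when it leads to a proof. -/
def PermStep (p q : Σ Γ : List Formula, Proof Γ) : Prop :=
  p.1 = q.1 ∧ (p.2.ruleTree = q.2.ruleTree ∨ RuleTree.Swap p.2.ruleTree q.2.ruleTree)

/-- `π₁ ∼ π₂`: equivalence of proofs by rule permutations. -/
def Proof.PermEquiv {Γ₁ Γ₂ : List Formula} (π₁ : Proof Γ₁) (π₂ : Proof Γ₂) : Prop :=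
  Relation.EqvGen PermStep ⟨Γ₁, π₁⟩ ⟨Γ₂, π₂⟩

/-! ### Graphs -/

/-- Directed graphs, possibly with parallel arcs. -/
structure Digr : Type 1 where
  N : Type
  A : Type
  tail : A → N
  head : A → N

/-- `n 0, a 0, n 1, …, a (k - 1), n k` is a path; arcs may be crossed in either direction, and
no node is repeated, except that the two end nodes may coincide. -/
structure Digr.IsPath (G : Digr) {k : ℕ} (n : Fin (k + 1) → G.N) (a : Fin k → G.A) : Prop where
  ends : ∀ i : Fin k, (G.tail (a i) = n i.castSucc ∧ G.head (a i) = n i.succ) ∨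
    (G.tail (a i) = n i.succ ∧ G.head (a i) = n i.castSucc)
  nodes : ∀ i j : Fin (k + 1), i ≠ j → n i = n j →
    (i = 0 ∧ j = Fin.last k) ∨ (i = Fin.last k ∧ j = 0)
  arcs : ∀ h : 2 ≤ k, a ⟨0, by omega⟩ ≠ a ⟨k - 1, by omega⟩

/-- `G` has no cycle. -/
def Digr.Acyclic (G : Digr) : Prop :=
  ¬ ∃ (k : ℕ) (n : Fin (k + 1) → G.N) (a : Fin k → G.A),
    0 < k ∧ G.IsPath n a ∧ n 0 = n (Fin.last k)

/-- The set of connected components of `G`. -/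
def Digr.CC (G : Digr) : Type := Quot fun m n : G.N => ∃ a, G.tail a = m ∧ G.head a = n

/-! ### Proof-structures with jumps -/

/-- Labels of the nodes of cut-free proof-structures; `bullet` marks the conclusions. -/
inductive Label : Type
  | ax | one | bot | tens | par | bullet

/-- Number of premises of a node. -/
def Label.arity : Label → ℕ
  | .ax | .one | .bot => 0
  | .tens | .par => 2
  | .bullet => 1

/-- Number of conclusions of a node. -/
def Label.coarity : Label → ℕ
  | .ax => 2
  | .one | .bot | .tens | .par => 1
  | .bullet => 0

/-- The data of a proof-structure: nodes and arcs, with labels of the nodes; the left and the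
right premises of nodes; the sequence of the conclusions; the types of the arcs; the
partial jump function. The laws are in `PreStructure.IsPS`. -/
structure PreStructure : Type 1 where
  N : Type
  A : Type
  label : N → Label
  tail : A → N
  head : A → N
  left : N → Option A
  right : N → Option A
  concl : List A
  type : A → Formula
  jump : N → Option N

namespace PreStructure

/-- `R` is a (cut-free) proof-structure of the fragment `F`. -/
structure IsPS (F : Set Formula) (R : PreStructure) : Prop where
  finite_N : Finite R.N
  finite_A : Finite R.A
  dag : ∀ n, ¬ Relation.TransGen (fun m m' => ∃ a, R.tail a = m ∧ R.head a = m') n n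
  arity : ∀ n, {a | R.head a = n}.ncard = (R.label n).arity
  coarity : ∀ n, {a | R.tail a = n}.ncard = (R.label n).coarity
  /-- the premises of `⊗` and `⅋` nodes are ordered -/
  premises : ∀ n, R.label n = .tens ∨ R.label n = .par →
    ∃ a b, R.left n = some a ∧ R.right n = some b ∧ a ≠ b ∧ R.head a = n ∧ R.head b = n
  no_premises : ∀ n, R.label n ≠ .tens → R.label n ≠ .par → R.left n = none ∧ R.right n = none
  /-- the conclusions are totally ordered -/
  concl_nodup : R.concl.Nodup
  mem_concl : ∀ a, a ∈ R.concl ↔ R.label (R.head a) = .bullet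
  type_ax : ∀ a b, R.tail a = R.tail b → R.label (R.tail a) = .ax → a ≠ b →
    R.type a = (R.type b).dual
  type_one : ∀ a, R.label (R.tail a) = .one → R.type a = .one
  type_bot : ∀ a, R.label (R.tail a) = .bot → R.type a = .bot
  type_tens : ∀ a b c, R.label (R.tail a) = .tens → R.left (R.tail a) = some b →
    R.right (R.tail a) = some c → R.type a = .tens (R.type b) (R.type c)
  type_par : ∀ a b c, R.label (R.tail a) = .par → R.left (R.tail a) = some b →
    R.right (R.tail a) = some c → R.type a = .par (R.type b) (R.type c)
  type_mem : ∀ a, R.type a ∈ F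
  /-- jumps start from `⊥` nodes, and, like all arcs, they have distinct ends -/
  jump_bot : ∀ n m, R.jump n = some m → R.label n = .bot ∧ n ≠ m

/-- The domain of the jump function is the whole set of `⊥` nodes. -/
def JumpTotal (R : PreStructure) : Prop := ∀ n, R.label n = .bot → (R.jump n).isSome

/-- A switching chooses a premise of every `⅋` node. -/
def Switching (R : PreStructure) : Type :=
  (n : {n : R.N // R.label n = .par}) → {a : R.A // R.head a = n.1}

open Classical in
/-- The switching graph: for every `⅋` node there is a fresh node, which becomes the head of the
premise that is not chosen; for every `n` in the domain of the jump function there is an arc from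
`n` to its image. -/
noncomputable abbrev switchingGraph (R : PreStructure) (φ : R.Switching) : Digr where
  N := R.N ⊕ {n : R.N // R.label n = .par}
  A := R.A ⊕ {n : R.N // (R.jump n).isSome}
  tail
    | .inl a => .inl (R.tail a)
    | .inr n => .inl n.1
  head
    | .inl a =>
        if h : R.label (R.head a) = .par then
          if (φ ⟨R.head a, h⟩).1 = a then .inl (R.head a) else .inr ⟨R.head a, h⟩
        else .inl (R.head a)
    | .inr n => .inl ((R.jump n.1).get n.2)

/-- Every switching graph is acyclic and has exactly one connected component. -/
def ACC (R : PreStructure) : Prop :=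
  ∀ φ : R.Switching, (R.switchingGraph φ).Acyclic ∧ Nat.card (R.switchingGraph φ).CC = 1

/-- Jump-correct proof-structures of `MLL` with units. -/
def JumpCorrect (R : PreStructure) : Prop := R.IsPS Set.univ ∧ R.JumpTotal ∧ R.ACC

/-! ### Equality of proof-structures, rewiring -/

/-- Isomorphisms between the underlying jump-free proof-structures of `R` and `S`. -/
structure BaseIso (R S : PreStructure) where
  node : R.N ≃ S.N
  arc : R.A ≃ S.A
  label : ∀ n, S.label (node n) = R.label n
  tail : ∀ a, S.tail (arc a) = node (R.tail a)
  head : ∀ a, S.head (arc a) = node (R.head a)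
  left : ∀ n, S.left (node n) = (R.left n).map arc
  right : ∀ n, S.right (node n) = (R.right n).map arc
  concl : S.concl = R.concl.map arc
  type : ∀ a, S.type (arc a) = R.type a

/-- Equality of proof-structures: these are graphs whose nodes and arcs have no intrinsic identity,
so that equality means isomorphism. -/
def Same (R S : PreStructure) : Prop :=
  ∃ e : BaseIso R S, ∀ n, S.jump (e.node n) = (R.jump n).map e.node

/-- `S` is obtained from `R` by redirecting exactly one jump. -/
def Rewire (R S : PreStructure) : Prop :=
  ∃ (e : BaseIso R S) (n : R.N), (R.jump n).isSome ∧ (S.jump (e.node n)).isSome ∧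
    S.jump (e.node n) ≠ (R.jump n).map e.node ∧
    ∀ n', n' ≠ n → S.jump (e.node n') = (R.jump n').map e.node

/-- Equivalence by rewiring: the smallest equivalence relation between jump-correct
proof-structures (which are taken up to `Same`) that contains `Rewire`. -/
def RewireEquiv (R S : {R : PreStructure // R.JumpCorrect}) : Prop :=
  Relation.EqvGen (fun R S : {R : PreStructure // R.JumpCorrect} =>
    R.1.Same S.1 ∨ R.1.Rewire S.1) R S

/-! ### Desequentialization -/

/-- An `ax` node with conclusions of types `A` and `A^⊥`. -/
abbrev ax (A : Formula) : PreStructure where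
  N := Option Bool
  A := Bool
  label | none => .ax | some _ => .bullet
  tail _ := none
  head b := some b
  left _ := none
  right _ := none
  concl := [false, true]
  type | false => A | true => A.dual
  jump _ := none

/-- A `1` node. -/
abbrev one : PreStructure where
  N := Bool
  A := Unit
  label | false => .one | true => .bullet
  tail _ := false
  head _ := true
  left _ := none
  right _ := none
  concl := [()]
  type _ := .one
  jump _ := none

/-- Exchange of the conclusions at positions `i` and `i + 1`. -/
abbrev ex (i : ℕ) (R : PreStructure) : PreStructure := { R with concl := swapAt i R.concl }

/-- Disjoint union; the conclusions of `R` come before those of `S`. -/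
abbrev union (R S : PreStructure) : PreStructure where
  N := R.N ⊕ S.N
  A := R.A ⊕ S.A
  label := Sum.elim R.label S.label
  tail := Sum.map R.tail S.tail
  head := Sum.map R.head S.head
  left := Sum.elim (fun n => (R.left n).map .inl) fun n => (S.left n).map .inr
  right := Sum.elim (fun n => (R.right n).map .inl) fun n => (S.right n).map .inr
  concl := R.concl.map .inl ++ S.concl.map .inr
  type := Sum.elim R.type S.type
  jump := Sum.elim (fun n => (R.jump n).map .inl) fun n => (S.jump n).map .inr

/-- The node `n` is the head of one of the arcs `l` and `r`. -/
def Meets (R : PreStructure) (l r : Option R.A) (n : R.N) : Prop :=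
  ∃ a, (l = some a ∨ r = some a) ∧ R.head a = n

open Classical in
/-- The node `n` of `R` in the proof-structure `R.addNode …` below. -/
noncomputable def emb (R : PreStructure) (l r : Option R.A) (n : R.N) :
    {n : R.N // ¬ R.Meets l r n} ⊕ Bool :=
  if h : R.Meets l r n then .inr false else .inl ⟨n, h⟩

/-- A terminal node is added to `R`, with label `x`, left premise `l` and right premise `r` (if
any), a conclusion of type `F`, and a jump to `j` (if any). The new node is `.inr false`, and
`.inr true` is the `bullet` node below it. The `bullet` nodes below `l` and `r` disappear: these
arcs end in the new node. The new conclusion is placed between `Γ` and `Δ`. -/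
noncomputable abbrev addNode (R : PreStructure) (x : Label) (l r : Option R.A) (F : Formula)
    (j : Option R.N) (Γ Δ : List R.A) : PreStructure where
  N := {n : R.N // ¬ R.Meets l r n} ⊕ Bool
  A := Option R.A
  label
    | .inl n => R.label n.1
    | .inr false => x
    | .inr true => .bullet
  tail
    | some a => R.emb l r (R.tail a)
    | none => .inr false
  head
    | some a => R.emb l r (R.head a)
    | none => .inr true
  left
    | .inl n => (R.left n.1).map some
    | .inr false => l.map some
    | .inr true => none
  right
    | .inl n => (R.right n.1).map some
    | .inr false => r.map some
    | .inr true => none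
  concl := Γ.map some ++ none :: Δ.map some
  type
    | some a => R.type a
    | none => F
  jump
    | .inl n => (R.jump n.1).map (R.emb l r)
    | .inr false => j.map (R.emb l r)
    | .inr true => none

/-- A terminal `⊥` node is added, with a jump to `j` (if any). -/
noncomputable abbrev bot (R : PreStructure) (j : Option R.N) : PreStructure :=
  R.addNode .bot none none .bot j R.concl []

/-- A terminal `⅋` node is added, whose premises are the last two conclusions of `R`. -/
noncomputable abbrev par (A B : Formula) (R : PreStructure) : PreStructure :=
  R.addNode .par R.concl.dropLast.getLast? R.concl.getLast? (.par A B) none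
    R.concl.dropLast.dropLast []

/-- A terminal `⊗` node is added, whose premises are the last conclusion of `R` and the first
conclusion of `S`. -/
noncomputable abbrev tens (A B : Formula) (R S : PreStructure) : PreStructure :=
  (R.union S).addNode .tens (R.concl.getLast?.map .inl) (S.concl.head?.map .inr) (.tens A B) none
    (R.concl.dropLast.map .inl) (S.concl.tail.map .inr)

/-- No jump has as its target the `bullet` node below `l` or `r`. -/
def Avoids (R : PreStructure) (l r : Option R.A) : Prop :=
  ∀ n m, R.jump n = some m → ¬ R.Meets l r m

end PreStructure

/-- The desequentialization `π°`, a jump-free proof-structure. -/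
noncomputable def Proof.deseq : {Γ : List Formula} → Proof Γ → PreStructure
  | _, .ax A => .ax A
  | _, .ex Γ _ _ _ p => p.deseq.ex Γ.length
  | _, .tens _ A B _ p q => .tens A B p.deseq q.deseq
  | _, .one => .one
  | _, .par _ A B p => .par A B p.deseq
  | _, .bot _ p => p.deseq.bot none

/-- The relation `π ⟾ R` between proofs and jump-total proof-structures, which extends
desequentialization: the `⊥` node introduced by a `⊥` rule may jump to any node of the
proof-structure of the premise of the rule (a `bullet` node must not disappear later on if it is
the target of a jump). -/
inductive Proof.DeseqJump : {Γ : List Formula} → Proof Γ → PreStructure → Prop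
  | ax (A : Formula) : DeseqJump (.ax A) (.ax A)
  | ex (Γ : List Formula) (A B : Formula) (Δ : List Formula) (p : Proof (Γ ++ A :: B :: Δ))
      (R : PreStructure) : DeseqJump p R → DeseqJump (.ex Γ A B Δ p) (R.ex Γ.length)
  | tens (Γ : List Formula) (A B : Formula) (Δ : List Formula) (p : Proof (Γ ++ [A]))
      (q : Proof (B :: Δ)) (R S : PreStructure) : DeseqJump p R → DeseqJump q S →
      R.Avoids R.concl.getLast? none → S.Avoids none S.concl.head? →
      DeseqJump (.tens Γ A B Δ p q) (.tens A B R S)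
  | one : DeseqJump .one .one
  | par (Γ : List Formula) (A B : Formula) (p : Proof (Γ ++ [A, B])) (R : PreStructure) :
      DeseqJump p R → R.Avoids R.concl.dropLast.getLast? R.concl.getLast? →
      DeseqJump (.par Γ A B p) (.par A B R)
  | bot (Γ : List Formula) (p : Proof Γ) (R : PreStructure) (m : R.N) :
      DeseqJump p R → DeseqJump (.bot Γ p) (R.bot (some m))
  | same {Γ : List Formula} (p : Proof Γ) (R S : PreStructure) :
      DeseqJump p R → R.Same S → DeseqJump p S

end MLL

open MLL

namespace MLL

/-! ### Occurrences -/

/-- The immediate subformula occurrence on the given side. -/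
def Occ.child (a : Occ) (b : Bool) : Occ := (a.1, b :: a.2)

theorem Occ.l_eq_child (a : Occ) : a.l = a.child false := rfl

theorem Occ.r_eq_child (a : Occ) : a.r = a.child true := rfl

/-- The immediate subformula on the given side. -/
def Formula.child : Formula → Bool → Formula
  | .tens A B, b => cond b B A
  | .par A B, b => cond b B A
  | .atom i c, _ => .atom i c
  | .one, _ => .one
  | .bot, _ => .bot

/-- The subformula at the end of a path. -/
def Formula.subAt (F : Formula) : List Bool → Formula
  | [] => F
  | b :: p => (F.subAt p).child b

/-- The subformula of the sequent `Θ` at an occurrence. -/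
def ty (Θ : List Formula) (a : Occ) : Formula := (Θ.getD a.1 .one).subAt a.2

theorem ty_child (Θ : List Formula) (a : Occ) (b : Bool) :
    ty Θ (a.child b) = (ty Θ a).child b := rfl

theorem ty_l {Θ : List Formula} {a : Occ} {A B : Formula}
    (h : ty Θ a = .tens A B ∨ ty Θ a = .par A B) : ty Θ a.l = A := by
  rcases h with h | h <;> simp [Occ.l_eq_child, ty_child, h, Formula.child]

theorem ty_r {Θ : List Formula} {a : Occ} {A B : Formula}
    (h : ty Θ a = .tens A B ∨ ty Θ a = .par A B) : ty Θ a.r = B := by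
  rcases h with h | h <;> simp [Occ.r_eq_child, ty_child, h, Formula.child]

/-- The occurrence `x` is inside the occurrence `v`. -/
def Above (v x : Occ) : Prop := v.1 = x.1 ∧ v.2 <:+ x.2

theorem Above.refl (v : Occ) : Above v v := ⟨rfl, List.suffix_rfl⟩

theorem Above.trans {u v w : Occ} (h : Above u v) (h' : Above v w) : Above u w :=
  ⟨h.1.trans h'.1, h.2.trans h'.2⟩

theorem above_child (v : Occ) (b : Bool) : Above v (v.child b) := ⟨rfl, List.suffix_cons _ _⟩

theorem not_child_above (v : Occ) (b : Bool) : ¬ Above (v.child b) v := fun h => by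
  have := h.2.length_le
  simp [Occ.child] at this

theorem Above.of_child {v x : Occ} {b : Bool} (h : Above v (x.child b)) :
    v = x.child b ∨ Above v x := by
  obtain ⟨h1, h2⟩ := h
  rcases List.suffix_cons_iff.1 h2 with h2 | h2
  · exact Or.inl (Prod.ext h1 h2)
  · exact Or.inr ⟨h1, h2⟩

/-- Paths list their last step first, so being inside is the suffix order, and two suffixes of one
list are comparable. -/
theorem Above.total {v w z : Occ} (h : Above v z) (h' : Above w z) : Above v w ∨ Above w v := by
  rcases List.suffix_or_suffix_of_suffix h.2 h'.2 with h2 | h2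
  · exact Or.inl ⟨h.1.trans h'.1.symm, h2⟩
  · exact Or.inr ⟨h'.1.trans h.1.symm, h2⟩

theorem Occ.child_inj {v w : Occ} {b c : Bool} : v.child b = w.child c ↔ v = w ∧ b = c := by
  obtain ⟨i, p⟩ := v
  obtain ⟨j, q⟩ := w
  simp only [Occ.child, Prod.mk.injEq, List.cons.injEq]
  tauto

/-- Distinct occurrences in `S` are disjoint. -/
def Anti (S : Multiset Occ) : Prop := S.Nodup ∧ ∀ v ∈ S, ∀ w ∈ S, Above v w → v = w

/-- The occurrences inside members of `S`. -/
def Cone (S : Multiset Occ) : Set Occ := {x | ∃ v ∈ S, Above v x}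

theorem mem_cone_of_mem {S : Multiset Occ} {x : Occ} (h : x ∈ S) : x ∈ Cone S :=
  ⟨x, h, Above.refl x⟩

theorem child_mem_cone {S : Multiset Occ} {x : Occ} (b : Bool) (h : x ∈ Cone S) :
    x.child b ∈ Cone S := by
  obtain ⟨v, hv, h⟩ := h
  exact ⟨v, hv, h.trans (above_child x b)⟩

theorem cone_mono {S T : Multiset Occ} (h : ∀ v ∈ S, v ∈ Cone T) : Cone S ⊆ Cone T := by
  rintro x ⟨v, hv, hx⟩
  obtain ⟨w, hw, hv⟩ := h v hv
  exact ⟨w, hw, hv.trans hx⟩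

theorem Anti.mono {S T : Multiset Occ} (h : Anti T) (hST : S ≤ T) : Anti S :=
  ⟨Multiset.nodup_of_le hST h.1, fun v hv w hw =>
    h.2 v (Multiset.mem_of_le hST hv) w (Multiset.mem_of_le hST hw)⟩

theorem Anti.of_cons {S : Multiset Occ} {x : Occ} (h : Anti (x ::ₘ S)) : Anti S :=
  h.mono (Multiset.le_cons_self S x)

theorem Anti.eq {S : Multiset Occ} (h : Anti S) {v w z : Occ} (hv : v ∈ S) (hw : w ∈ S)
    (hvz : Above v z) (hwz : Above w z) : v = w := by
  rcases hvz.total hwz with h' | h'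
  · exact h.2 v hv w hw h'
  · exact (h.2 w hw v hv h').symm

theorem Anti.disjoint {S T : Multiset Occ} (h : Anti (S + T)) : Disjoint (Cone S) (Cone T) := by
  rw [Set.disjoint_left]
  rintro z ⟨v, hv, hvz⟩ ⟨w, hw, hwz⟩
  have := h.eq (Multiset.mem_add.2 (Or.inl hv)) (Multiset.mem_add.2 (Or.inr hw)) hvz hwz
  subst this
  exact (Multiset.disjoint_left.1 (Multiset.nodup_add.1 h.1).2.2) hv hw

theorem Anti.disjoint_cons {S : Multiset Occ} {x : Occ} (h : Anti (x ::ₘ S)) {z : Occ}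
    (hz : Above x z) : z ∉ Cone S := fun hS =>
  Set.disjoint_left.1 (Anti.disjoint (S := {x}) (T := S) h) ⟨x, by simp, hz⟩ hS

/-- The disjointness of the conclusions passes to the premises of the rules, which lets inductions
on proofs carry it along. An occurrence comparable with a child of `x` would put a common point in
the cones of `x` and of `S`. -/
theorem Anti.par {S : Multiset Occ} {x : Occ} (h : Anti (x ::ₘ S)) :
    Anti (x.l ::ₘ x.r ::ₘ S) := by
  have key : ∀ b, ∀ v ∈ S, ¬ Above (x.child b) v ∧ ¬ Above v (x.child b) := by
    intro b v hv
    refine ⟨fun h' => h.disjoint_cons ((above_child x b).trans h') (mem_cone_of_mem hv),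
      fun h' => h.disjoint_cons (above_child x b) ⟨v, hv, h'⟩⟩
  have hlr : ∀ b c, Above (x.child b) (x.child c) → b = c := by
    intro b c hbc
    rcases hbc.of_child with h' | h'
    · exact (Occ.child_inj.1 h').2
    · exact absurd h' (not_child_above _ _)
  have hS := h.of_cons
  rw [Occ.l_eq_child, Occ.r_eq_child]
  have hlr' : Above (x.child false) (x.child true) → False := fun h => by simpa using hlr _ _ h
  have hrl' : Above (x.child true) (x.child false) → False := fun h => by simpa using hlr _ _ h
  refine ⟨?_, ?_⟩
  · rw [Multiset.nodup_cons, Multiset.nodup_cons]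
    refine ⟨fun hm => ?_, fun hm => (key true _ hm).1 (Above.refl _), hS.1⟩
    rcases Multiset.mem_cons.1 hm with hm | hm
    · rw [Occ.child_inj] at hm
      simp at hm
    · exact (key false _ hm).1 (Above.refl _)
  · intro v hv w hw hvw
    simp only [Multiset.mem_cons] at hv hw
    rcases hv with rfl | rfl | hv <;> rcases hw with rfl | rfl | hw
    · rfl
    · exact (hlr' hvw).elim
    · exact absurd hvw (key _ _ hw).1
    · exact (hrl' hvw).elim
    · rfl
    · exact absurd hvw (key _ _ hw).1
    · exact absurd hvw (key _ _ hv).2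
    · exact absurd hvw (key _ _ hv).2
    · exact hS.2 v hv w hw hvw

theorem cons_add_cons (x y : Occ) (S T : Multiset Occ) :
    (x ::ₘ S) + (y ::ₘ T) = x ::ₘ y ::ₘ (S + T) := by
  rw [Multiset.cons_add, Multiset.add_cons]

theorem Anti.tens {S T : Multiset Occ} {x : Occ} (h : Anti (x ::ₘ (S + T))) :
    Anti ((x.l ::ₘ S) + (x.r ::ₘ T)) := by
  rw [cons_add_cons]
  exact h.par

theorem Anti.tens_left {S T : Multiset Occ} {x : Occ} (h : Anti (x ::ₘ (S + T))) :
    Anti (x.l ::ₘ S) := h.tens.mono (Multiset.le_add_right _ _)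

theorem Anti.tens_right {S T : Multiset Occ} {x : Occ} (h : Anti (x ::ₘ (S + T))) :
    Anti (x.r ::ₘ T) := h.tens.mono (Multiset.le_add_left _ _)

theorem Anti.not_mem_cone {S : Multiset Occ} {x : Occ} (h : Anti (x ::ₘ S)) : x ∉ Cone S :=
  h.disjoint_cons (Above.refl x)

theorem cone_par {S : Multiset Occ} {x : Occ} :
    Cone (x.l ::ₘ x.r ::ₘ S) ⊆ Cone (x ::ₘ S) := by
  refine cone_mono fun v hv => ?_
  simp only [Multiset.mem_cons] at hv
  rcases hv with rfl | rfl | hv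
  · exact ⟨x, by simp, above_child x _⟩
  · exact ⟨x, by simp, above_child x _⟩
  · exact mem_cone_of_mem (by simp [hv])

theorem cone_le {S T : Multiset Occ} (h : S ≤ T) : Cone S ⊆ Cone T :=
  cone_mono fun _ hv => mem_cone_of_mem (Multiset.mem_of_le h hv)

theorem cone_tens_left {S T : Multiset Occ} {x : Occ} :
    Cone (x.l ::ₘ S) ⊆ Cone (x ::ₘ (S + T)) :=
  (cone_le (by rw [← cons_add_cons]; exact Multiset.le_add_right _ _)).trans cone_par

theorem cone_tens_right {S T : Multiset Occ} {x : Occ} :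
    Cone (x.r ::ₘ T) ⊆ Cone (x ::ₘ (S + T)) :=
  (cone_le (by rw [← cons_add_cons]; exact Multiset.le_add_left _ _)).trans cone_par

/-- Together with `Der.occs_subset`, this keeps the principal occurrence of a `⅋` rule out of
everything above the rule. -/
theorem Anti.not_mem_cone_par {S : Multiset Occ} {x : Occ} (h : Anti (x ::ₘ S)) :
    x ∉ Cone (x.l ::ₘ x.r ::ₘ S) := by
  rintro ⟨v, hv, hx⟩
  simp only [Multiset.mem_cons] at hv
  rcases hv with rfl | rfl | hv
  · exact not_child_above _ _ hx
  · exact not_child_above _ _ hx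
  · exact h.not_mem_cone ⟨v, hv, hx⟩

theorem Anti.not_mem_cone_left {S T : Multiset Occ} {x : Occ} (h : Anti (x ::ₘ (S + T))) :
    x ∉ Cone (x.l ::ₘ S) := fun hx => h.not_mem_cone_par
  (cone_le (by rw [← cons_add_cons]; exact Multiset.le_add_right _ _) hx)

theorem Anti.not_mem_cone_right {S T : Multiset Occ} {x : Occ} (h : Anti (x ::ₘ (S + T))) :
    x ∉ Cone (x.r ::ₘ T) := fun hx => h.not_mem_cone_par
  (cone_le (by rw [← cons_add_cons]; exact Multiset.le_add_left _ _) hx)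

/-! ### Rule trees -/

namespace RuleTree

/-- The axiom links of a rule tree. -/
def links : RuleTree → Set (Sym2 Occ)
  | .ax s => {s}
  | .one _ => ∅
  | .bot _ t => t.links
  | .par _ t => t.links
  | .tens _ t u => t.links ∪ u.links

/-- The principal occurrences of the rules other than axioms. -/
def rules : RuleTree → Set Occ
  | .ax _ => ∅
  | .one a => {a}
  | .bot a t => insert a t.rules
  | .par a t => insert a t.rules
  | .tens a t u => insert a (t.rules ∪ u.rules)

/-- The occurrences in the sequents of a rule tree. -/
def occs (t : RuleTree) : Set Occ := {x | x ∈ t.rules ∨ ∃ s ∈ t.links, x ∈ s}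

/-- The number of rules. -/
def size : RuleTree → ℕ
  | .ax _ => 1
  | .one _ => 1
  | .bot _ t => t.size + 1
  | .par _ t => t.size + 1
  | .tens _ t u => t.size + u.size + 1

theorem Swap.links_eq {t t' : RuleTree} (h : t.Swap t') : t.links = t'.links := by
  induction h <;> simp_all [links, Set.union_assoc, Set.union_comm, Set.union_left_comm]

theorem Swap.rules_eq {t t' : RuleTree} (h : t.Swap t') : t.rules = t'.rules := by
  induction h <;> simp_all [rules] <;> ext x <;> simp <;> tauto

theorem Swap.size_eq {t t' : RuleTree} (h : t.Swap t') : t.size = t'.size := by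
  induction h <;> simp_all [size] <;> omega

end RuleTree

/-- `Der Θ S t`: the tree `t` is a proof modulo exchange, whose conclusions are the members of
`S`. -/
inductive Der (Θ : List Formula) : Multiset Occ → RuleTree → Prop
  | ax (x y : Occ) : ty Θ y = (ty Θ x).dual → Der Θ (x ::ₘ y ::ₘ 0) (.ax s(x, y))
  | one (x : Occ) : ty Θ x = .one → Der Θ (x ::ₘ 0) (.one x)
  | bot (x : Occ) (S : Multiset Occ) (t : RuleTree) : ty Θ x = .bot → Der Θ S t →
      Der Θ (x ::ₘ S) (.bot x t)
  | par (x : Occ) (A B : Formula) (S : Multiset Occ) (t : RuleTree) : ty Θ x = .par A B →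
      Der Θ (x.l ::ₘ x.r ::ₘ S) t → Der Θ (x ::ₘ S) (.par x t)
  | tens (x : Occ) (A B : Formula) (S T : Multiset Occ) (t u : RuleTree) : ty Θ x = .tens A B →
      Der Θ (x.l ::ₘ S) t → Der Θ (x.r ::ₘ T) u → Der Θ (x ::ₘ (S + T)) (.tens x t u)

variable {Θ : List Formula}

/-- Read upwards, rules only decompose formulae. Hence proofs of disjoint conclusions share no
occurrence, and the two premises of a `⊗` never interfere. -/
theorem Der.occs_subset {S : Multiset Occ} {t : RuleTree} (h : Der Θ S t) :
    t.occs ⊆ Cone S := by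
  induction h with
  | ax x y h =>
    rintro z (hz | ⟨s, hs, hz⟩)
    · exact hz.elim
    · rw [RuleTree.links, Set.mem_singleton_iff] at hs
      subst hs
      exact mem_cone_of_mem (by simpa using Sym2.mem_iff.1 hz)
  | one x h =>
    rintro z (hz | ⟨s, hs, hz⟩)
    · exact mem_cone_of_mem (by simpa [RuleTree.rules] using hz)
    · exact hs.elim
  | bot x S t h _ ih =>
    rintro z (hz | hz)
    · rcases hz with rfl | hz
      · exact mem_cone_of_mem (by simp)
      · exact cone_le (Multiset.le_cons_self _ _) (ih (Or.inl hz))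
    · exact cone_le (Multiset.le_cons_self _ _) (ih (Or.inr hz))
  | par x A B S t h _ ih =>
    rintro z (hz | hz)
    · rcases hz with rfl | hz
      · exact mem_cone_of_mem (by simp)
      · exact cone_par (ih (Or.inl hz))
    · exact cone_par (ih (Or.inr hz))
  | tens x A B S T t u h _ _ ih1 ih2 =>
    rintro z (hz | ⟨s, hs | hs, hz⟩)
    · rcases hz with rfl | hz | hz
      · exact mem_cone_of_mem (by simp)
      · exact cone_tens_left (ih1 (Or.inl hz))
      · exact cone_tens_right (ih2 (Or.inl hz))
    · exact cone_tens_left (ih1 (Or.inr ⟨s, hs, hz⟩))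
    · exact cone_tens_right (ih2 (Or.inr ⟨s, hs, hz⟩))

theorem Der.links_cone {S : Multiset Occ} {t : RuleTree} (h : Der Θ S t) {s : Sym2 Occ} {y : Occ}
    (hs : s ∈ t.links) (hy : y ∈ s) : y ∈ Cone S := h.occs_subset (Or.inr ⟨s, hs, hy⟩)

/-- There is no weakening: a conclusion is carried upwards until it is principal or belongs to an
axiom. -/
theorem Der.mem_occs {S : Multiset Occ} {t : RuleTree} (h : Der Θ S t) :
    ∀ x ∈ S, x ∈ t.occs := by
  induction h with
  | ax x y h =>
    intro z hz
    exact Or.inr ⟨_, rfl, by simpa using hz⟩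
  | one x h =>
    intro z hz
    exact Or.inl (by simpa [RuleTree.rules] using hz)
  | bot x S t h _ ih =>
    intro z hz
    rcases Multiset.mem_cons.1 hz with rfl | hz
    · exact Or.inl (Or.inl rfl)
    · exact (ih z hz).imp Or.inr id
  | par x A B S t h _ ih =>
    intro z hz
    rcases Multiset.mem_cons.1 hz with rfl | hz
    · exact Or.inl (Or.inl rfl)
    · exact (ih z (by simp [hz])).imp Or.inr id
  | tens x A B S T t u h _ _ ih1 ih2 =>
    intro z hz
    rcases Multiset.mem_cons.1 hz with rfl | hz
    · exact Or.inl (Or.inl rfl)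
    · rcases Multiset.mem_add.1 hz with hz | hz
      · rcases ih1 z (by simp [hz]) with h | ⟨s, hs, h⟩
        · exact Or.inl (Or.inr (Or.inl h))
        · exact Or.inr ⟨s, Or.inl hs, h⟩
      · rcases ih2 z (by simp [hz]) with h | ⟨s, hs, h⟩
        · exact Or.inl (Or.inr (Or.inr h))
        · exact Or.inr ⟨s, Or.inr hs, h⟩

/-! ### Equivalence of rule trees -/

/-- Equivalence of trees by interchanges of rules, through proofs with conclusions `S`. -/
def Eqv (Θ : List Formula) (S : Multiset Occ) : RuleTree → RuleTree → Prop :=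
  Relation.EqvGen fun t t' => Der Θ S t ∧ Der Θ S t' ∧ t.Swap t'

theorem Eqv.refl (S : Multiset Occ) (t : RuleTree) : Eqv Θ S t t := Relation.EqvGen.refl t

theorem Eqv.symm {S : Multiset Occ} {t t' : RuleTree} (h : Eqv Θ S t t') : Eqv Θ S t' t :=
  Relation.EqvGen.symm _ _ h

theorem Eqv.trans {S : Multiset Occ} {t u v : RuleTree} (h : Eqv Θ S t u) (h' : Eqv Θ S u v) :
    Eqv Θ S t v := Relation.EqvGen.trans _ _ _ h h'

theorem Eqv.of {S : Multiset Occ} {t t' : RuleTree} (h : Der Θ S t) (h' : Der Θ S t')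
    (hs : t.Swap t' ∨ t'.Swap t) : Eqv Θ S t t' := by
  rcases hs with hs | hs
  · exact Relation.EqvGen.rel _ _ ⟨h, h', hs⟩
  · exact (Relation.EqvGen.rel _ _ ⟨h', h, hs⟩ : Eqv Θ S t' t).symm

theorem Eqv.map {S S' : Multiset Occ} {F : RuleTree → RuleTree}
    (hs : ∀ t t', t.Swap t' → (F t).Swap (F t')) (hd : ∀ t, Der Θ S t → Der Θ S' (F t))
    {t t' : RuleTree} (h : Eqv Θ S t t') : Eqv Θ S' (F t) (F t') := by
  induction h with
  | rel t t' h => exact Relation.EqvGen.rel _ _ ⟨hd _ h.1, hd _ h.2.1, hs _ _ h.2.2⟩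
  | refl t => exact Eqv.refl _ _
  | symm _ _ _ ih => exact ih.symm
  | trans _ _ _ _ _ ih ih' => exact ih.trans ih'

theorem Eqv.der_iff {S : Multiset Occ} {t t' : RuleTree} (h : Eqv Θ S t t') :
    Der Θ S t ↔ Der Θ S t' := by
  induction h with
  | rel t t' h => exact ⟨fun _ => h.2.1, fun _ => h.1⟩
  | refl t => exact Iff.rfl
  | symm _ _ _ ih => exact ih.symm
  | trans _ _ _ _ _ ih ih' => exact ih.trans ih'

theorem Eqv.invariant {α : Type} {S : Multiset Occ} (f : RuleTree → α)
    (hf : ∀ t t', t.Swap t' → f t = f t') {t t' : RuleTree} (h : Eqv Θ S t t') : f t = f t' := by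
  induction h with
  | rel t t' h => exact hf _ _ h.2.2
  | refl t => rfl
  | symm _ _ _ ih => exact ih.symm
  | trans _ _ _ _ _ ih ih' => exact ih.trans ih'

theorem Eqv.links_eq {S : Multiset Occ} {t t' : RuleTree} (h : Eqv Θ S t t') :
    t.links = t'.links := h.invariant _ fun _ _ h => h.links_eq

theorem Eqv.rules_eq {S : Multiset Occ} {t t' : RuleTree} (h : Eqv Θ S t t') :
    t.rules = t'.rules := h.invariant _ fun _ _ h => h.rules_eq

theorem Eqv.size_eq {S : Multiset Occ} {t t' : RuleTree} (h : Eqv Θ S t t') :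
    t.size = t'.size := h.invariant _ fun _ _ h => h.size_eq

theorem Eqv.tens_left {a : Occ} {A B : Formula} {S T : Multiset Occ} {t t' u : RuleTree}
    (ha : ty Θ a = .tens A B) (hu : Der Θ (a.r ::ₘ T) u) (h : Eqv Θ (a.l ::ₘ S) t t') :
    Eqv Θ (a ::ₘ (S + T)) (.tens a t u) (.tens a t' u) :=
  h.map (F := fun t => .tens a t u) (fun _ _ h => .congr_tens_left a u h)
    fun t ht => .tens a A B S T t u ha ht hu

theorem Eqv.tens_right {a : Occ} {A B : Formula} {S T : Multiset Occ} {t u u' : RuleTree}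
    (ha : ty Θ a = .tens A B) (ht : Der Θ (a.l ::ₘ S) t) (h : Eqv Θ (a.r ::ₘ T) u u') :
    Eqv Θ (a ::ₘ (S + T)) (.tens a t u) (.tens a t u') :=
  h.map (F := fun u => .tens a t u) (fun _ _ h => .congr_tens_right a t h)
    fun u hu => .tens a A B S T t u ha ht hu

/-! ### Inversion of the `⊥` and `⅋` rules -/

/-- `K` is the rule whose principal occurrence `a` is a `⊥` or a `⅋`, and `pre` the multiset of
the active occurrences of its premise. -/
def NegRule (Θ : List Formula) (a : Occ) (pre : Multiset Occ) (K : RuleTree → RuleTree) : Prop :=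
  (ty Θ a = .bot ∧ pre = 0 ∧ K = .bot a) ∨
    ((∃ A B, ty Θ a = .par A B) ∧ pre = a.l ::ₘ a.r ::ₘ 0 ∧ K = .par a)

namespace NegRule

variable {a : Occ} {pre : Multiset Occ} {K : RuleTree → RuleTree}

theorem der (hK : NegRule Θ a pre K) {S : Multiset Occ} {t : RuleTree} (h : Der Θ (pre + S) t) :
    Der Θ (a ::ₘ S) (K t) := by
  rcases hK with ⟨ha, rfl, rfl⟩ | ⟨⟨A, B, ha⟩, rfl, rfl⟩
  · exact .bot a S t ha (by simpa using h)
  · exact .par a A B S t ha (by simpa using h)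

theorem swap_bot (hK : NegRule Θ a pre K) (b : Occ) (t : RuleTree) :
    (RuleTree.bot b (K t)).Swap (K (.bot b t)) ∨ (K (.bot b t)).Swap (RuleTree.bot b (K t)) := by
  rcases hK with ⟨ha, rfl, rfl⟩ | ⟨⟨A, B, ha⟩, rfl, rfl⟩
  · exact Or.inl (.bot_bot _ _ _)
  · exact Or.inl (.bot_par _ _ _)

theorem swap_par (hK : NegRule Θ a pre K) (b : Occ) (t : RuleTree) :
    (RuleTree.par b (K t)).Swap (K (.par b t)) ∨ (K (.par b t)).Swap (RuleTree.par b (K t)) := by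
  rcases hK with ⟨ha, rfl, rfl⟩ | ⟨⟨A, B, ha⟩, rfl, rfl⟩
  · exact Or.inr (.bot_par _ _ _)
  · exact Or.inl (.par_par _ _ _)

theorem swap_tens_left (hK : NegRule Θ a pre K) (b : Occ) (t u : RuleTree) :
    (K (.tens b t u)).Swap (.tens b (K t) u) := by
  rcases hK with ⟨ha, rfl, rfl⟩ | ⟨⟨A, B, ha⟩, rfl, rfl⟩
  · exact .bot_tens_left _ _ _ _
  · exact .par_tens_left _ _ _ _

theorem swap_tens_right (hK : NegRule Θ a pre K) (b : Occ) (t u : RuleTree) :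
    (K (.tens b t u)).Swap (.tens b t (K u)) := by
  rcases hK with ⟨ha, rfl, rfl⟩ | ⟨⟨A, B, ha⟩, rfl, rfl⟩
  · exact .bot_tens_right _ _ _ _
  · exact .par_tens_right _ _ _ _

theorem congr (hK : NegRule Θ a pre K) {S : Multiset Occ} {t t' : RuleTree}
    (h : Eqv Θ (pre + S) t t') : Eqv Θ (a ::ₘ S) (K t) (K t') := by
  refine h.map (fun t t' hs => ?_) fun t ht => hK.der ht
  rcases hK with ⟨ha, rfl, rfl⟩ | ⟨⟨A, B, ha⟩, rfl, rfl⟩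
  · exact .congr_bot _ hs
  · exact .congr_par _ hs

theorem size (hK : NegRule Θ a pre K) (t : RuleTree) : (K t).size = t.size + 1 := by
  rcases hK with ⟨ha, rfl, rfl⟩ | ⟨⟨A, B, ha⟩, rfl, rfl⟩ <;> rfl

theorem links (hK : NegRule Θ a pre K) (t : RuleTree) : (K t).links = t.links := by
  rcases hK with ⟨ha, rfl, rfl⟩ | ⟨⟨A, B, ha⟩, rfl, rfl⟩ <;> rfl

theorem anti (hK : NegRule Θ a pre K) {S : Multiset Occ} (h : Anti (a ::ₘ S)) :
    Anti (pre + S) := by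
  rcases hK with ⟨ha, rfl, rfl⟩ | ⟨⟨A, B, ha⟩, rfl, rfl⟩
  · simpa using h.of_cons
  · simpa using h.par

theorem cone (hK : NegRule Θ a pre K) {S : Multiset Occ} : Cone (pre + S) ⊆ Cone (a ::ₘ S) := by
  rcases hK with ⟨ha, rfl, rfl⟩ | ⟨⟨A, B, ha⟩, rfl, rfl⟩
  · simpa using cone_le (Multiset.le_cons_self _ _)
  · simpa using cone_par

/-- A `⊥` or `⅋` conclusion that belongs to no axiom can be introduced by the last rule. -/
theorem invert (hK : NegRule Θ a pre K) (t : RuleTree) : ∀ S : Multiset Occ, Der Θ (a ::ₘ S) t →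
    (∀ s ∈ t.links, a ∉ s) → ∃ t', Der Θ (pre + S) t' ∧ Eqv Θ (a ::ₘ S) t (K t') := by
  induction t with
  | ax s =>
    intro S h hl
    -- Axioms are not restricted to atoms, so a `⅋` may also come from an axiom; `hl` excludes this.
    exfalso
    generalize hM : a ::ₘ S = M at h
    cases h with
    | ax x y hxy =>
      refine hl _ rfl ?_
      have : a ∈ x ::ₘ y ::ₘ (0 : Multiset Occ) := by rw [← hM]; simp
      simpa using this
  | one b =>
    intro S h hl
    exfalso
    generalize hM : a ::ₘ S = M at h
    cases h with
    | one x hx =>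
      have : a ∈ b ::ₘ (0 : Multiset Occ) := by rw [← hM]; simp
      simp only [Multiset.mem_cons, Multiset.notMem_zero, or_false] at this
      subst this
      rcases hK with ⟨ha, -⟩ | ⟨⟨A, B, ha⟩, -⟩ <;> simp [ha] at hx
  | bot b t ih =>
    intro S h hl
    generalize hM : a ::ₘ S = M at h
    cases h with
    | bot _ S' _ hb ht =>
      -- Either the last rule already introduces `a`, or `a` is a side formula. In the second case
      -- the rule for `a` is brought to the bottom of the premise by induction, and then
      -- interchanged with the last rule.
      rcases Multiset.cons_eq_cons.1 hM with ⟨rfl, rfl⟩ | ⟨hne, cs, rfl, rfl⟩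
      · rcases hK with ⟨ha, rfl, rfl⟩ | ⟨⟨A, B, ha⟩, -⟩
        · exact ⟨t, by simpa using ht, Eqv.refl _ _⟩
        · simp [ha] at hb
      · obtain ⟨t', ht', he⟩ := ih _ ht hl
        have h1 : Der Θ (pre + b ::ₘ cs) (.bot b t') := by
          rw [Multiset.add_cons]
          exact .bot b _ t' hb ht'
        refine ⟨.bot b t', h1, ?_⟩
        refine Eqv.trans (he.map (fun _ _ => .congr_bot b) fun t ht => ?_)
          (.of ?_ (by rw [Multiset.cons_swap]; exact hK.der h1) (hK.swap_bot b t'))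
        · exact .bot b _ t hb ht
        · exact .bot b _ _ hb (hK.der ht')
  | par b t ih =>
    intro S h hl
    generalize hM : a ::ₘ S = M at h
    cases h with
    | par _ A B S' _ hb ht =>
      rcases Multiset.cons_eq_cons.1 hM with ⟨rfl, rfl⟩ | ⟨hne, cs, rfl, rfl⟩
      · rcases hK with ⟨ha, rfl, rfl⟩ | ⟨⟨A, B, ha⟩, rfl, rfl⟩
        · simp [ha] at hb
        · exact ⟨t, by simpa using ht, Eqv.refl _ _⟩
      · have hsw : ∀ X : Multiset Occ, b.l ::ₘ b.r ::ₘ a ::ₘ X = a ::ₘ b.l ::ₘ b.r ::ₘ X := by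
          intro X
          rw [Multiset.cons_swap b.r, Multiset.cons_swap b.l]
        rw [hsw] at ht
        obtain ⟨t', ht', he⟩ := ih _ ht hl
        have h1 : Der Θ (pre + b ::ₘ cs) (.par b t') := by
          rw [Multiset.add_cons]
          refine .par b A B _ t' hb ?_
          simpa [Multiset.add_cons] using ht'
        refine ⟨.par b t', h1, ?_⟩
        refine Eqv.trans (he.map (fun _ _ => .congr_par b) fun t ht => ?_)
          (.of ?_ (by rw [Multiset.cons_swap]; exact hK.der h1) (hK.swap_par b t'))
        · exact .par b A B _ t hb (by rwa [hsw])
        · exact .par b A B _ _ hb (by rw [hsw]; exact hK.der ht')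
  | tens b v w ihv ihw =>
    intro S h hl
    generalize hM : a ::ₘ S = M at h
    cases h with
    | tens _ A B S1 T1 _ _ hb hv hw =>
      rcases Multiset.cons_eq_cons.1 hM with ⟨rfl, rfl⟩ | ⟨hne, cs, rfl, h2⟩
      · rcases hK with ⟨ha, -⟩ | ⟨⟨A, B, ha⟩, -⟩ <;> simp [ha] at hb
      · have ha : a ∈ S1 + T1 := by rw [h2]; simp
        -- The side formula `a` goes to one of the premises, and the rule for `a` is pulled out of
        -- that one.
        rcases Multiset.mem_add.1 ha with ha | ha
        · obtain ⟨S1, rfl⟩ := Multiset.exists_cons_of_mem ha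
          rw [Multiset.cons_add] at h2
          obtain rfl := (Multiset.cons_inj_right a).1 h2
          rw [Multiset.cons_swap] at hv
          obtain ⟨t', ht', he⟩ := ihv _ hv fun s hs => hl s (Or.inl hs)
          have h1 : Der Θ (pre + b ::ₘ (S1 + T1)) (.tens b t' w) := by
            rw [Multiset.add_cons, ← add_assoc]
            refine .tens b A B _ _ _ _ hb ?_ hw
            simpa [Multiset.add_cons] using ht'
          refine ⟨.tens b t' w, h1, ?_⟩
          have he' := Eqv.tens_left (S := a ::ₘ S1) hb hw (by rwa [Multiset.cons_swap])
          have e1 : a ::ₘ b ::ₘ (S1 + T1) = b ::ₘ (a ::ₘ S1 + T1) := by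
            rw [Multiset.cons_swap, Multiset.cons_add]
          refine he'.trans (.of ?_ ?_ (Or.inr (hK.swap_tens_left b t' w)))
          · refine .tens b A B _ _ _ _ hb ?_ hw
            rw [Multiset.cons_swap]
            exact hK.der ht'
          · rw [← e1]
            exact hK.der h1
        · obtain ⟨T1, rfl⟩ := Multiset.exists_cons_of_mem ha
          rw [Multiset.add_cons] at h2
          obtain rfl := (Multiset.cons_inj_right a).1 h2
          rw [Multiset.cons_swap] at hw
          obtain ⟨t', ht', he⟩ := ihw _ hw fun s hs => hl s (Or.inr hs)
          have h1 : Der Θ (pre + b ::ₘ (S1 + T1)) (.tens b v t') := by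
            rw [Multiset.add_cons, add_left_comm]
            refine .tens b A B _ _ _ _ hb hv ?_
            simpa [Multiset.add_cons] using ht'
          refine ⟨.tens b v t', h1, ?_⟩
          have he' := Eqv.tens_right (T := a ::ₘ T1) hb hv (by rwa [Multiset.cons_swap])
          have e1 : a ::ₘ b ::ₘ (S1 + T1) = b ::ₘ (S1 + a ::ₘ T1) := by
            rw [Multiset.cons_swap, Multiset.add_cons]
          refine he'.trans (.of ?_ ?_ (Or.inr (hK.swap_tens_right b v t')))
          · refine .tens b A B _ _ _ _ hb hv ?_
            rw [Multiset.cons_swap]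
            exact hK.der ht'
          · rw [← e1]
            exact hK.der h1

end NegRule

/-! ### Proofs with the same axiom links -/

/-! ### Formulae of the fragment -/

theorem IsA.not_isE {F : Formula} (h : IsA F) : ¬ IsE F := by
  induction h with
  | atom | one | tens => intro h; cases h
  | parAA _ _ ih | parAE _ _ ih => intro h; cases h; exact ih ‹_›
  | parEA _ _ ih => intro h; cases h; exact ih ‹_›

/-- All that the argument needs from the fragment, besides its closure under subformulae: no premise
of a `⊗` is made of `⊥` alone. -/
theorem not_isE_of_tens {A B : Formula} (h : Formula.tens A B ∈ NBTLL) : ¬ IsE A ∧ ¬ IsE B := by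
  rcases h with h | h
  · cases h with
    | tens hA hB => exact ⟨hA.not_isE, hB.not_isE⟩
  · cases h

theorem child_mem_NBTLL {F : Formula} (h : F ∈ NBTLL) (b : Bool) : F.child b ∈ NBTLL := by
  rcases h with h | h
  · cases h with
    | atom | one => exact Or.inl (by constructor)
    | tens hA hB => cases b <;> exact Or.inl ‹_›
    | parAA hA hB => cases b <;> exact Or.inl ‹_›
    | parAE hA hB => cases b; exacts [Or.inl hA, Or.inr hB]
    | parEA hA hB => cases b; exacts [Or.inr hA, Or.inl hB]
  · cases h with
    | bot => exact Or.inr .bot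
    | par hA hB => cases b; exacts [Or.inr hA, Or.inr hB]

theorem ty_mem_NBTLL (h : ∀ C ∈ Θ, C ∈ NBTLL) (a : Occ) : ty Θ a ∈ NBTLL := by
  obtain ⟨i, p⟩ := a
  induction p with
  | nil =>
    simp only [ty, Formula.subAt]
    by_cases hi : i < Θ.length
    · rw [List.getD_eq_getElem _ _ hi]
      exact h _ (List.getElem_mem hi)
    -- Positions out of range have the default type `1`, which belongs to the fragment.
    · rw [List.getD_eq_default _ _ (not_lt.1 hi)]
      exact Or.inl .one
  | cons b p ih => exact child_mem_NBTLL ih b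

/-- The principal occurrence of the last rule belongs to no axiom. -/
theorem not_mem_links {S : Multiset Occ} {a : Occ} {L : Set (Sym2 Occ)}
    (ha : a ∉ Cone S) (h : ∀ s ∈ L, ∀ y ∈ s, y ∈ Cone S) : ∀ s ∈ L, a ∉ s :=
  fun s hs has => ha (h s hs a has)

/-- Every leaf above `x` is a `⊥` introduced by a rule. -/
def Pure (Θ : List Formula) (L : Set (Sym2 Occ)) (x : Occ) : Prop :=
  IsE (ty Θ x) ∧ ∀ s ∈ L, ∀ y ∈ s, ¬ Above x y

/-- The axioms of the other premise of a `⊗` live in a disjoint cone, so they cannot spoil purity.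
-/
theorem Pure.union {L L' : Set (Sym2 Occ)} {S T : Multiset Occ} (h : Disjoint (Cone S) (Cone T))
    (hL' : ∀ s ∈ L', ∀ y ∈ s, y ∈ Cone T) {x : Occ} (hx : x ∈ S) (hp : Pure Θ L x) :
    Pure Θ (L ∪ L') x := by
  refine ⟨hp.1, ?_⟩
  rintro s (hs | hs) y hy hxy
  · exact hp.2 s hs y hy hxy
  · exact Set.disjoint_left.1 h ⟨x, hx, hxy⟩ (hL' s hs y hy)

/-- The leaves of a proof, apart from the `⊥` rules, are connected by the axioms and the `⊗`
rules. -/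
theorem Der.connected (hfr : ∀ a, ty Θ a ∈ NBTLL) {S : Multiset Occ} {t : RuleTree}
    (h : Der Θ S t) : Anti S → ∀ κ : Occ → Prop,
    (∀ c b, c ∈ Cone S → (κ (c.child b) ↔ κ c)) →
    (∀ x y, s(x, y) ∈ t.links → (κ x ↔ κ y)) →
    (∀ x ∈ S, κ x → Pure Θ t.links x) ∨ (∀ x ∈ S, ¬ κ x → Pure Θ t.links x) := by
  induction h with
  | ax x y h =>
    intro hS κ hκ hl
    -- The two conclusions of an axiom share their colour, so one colour is absent.
    have := hl x y rfl
    by_cases hx : κ x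
    · right
      simp [hx, ← this]
    · left
      simp [hx, ← this]
  | one x h =>
    intro hS κ hκ hl
    by_cases hx : κ x <;> simp [hx]
  | bot x S t hx ht ih =>
    intro hS κ hκ hl
    -- The new conclusion is pure, hence harmless whichever colour it has.
    have hp : Pure Θ t.links x := by
      refine ⟨by rw [hx]; exact .bot, fun s hs y hy hxy => ?_⟩
      exact hS.disjoint_cons hxy (ht.links_cone hs hy)
    have := ih hS.of_cons κ (fun c b hc => hκ c b (cone_le (Multiset.le_cons_self _ _) hc)) hl
    refine this.imp (fun h v hv hκv => ?_) fun h v hv hκv => ?_ <;>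
    · rcases Multiset.mem_cons.1 hv with rfl | hv
      · exact hp
      · exact h v hv hκv
  | par x A B S t hx ht ih =>
    intro hS κ hκ hl
    -- The two premises have the colour of `x`. If that is the colour whose conclusions are pure,
    -- then both premises are pure, and so is `x`.
    have hp : Pure Θ t.links x.l → Pure Θ t.links x.r → Pure Θ t.links x := by
      intro h1 h2
      refine ⟨?_, fun s hs y hy hxy => ?_⟩
      · have h1 := h1.1
        have h2 := h2.1
        rw [ty_l (Or.inr hx)] at h1
        rw [ty_r (Or.inr hx)] at h2
        rw [hx]
        exact .par h1 h2
      · obtain ⟨v, hv, hvy⟩ := ht.links_cone hs hy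
        simp only [Multiset.mem_cons] at hv
        rcases hv with rfl | rfl | hv
        · exact h1.2 s hs y hy hvy
        · exact h2.2 s hs y hy hvy
        · exact hS.disjoint_cons hxy ⟨v, hv, hvy⟩
    have hxl : κ x.l ↔ κ x := hκ x false (mem_cone_of_mem (by simp))
    have hxr : κ x.r ↔ κ x := hκ x true (mem_cone_of_mem (by simp))
    have := ih hS.par κ (fun c b hc => hκ c b (cone_par hc)) hl
    refine this.imp (fun h v hv hκv => ?_) fun h v hv hκv => ?_ <;>
    · rcases Multiset.mem_cons.1 hv with rfl | hv
      · exact hp (h _ (by simp) (by rwa [hxl])) (h _ (by simp) (by rwa [hxr]))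
      · exact h v (by simp [hv]) hκv
  | tens x A B S T t u hx ht hu ih1 ih2 =>
    intro hS κ hκ hl
    have hxl : κ x.l ↔ κ x := hκ x false (mem_cone_of_mem (by simp))
    have hxr : κ x.r ↔ κ x := hκ x true (mem_cone_of_mem (by simp))
    have hE := not_isE_of_tens (hx ▸ hfr x)
    -- Neither premise of the `⊗` is pure, by the choice of the fragment. Their common colour is
    -- therefore the impure one on both sides, and the other colour is pure on both sides; this
    -- glues the two induction hypotheses.
    have hl' : ∀ L, ¬ Pure Θ L x.l := fun L h => by
      have h := h.1
      rw [ty_l (Or.inl hx)] at h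
      exact hE.1 h
    have hr' : ∀ L, ¬ Pure Θ L x.r := fun L h => by
      have h := h.1
      rw [ty_r (Or.inl hx)] at h
      exact hE.2 h
    have h1 := ih1 hS.tens_left κ (fun c b hc => hκ c b (cone_tens_left hc))
      fun x y h => hl x y (Or.inl h)
    have h2 := ih2 hS.tens_right κ (fun c b hc => hκ c b (cone_tens_right hc))
      fun x y h => hl x y (Or.inr h)
    have hd := hS.tens.disjoint
    have u1 : ∀ v ∈ x.l ::ₘ S, Pure Θ t.links v → Pure Θ (t.links ∪ u.links) v := fun v hv h =>
      h.union hd (fun s hs y hy => hu.links_cone hs hy) hv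
    have u2 : ∀ v ∈ x.r ::ₘ T, Pure Θ u.links v → Pure Θ (t.links ∪ u.links) v := fun v hv h => by
      rw [Set.union_comm]
      exact h.union hd.symm (fun s hs y hy => ht.links_cone hs hy) hv
    by_cases hκx : κ x
    · right
      have h1 := h1.resolve_left fun h => hl' _ (h _ (by simp) (hxl.2 hκx))
      have h2 := h2.resolve_left fun h => hr' _ (h _ (by simp) (hxr.2 hκx))
      intro v hv hκv
      simp only [Multiset.mem_cons, Multiset.mem_add] at hv
      rcases hv with rfl | hv | hv
      · exact absurd hκx hκv
      · exact u1 v (by simp [hv]) (h1 v (by simp [hv]) hκv)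
      · exact u2 v (by simp [hv]) (h2 v (by simp [hv]) hκv)
    · left
      have h1 := h1.resolve_right fun h => hl' _ (h _ (by simp) (by rwa [hxl]))
      have h2 := h2.resolve_right fun h => hr' _ (h _ (by simp) (by rwa [hxr]))
      intro v hv hκv
      simp only [Multiset.mem_cons, Multiset.mem_add] at hv
      rcases hv with rfl | hv | hv
      · exact absurd hκv hκx
      · exact u1 v (by simp [hv]) (h1 v (by simp [hv]) hκv)
      · exact u2 v (by simp [hv]) (h2 v (by simp [hv]) hκv)

theorem exists_negRule {a : Occ} (h : ty Θ a = .bot ∨ ∃ A B, ty Θ a = .par A B) :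
    ∃ pre K, NegRule Θ a pre K := by
  rcases h with h | h
  · exact ⟨_, _, Or.inl ⟨h, rfl, rfl⟩⟩
  · exact ⟨_, _, Or.inr ⟨h, rfl, rfl⟩⟩

/-- This makes a pure conclusion subject to `NegRule.invert`. -/
theorem Pure.neg {L : Set (Sym2 Occ)} {x : Occ} (h : Pure Θ L x) :
    (ty Θ x = .bot ∨ ∃ A B, ty Θ x = .par A B) ∧ ∀ s ∈ L, x ∉ s := by
  refine ⟨?_, fun s hs hx => h.2 s hs x hx (Above.refl x)⟩
  have := h.1
  generalize ty Θ x = F at this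
  cases this with
  | bot => exact Or.inl rfl
  | par => exact Or.inr ⟨_, _, rfl⟩

/-- A negative rule just below a `⊗` moves up into the left premise or into the right one, according
to where its active occurrences are. -/
theorem swap_of_neg_tens {a q : Occ} {pre : Multiset Occ} {K : RuleTree → RuleTree}
    (hK : NegRule Θ q pre K) {S T : Multiset Occ} {A B : Formula} (ha : ty Θ a = .tens A B)
    {t u : RuleTree} :
    (Der Θ (a.l ::ₘ (pre + S)) t → Der Θ (a.r ::ₘ T) u →
      Der Θ (a.l ::ₘ q ::ₘ S) (K t) ∧
      Eqv Θ (q ::ₘ a ::ₘ (S + T)) (K (.tens a t u)) (.tens a (K t) u)) ∧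
    (Der Θ (a.l ::ₘ S) t → Der Θ (a.r ::ₘ (pre + T)) u →
      Der Θ (a.r ::ₘ q ::ₘ T) (K u) ∧
      Eqv Θ (q ::ₘ a ::ₘ (S + T)) (K (.tens a t u)) (.tens a t (K u))) := by
  refine ⟨fun ht hu => ?_, fun ht hu => ?_⟩
  · have h1 : Der Θ (a.l ::ₘ q ::ₘ S) (K t) := by
      rw [Multiset.cons_swap]
      exact hK.der (by rwa [Multiset.add_cons])
    refine ⟨h1, .of (hK.der ?_) ?_ (Or.inl (hK.swap_tens_left a t u))⟩
    · rw [Multiset.add_cons, ← add_assoc]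
      exact .tens a A B _ _ _ _ ha ht hu
    · rw [Multiset.cons_swap, ← Multiset.cons_add]
      exact .tens a A B _ _ _ _ ha h1 hu
  · have h1 : Der Θ (a.r ::ₘ q ::ₘ T) (K u) := by
      rw [Multiset.cons_swap]
      exact hK.der (by rwa [Multiset.add_cons])
    refine ⟨h1, .of (hK.der ?_) ?_ (Or.inl (hK.swap_tens_right a t u))⟩
    · rw [Multiset.add_cons, add_left_comm]
      exact .tens a A B _ _ _ _ ha ht hu
    · rw [Multiset.cons_swap, ← Multiset.add_cons]
      exact .tens a A B _ _ _ _ ha ht h1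

open Classical in
/-- If the axioms respect a partition of the conclusions that separates the premises of the
conclusion `a`, then `a` can be introduced by the last rule, which splits the conclusions in the
same way. -/
theorem Der.split (hfr : ∀ a, ty Θ a ∈ NBTLL) {a : Occ} {A B : Formula} (ha : ty Θ a = .tens A B)
    (κ : Occ → Prop) (hal : κ a.l) (har : ¬ κ a.r) (n : ℕ) : ∀ (t : RuleTree) (S : Multiset Occ),
    t.size = n → Der Θ (a ::ₘ S) t → Anti (a ::ₘ S) → (∀ s ∈ t.links, a ∉ s) →
    (∀ c b, c ∈ Cone (a ::ₘ S) → c ≠ a → (κ (c.child b) ↔ κ c)) →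
    (∀ x y, s(x, y) ∈ t.links → (κ x ↔ κ y)) →
    ∃ t1 t2, Der Θ (a.l ::ₘ S.filter κ) t1 ∧ Der Θ (a.r ::ₘ S.filter (¬ κ ·)) t2 ∧
      Eqv Θ (a ::ₘ S) t (.tens a t1 t2) := by
  -- Inversion replaces `t` by a tree with one rule less that need not be a subtree of `t`, so the
  -- induction is on the number of rules.
  induction n using Nat.strong_induction_on with
  | _ n ih =>
  intro t S hn ht hS hal' hκ hl
  -- Invertible conclusions are stripped first. The rule for such a `q` is moved to the bottom, its
  -- premise is split by induction, and the rule is then pushed into the premise of the colour of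
  -- `q`.
  by_cases hneg : ∃ q ∈ S, (ty Θ q = .bot ∨ ∃ A B, ty Θ q = .par A B) ∧ ∀ s ∈ t.links, q ∉ s
  · obtain ⟨q, hq, hqt, hql⟩ := hneg
    obtain ⟨S, rfl⟩ := Multiset.exists_cons_of_mem hq
    obtain ⟨pre, K, hK⟩ := exists_negRule hqt
    have hS' := hS
    rw [Multiset.cons_swap] at ht hS
    obtain ⟨t', ht', he⟩ := hK.invert t _ ht hql
    rw [Multiset.add_cons] at ht'
    have hlk : t.links = t'.links := by rw [he.links_eq, hK.links]
    rw [hlk] at hal' hl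
    have hcone : Cone (a ::ₘ (pre + S)) ⊆ Cone (a ::ₘ q ::ₘ S) := by
      rw [← Multiset.add_cons, Multiset.cons_swap]
      exact hK.cone
    have hA : Anti (a ::ₘ (pre + S)) := by
      rw [← Multiset.add_cons]
      exact hK.anti hS
    obtain ⟨t1, t2, h1, h2, h12⟩ := ih t'.size (by have := he.size_eq; rw [hK.size] at this; omega)
      t' _ rfl ht' hA hal' (fun c b hc => hκ c b (hcone hc)) hl
    -- The active occurrences have the colour of `q`, so the colouring sends all of them to the same
    -- premise.
    have hpre : ∀ x ∈ pre, (κ x ↔ κ q) := by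
      have hqa : q ≠ a := by
        rintro rfl
        have := hS.1
        simp at this
      have hqc : q ∈ Cone (a ::ₘ q ::ₘ S) := mem_cone_of_mem (by simp)
      rcases hK with ⟨-, rfl, -⟩ | ⟨-, rfl, -⟩
      · simp
      · intro x hx
        simp only [Multiset.mem_cons, Multiset.notMem_zero, or_false] at hx
        rcases hx with rfl | rfl
        · exact hκ q false hqc hqa
        · exact hκ q true hqc hqa
    have he2 : Eqv Θ (q ::ₘ a ::ₘ S) t (K (.tens a t1 t2)) :=
      he.trans (hK.congr (by rwa [Multiset.add_cons]))
    rw [Multiset.filter_add] at h1 h2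
    by_cases hκq : κ q
    · have f1 : pre.filter κ = pre := Multiset.filter_eq_self.2 fun x hx => (hpre x hx).2 hκq
      have f2 : pre.filter (¬ κ ·) = 0 :=
        Multiset.filter_eq_nil.2 fun x hx => not_not.2 ((hpre x hx).2 hκq)
      rw [f1] at h1
      rw [f2, zero_add] at h2
      obtain ⟨h3, h4⟩ := (swap_of_neg_tens hK ha).1 h1 h2
      rw [Multiset.filter_add_not] at h4
      refine ⟨K t1, t2, ?_, ?_, ?_⟩
      · rwa [Multiset.filter_cons_of_pos _ hκq]
      · rwa [Multiset.filter_cons_of_neg (p := fun x => ¬ κ x) _ (not_not.2 hκq)]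
      · rw [Multiset.cons_swap]
        exact he2.trans h4
    · have f1 : pre.filter κ = 0 := Multiset.filter_eq_nil.2 fun x hx => by rwa [hpre x hx]
      have f2 : pre.filter (¬ κ ·) = pre := Multiset.filter_eq_self.2 fun x hx => by
        rwa [hpre x hx]
      rw [f1, zero_add] at h1
      rw [f2] at h2
      obtain ⟨h3, h4⟩ := (swap_of_neg_tens hK ha).2 h1 h2
      rw [Multiset.filter_add_not] at h4
      refine ⟨t1, K t2, ?_, ?_, ?_⟩
      · rwa [Multiset.filter_cons_of_neg _ hκq]
      · rwa [Multiset.filter_cons_of_pos (p := fun x => ¬ κ x) _ hκq]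
      · rw [Multiset.cons_swap]
        exact he2.trans h4
  -- From here on no conclusion other than `a` is pure. Purity being excluded, `Der.connected`
  -- forces a single colour; the last rule can only be a `⊗`.
  · have hpure : ∀ x ∈ S, ¬ Pure Θ t.links x := fun x hx hp => hneg ⟨x, hx, hp.neg⟩
    have hmem : ∀ {b : Occ} {M : Multiset Occ}, a ::ₘ S = b ::ₘ M → b ≠ a → b ∈ S := by
      intro b M h hba
      have : b ∈ a ::ₘ S := by rw [h]; simp
      exact (Multiset.mem_cons.1 this).resolve_left hba
    generalize hM : a ::ₘ S = M at ht
    cases ht with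
    | ax x y hxy =>
      refine absurd ?_ (hal' _ rfl)
      have : a ∈ x ::ₘ y ::ₘ (0 : Multiset Occ) := by rw [← hM]; simp
      simpa using this
    | one x hx =>
      have : a ∈ x ::ₘ (0 : Multiset Occ) := by rw [← hM]; simp
      simp only [Multiset.mem_cons, Multiset.notMem_zero, or_false] at this
      subst this
      simp [ha] at hx
    | bot b S' t hb ht =>
      have hba : b ≠ a := by rintro rfl; simp [ha] at hb
      refine absurd ⟨b, hmem hM hba, Or.inl hb, ?_⟩ hneg
      rw [hM] at hS
      exact not_mem_links hS.not_mem_cone fun s hs y hy => ht.links_cone hs hy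
    | par b A' B' S' t hb ht =>
      have hba : b ≠ a := by rintro rfl; simp [ha] at hb
      refine absurd ⟨b, hmem hM hba, Or.inr ⟨_, _, hb⟩, ?_⟩ hneg
      rw [hM] at hS
      exact not_mem_links hS.not_mem_cone_par fun s hs y hy => ht.links_cone hs hy
    | tens b A' B' S1 T1 v w hb hv hw =>
      have hE := not_isE_of_tens (hb ▸ hfr b)
      rw [← ty_l (Or.inl hb), ← ty_r (Or.inl hb)] at hE
      have hS1 := hS
      rw [hM] at hS1
      have hd := hS1.tens.disjoint
      have hab : ∀ c ∈ b ::ₘ (S1 + T1), c ∈ a ::ₘ S := by rw [← hM]; simp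
      have hal1 : ∀ s ∈ v.links, a ∉ s := fun s hs => hal' s (Or.inl hs)
      have hal2 : ∀ s ∈ w.links, a ∉ s := fun s hs => hal' s (Or.inr hs)
      have hl1 : ∀ x y, s(x, y) ∈ v.links → (κ x ↔ κ y) := fun x y h => hl x y (Or.inl h)
      have hl2 : ∀ x y, s(x, y) ∈ w.links → (κ x ↔ κ y) := fun x y h => hl x y (Or.inr h)
      have hc1 : Cone (b.l ::ₘ S1) ⊆ Cone (a ::ₘ S) := by rw [hM]; exact cone_tens_left
      have hc2 : Cone (b.r ::ₘ T1) ⊆ Cone (a ::ₘ S) := by rw [hM]; exact cone_tens_right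
      -- in a premise that does not contain `a`, all the conclusions have the same colour
      have mono1 : a ∉ Cone (b.l ::ₘ S1) → (∀ x ∈ S1, x ∈ S) →
          (∀ x ∈ S1, κ x ↔ κ b.l) := by
        intro haC hsub x hx
        have := hv.connected hfr hS1.tens_left κ (fun c d hc => hκ c d (hc1 hc)
          (by rintro rfl; exact haC hc)) hl1
        have hpx : ∀ x ∈ S1, ¬ Pure Θ v.links x := fun x hx hp => hpure x (hsub x hx)
          (hp.union hd (fun s hs y hy => hw.links_cone hs hy) (by simp [hx]))
        have hpb : ¬ Pure Θ v.links b.l := fun h => hE.1 h.1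
        rcases this with h | h
        · have e1 := mt (h x (by simp [hx])) (hpx x hx)
          have e2 := mt (h b.l (by simp)) hpb
          tauto
        · have e1 := mt (h x (by simp [hx])) (hpx x hx)
          have e2 := mt (h b.l (by simp)) hpb
          tauto
      have mono2 : a ∉ Cone (b.r ::ₘ T1) → (∀ x ∈ T1, x ∈ S) →
          (∀ x ∈ T1, κ x ↔ κ b.r) := by
        intro haC hsub x hx
        have := hw.connected hfr hS1.tens_right κ (fun c d hc => hκ c d (hc2 hc)
          (by rintro rfl; exact haC hc)) hl2
        have hpx : ∀ x ∈ T1, ¬ Pure Θ w.links x := fun x hx hp => hpure x (hsub x hx) (by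
          have := hp.union hd.symm (L' := v.links) (fun s hs y hy => hv.links_cone hs hy)
            (by simp [hx])
          rwa [Set.union_comm] at this)
        have hpb : ¬ Pure Θ w.links b.r := fun h => hE.2 h.1
        rcases this with h | h
        · have e1 := mt (h x (by simp [hx])) (hpx x hx)
          have e2 := mt (h b.r (by simp)) hpb
          tauto
        · have e1 := mt (h x (by simp [hx])) (hpx x hx)
          have e2 := mt (h b.r (by simp)) hpb
          tauto
      -- If the last rule introduces `a` itself, its premises have the colours of `a.l` and `a.r`
      -- throughout, which is already the required splitting.
      rcases Multiset.cons_eq_cons.1 hM with ⟨rfl, rfl⟩ | ⟨hne, cs, rfl, h2⟩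
      · have m1 := mono1 hS.not_mem_cone_left fun x hx => by simp [hx]
        have m2 := mono2 hS.not_mem_cone_right fun x hx => by simp [hx]
        refine ⟨v, w, ?_, ?_, Eqv.refl _ _⟩
        · have f1 : S1.filter κ = S1 := Multiset.filter_eq_self.2 fun x hx => (m1 x hx).2 hal
          have f2 : T1.filter κ = 0 := Multiset.filter_eq_nil.2 fun x hx => by rwa [m2 x hx]
          rwa [Multiset.filter_add, f1, f2, add_zero]
        · have f1 : S1.filter (¬ κ ·) = 0 :=
            Multiset.filter_eq_nil.2 fun x hx => not_not.2 ((m1 x hx).2 hal)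
          have f2 : T1.filter (¬ κ ·) = T1 := Multiset.filter_eq_self.2 fun x hx => by
            rwa [m2 x hx]
          rwa [Multiset.filter_add, f1, f2, zero_add]
      · have hbC : b ∈ Cone (a ::ₘ b ::ₘ cs) := mem_cone_of_mem (by simp)
        have hbl : κ b.l ↔ κ b := hκ b false hbC (Ne.symm hne)
        have hbr : κ b.r ↔ κ b := hκ b true hbC (Ne.symm hne)
        have ha' : a ∈ S1 + T1 := by rw [h2]; simp
        rcases Multiset.mem_add.1 ha' with ha' | ha'
        -- Here `a` lies in the left premise of `b`, which is split by induction. The right premise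
        -- has the colour of `b` throughout, so the whole `⊗` rule of `b` is moved above that of
        -- `a`, on the side of this colour.
        · obtain ⟨S1, rfl⟩ := Multiset.exists_cons_of_mem ha'
          have haT : a ∉ Cone (b.r ::ₘ T1) :=
            fun h => Set.disjoint_left.1 hd (mem_cone_of_mem (by simp)) h
          rw [Multiset.cons_add] at h2
          obtain rfl := (Multiset.cons_inj_right a).1 h2
          have m2 := mono2 haT fun x hx => by simp [hx]
          have hv' := hv
          have hA1 := hS1.tens_left
          rw [Multiset.cons_swap] at hv hA1 hc1
          obtain ⟨v1, v2, h3, h4, he⟩ := ih v.size (by rw [← hn]; simp only [RuleTree.size]; omega)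
            v _ rfl hv hA1 hal1 (fun c d hc => hκ c d (hc1 hc)) hl1
          have he' := Eqv.tens_left (S := a ::ₘ S1) hb hw (by rwa [Multiset.cons_swap])
          rw [← hM] at he'
          have e1 : Der Θ (a ::ₘ b ::ₘ (S1 + T1)) (.tens b (.tens a v1 v2) w) := by
            rw [← he'.der_iff, hM]
            exact .tens b _ _ _ _ _ _ hb hv' hw
          rw [← hM]
          by_cases hκb : κ b
          · have f2 : T1.filter κ = T1 :=
              Multiset.filter_eq_self.2 fun x hx => by rwa [m2 x hx, hbr]
            have f3 : T1.filter (¬ κ ·) = 0 :=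
              Multiset.filter_eq_nil.2 fun x hx => not_not.2 (by rwa [m2 x hx, hbr])
            rw [Multiset.filter_cons_of_pos _ (hbl.2 hκb)] at h3
            rw [Multiset.filter_cons_of_neg (p := fun x => ¬ κ x) _ (not_not.2 (hbl.2 hκb))] at h4
            have d1 : Der Θ (a.l ::ₘ (b ::ₘ (S1 + T1)).filter κ) (.tens b v1 w) := by
              rw [Multiset.filter_cons_of_pos _ hκb, Multiset.filter_add, f2,
                Multiset.cons_swap, ← Multiset.cons_add]
              exact .tens b _ _ _ _ _ _ hb (by rwa [Multiset.cons_swap]) hw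
            have d2 : Der Θ (a.r ::ₘ (b ::ₘ (S1 + T1)).filter (¬ κ ·)) v2 := by
              rw [Multiset.filter_cons_of_neg (p := fun x => ¬ κ x) _ (not_not.2 hκb), Multiset.filter_add, f3, add_zero]
              exact h4
            refine ⟨.tens b v1 w, v2, d1, d2, he'.trans (.of e1 ?_ (Or.inr ?_))⟩
            · have := Der.tens a A B _ _ _ _ ha d1 d2
              rwa [Multiset.filter_add_not] at this
            · exact .tens_tens_left _ _ _ _ _
          · have f2 : T1.filter κ = 0 :=
              Multiset.filter_eq_nil.2 fun x hx => by rwa [m2 x hx, hbr]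
            have f3 : T1.filter (¬ κ ·) = T1 :=
              Multiset.filter_eq_self.2 fun x hx => by rwa [m2 x hx, hbr]
            rw [Multiset.filter_cons_of_neg _ (by rwa [hbl])] at h3
            rw [Multiset.filter_cons_of_pos (p := fun x => ¬ κ x) _ (by rwa [hbl])] at h4
            have d1 : Der Θ (a.l ::ₘ (b ::ₘ (S1 + T1)).filter κ) v1 := by
              rw [Multiset.filter_cons_of_neg _ hκb, Multiset.filter_add, f2, add_zero]
              exact h3
            have d2 : Der Θ (a.r ::ₘ (b ::ₘ (S1 + T1)).filter (¬ κ ·)) (.tens b v2 w) := by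
              rw [Multiset.filter_cons_of_pos (p := fun x => ¬ κ x) _ hκb, Multiset.filter_add, f3,
                Multiset.cons_swap, ← Multiset.cons_add]
              exact .tens b _ _ _ _ _ _ hb (by rwa [Multiset.cons_swap]) hw
            refine ⟨v1, .tens b v2 w, d1, d2, he'.trans (.of e1 ?_ (Or.inl ?_))⟩
            · have := Der.tens a A B _ _ _ _ ha d1 d2
              rwa [Multiset.filter_add_not] at this
            · exact .tens_tens_middle _ _ _ _ _
        -- The mirror image, with `a` in the right premise of `b`.
        · obtain ⟨T1, rfl⟩ := Multiset.exists_cons_of_mem ha'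
          have haT : a ∉ Cone (b.l ::ₘ S1) :=
            fun h => Set.disjoint_left.1 hd h (mem_cone_of_mem (by simp))
          rw [Multiset.add_cons] at h2
          obtain rfl := (Multiset.cons_inj_right a).1 h2
          have m2 := mono1 haT fun x hx => by simp [hx]
          have hw' := hw
          have hA1 := hS1.tens_right
          rw [Multiset.cons_swap] at hw hA1 hc2
          obtain ⟨v1, v2, h3, h4, he⟩ := ih w.size (by rw [← hn]; simp only [RuleTree.size]; omega)
            w _ rfl hw hA1 hal2 (fun c d hc => hκ c d (hc2 hc)) hl2
          have he' := Eqv.tens_right (T := a ::ₘ T1) hb hv (by rwa [Multiset.cons_swap])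
          rw [← hM] at he'
          have e1 : Der Θ (a ::ₘ b ::ₘ (S1 + T1)) (.tens b v (.tens a v1 v2)) := by
            rw [← he'.der_iff, hM]
            exact .tens b _ _ _ _ _ _ hb hv hw'
          rw [← hM]
          by_cases hκb : κ b
          · have f2 : S1.filter κ = S1 :=
              Multiset.filter_eq_self.2 fun x hx => by rwa [m2 x hx, hbl]
            have f3 : S1.filter (¬ κ ·) = 0 :=
              Multiset.filter_eq_nil.2 fun x hx => not_not.2 (by rwa [m2 x hx, hbl])
            rw [Multiset.filter_cons_of_pos _ (hbr.2 hκb)] at h3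
            rw [Multiset.filter_cons_of_neg (p := fun x => ¬ κ x) _ (not_not.2 (hbr.2 hκb))] at h4
            have d1 : Der Θ (a.l ::ₘ (b ::ₘ (S1 + T1)).filter κ) (.tens b v v1) := by
              rw [Multiset.filter_cons_of_pos _ hκb, Multiset.filter_add, f2,
                Multiset.cons_swap, ← Multiset.add_cons]
              exact .tens b _ _ _ _ _ _ hb hv (by rwa [Multiset.cons_swap])
            have d2 : Der Θ (a.r ::ₘ (b ::ₘ (S1 + T1)).filter (¬ κ ·)) v2 := by
              rw [Multiset.filter_cons_of_neg (p := fun x => ¬ κ x) _ (not_not.2 hκb), Multiset.filter_add, f3, zero_add]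
              exact h4
            refine ⟨.tens b v v1, v2, d1, d2, he'.trans (.of e1 ?_ (Or.inr ?_))⟩
            · have := Der.tens a A B _ _ _ _ ha d1 d2
              rwa [Multiset.filter_add_not] at this
            · exact .tens_tens_middle _ _ _ _ _
          · have f2 : S1.filter κ = 0 :=
              Multiset.filter_eq_nil.2 fun x hx => by rwa [m2 x hx, hbl]
            have f3 : S1.filter (¬ κ ·) = S1 :=
              Multiset.filter_eq_self.2 fun x hx => by rwa [m2 x hx, hbl]
            rw [Multiset.filter_cons_of_neg _ (by rwa [hbr])] at h3
            rw [Multiset.filter_cons_of_pos (p := fun x => ¬ κ x) _ (by rwa [hbr])] at h4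
            have d1 : Der Θ (a.l ::ₘ (b ::ₘ (S1 + T1)).filter κ) v1 := by
              rw [Multiset.filter_cons_of_neg _ hκb, Multiset.filter_add, f2, zero_add]
              exact h3
            have d2 : Der Θ (a.r ::ₘ (b ::ₘ (S1 + T1)).filter (¬ κ ·)) (.tens b v v2) := by
              rw [Multiset.filter_cons_of_pos (p := fun x => ¬ κ x) _ hκb, Multiset.filter_add, f3,
                Multiset.cons_swap, ← Multiset.add_cons]
              exact .tens b _ _ _ _ _ _ hb hv (by rwa [Multiset.cons_swap])
            refine ⟨v1, .tens b v v2, d1, d2, he'.trans (.of e1 ?_ (Or.inl ?_))⟩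
            · have := Der.tens a A B _ _ _ _ ha d1 d2
              rwa [Multiset.filter_add_not] at this
            · exact .tens_tens_right _ _ _ _ _

/-- In the fragment, a proof is determined, up to interchanges of rules, by its axiom links. -/
theorem eqv_of_links_eq (hfr : ∀ a, ty Θ a ∈ NBTLL) {S : Multiset Occ} {t₁ : RuleTree}
    (h₁ : Der Θ S t₁) : ∀ t₂, Der Θ S t₂ → Anti S → t₁.links = t₂.links → Eqv Θ S t₁ t₂ := by
  classical
  induction h₁ with
  | ax x y hxy =>
    intro t₂ h₂ hS hl
    -- Every conclusion of `t₂` belongs to its only link, whereas the principal occurrence of a `⊥`,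
    -- `⅋` or `⊗` last rule belongs to no link. So `t₂` is an axiom as well.
    have hmem : ∀ {b : Occ} {M : Multiset Occ}, x ::ₘ y ::ₘ 0 = b ::ₘ M →
        ¬ ∀ s ∈ t₂.links, b ∉ s := by
      intro b M h hb
      refine hb s(x, y) (by rw [← hl]; rfl) ?_
      have : b ∈ x ::ₘ y ::ₘ (0 : Multiset Occ) := by rw [h]; simp
      simpa using this
    generalize hM : x ::ₘ y ::ₘ (0 : Multiset Occ) = M at h₂ hS
    cases h₂ with
    | ax x' y' h =>
      rw [RuleTree.links, RuleTree.links, Set.singleton_eq_singleton_iff] at hl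
      rw [hl]
      exact Eqv.refl _ _
    | one z h =>
      rw [RuleTree.links, RuleTree.links] at hl
      exact absurd hl (Set.singleton_ne_empty _)
    | bot z S t h ht =>
      exact absurd (not_mem_links hS.not_mem_cone fun s hs y hy => ht.links_cone hs hy) (hmem hM)
    | par z A B S t h ht =>
      exact absurd (not_mem_links hS.not_mem_cone_par fun s hs y hy => ht.links_cone hs hy)
        (hmem hM)
    | tens z A B S T t u h ht hu =>
      refine absurd ?_ (hmem hM)
      rintro s (hs | hs)
      · exact not_mem_links hS.not_mem_cone_left (fun s hs y hy => ht.links_cone hs hy) s hs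
      · exact not_mem_links hS.not_mem_cone_right (fun s hs y hy => hu.links_cone hs hy) s hs
  | one x hx =>
    intro t₂ h₂ hS hl
    have hmem : ∀ {b : Occ} {M : Multiset Occ}, x ::ₘ 0 = b ::ₘ M → b = x := by
      intro b M h
      have : b ∈ x ::ₘ (0 : Multiset Occ) := by rw [h]; simp
      simpa using this
    generalize hM : x ::ₘ (0 : Multiset Occ) = M at h₂ hS
    cases h₂ with
    | ax x' y' h =>
      rw [RuleTree.links, RuleTree.links] at hl
      exact absurd hl.symm (Set.singleton_ne_empty _)
    | one z h =>
      rw [hmem hM]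
      exact Eqv.refl _ _
    | bot z S t h ht => rw [hmem hM, hx] at h; cases h
    | par z A B S t h ht => rw [hmem hM, hx] at h; cases h
    | tens z A B S T t u h ht hu => rw [hmem hM, hx] at h; cases h
  | bot a S t ha ht ih =>
    intro t₂ h₂ hS hl
    have hK : NegRule Θ a 0 (.bot a) := Or.inl ⟨ha, rfl, rfl⟩
    have hal := not_mem_links hS.not_mem_cone fun s hs y hy => ht.links_cone hs hy
    obtain ⟨t', ht', he⟩ := hK.invert t₂ S h₂ (by rw [← hl]; exact hal)
    have := ih t' (by simpa using ht') hS.of_cons (hl.trans he.links_eq)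
    exact (hK.congr (by simpa using this)).trans he.symm
  | par a A B S t ha ht ih =>
    intro t₂ h₂ hS hl
    have hK : NegRule Θ a (a.l ::ₘ a.r ::ₘ 0) (.par a) := Or.inr ⟨⟨A, B, ha⟩, rfl, rfl⟩
    have hal := not_mem_links hS.not_mem_cone_par fun s hs y hy => ht.links_cone hs hy
    obtain ⟨t', ht', he⟩ := hK.invert t₂ S h₂ (by rw [← hl]; exact hal)
    have := ih t' (by simpa using ht') hS.par (hl.trans he.links_eq)
    exact (hK.congr (by simpa using this)).trans he.symm
  | tens a A B S T t u ha ht hu ih1 ih2 =>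
    intro t₂ h₂ hS hl
    have hd := hS.tens.disjoint
    have hal : ∀ s ∈ t₂.links, a ∉ s := by
      rw [← hl]
      rintro s (hs | hs)
      · exact not_mem_links hS.not_mem_cone_left (fun s hs y hy => ht.links_cone hs hy) s hs
      · exact not_mem_links hS.not_mem_cone_right (fun s hs y hy => hu.links_cone hs hy) s hs
    have hκr : ∀ x ∈ Cone (a.r ::ₘ T), x ∉ Cone (a.l ::ₘ S) :=
      fun x hx hx' => Set.disjoint_left.1 hd hx' hx
    -- The colour is membership in the cone of the left premise of `t₁`. An occurrence and its
    -- immediate subformulae agree on it, except at `a`, whose two children lie on different sides.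
    have hleft : ∀ c b, c ∈ Cone (a ::ₘ (S + T)) → c ≠ a →
        (c.child b ∈ Cone (a.l ::ₘ S) ↔ c ∈ Cone (a.l ::ₘ S)) := by
      rintro c b ⟨w, hw, hwc⟩ hca
      refine ⟨?_, child_mem_cone b⟩
      rintro ⟨v, hv, hvc⟩
      rcases hvc.of_child with rfl | hvc
      · exfalso
        rcases Multiset.mem_cons.1 hv with hv | hv
        · exact hca (Occ.child_inj.1 hv).1
        · have := hS.2 w hw (c.child b) (by simp [hv]) (hwc.trans (above_child c b))
          subst this
          exact not_child_above _ _ hwc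
      · exact ⟨v, hv, hvc⟩
    obtain ⟨t', u', ht', hu', he⟩ := Der.split hfr ha (· ∈ Cone (a.l ::ₘ S))
      (mem_cone_of_mem (by simp)) (hκr _ (mem_cone_of_mem (by simp))) _ t₂ (S + T) rfl h₂ hS hal
      hleft (by
        rw [← hl]
        rintro x y (h | h)
        · simp [ht.links_cone h (Sym2.mem_mk_left x y), ht.links_cone h (Sym2.mem_mk_right x y)]
        · simp [hκr _ (hu.links_cone h (Sym2.mem_mk_left x y)),
            hκr _ (hu.links_cone h (Sym2.mem_mk_right x y))])
    have f1 : S.filter (· ∈ Cone (a.l ::ₘ S)) = S :=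
      Multiset.filter_eq_self.2 fun x hx => mem_cone_of_mem (by simp [hx])
    have f2 : S.filter (· ∉ Cone (a.l ::ₘ S)) = 0 :=
      Multiset.filter_eq_nil.2 fun x hx => not_not.2 (mem_cone_of_mem (by simp [hx]))
    have f3 : T.filter (· ∈ Cone (a.l ::ₘ S)) = 0 :=
      Multiset.filter_eq_nil.2 fun x hx => hκr x (mem_cone_of_mem (by simp [hx]))
    have f4 : T.filter (· ∉ Cone (a.l ::ₘ S)) = T :=
      Multiset.filter_eq_self.2 fun x hx => hκr x (mem_cone_of_mem (by simp [hx]))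
    rw [Multiset.filter_add, f1, f3, add_zero] at ht'
    rw [Multiset.filter_add, f2, f4, zero_add] at hu'
    have hl' : t.links ∪ u.links = t'.links ∪ u'.links := hl.trans he.links_eq
    -- A link has its ends in the cone of one premise only, so the union of the links determines the
    -- links of each premise.
    have key : ∀ {v w v' w' : RuleTree} {M N : Multiset Occ}, Disjoint (Cone M) (Cone N) →
        Der Θ M v → Der Θ N w' → v.links ∪ w.links = v'.links ∪ w'.links →
        v.links ⊆ v'.links := by
      intro v w v' w' M N hMN hv hw h s hs
      have : s ∈ v'.links ∪ w'.links := by rw [← h]; exact Or.inl hs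
      refine this.resolve_right fun hs' => ?_
      induction s with
      | _ x y =>
        exact Set.disjoint_left.1 hMN (hv.links_cone hs (Sym2.mem_mk_left x y))
          (hw.links_cone hs' (Sym2.mem_mk_left x y))
    have l1 : t.links = t'.links := (key hd ht hu' hl').antisymm (key hd ht' hu hl'.symm)
    have l2 : u.links = u'.links := by
      rw [Set.union_comm t.links, Set.union_comm t'.links] at hl'
      exact (key hd.symm hu ht' hl').antisymm (key hd.symm hu' ht hl'.symm)
    exact ((Eqv.tens_left ha hu (ih1 t' ht' hS.tens_left l1)).trans
      (Eqv.tens_right ha ht' (ih2 u' hu' hS.tens_right l2))).trans he.symm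

/-! ### Proofs and rule trees -/

theorem swapAt_append {α : Type} (l r : List α) (a b : α) :
    swapAt l.length (l ++ a :: b :: r) = l ++ b :: a :: r := by
  induction l with
  | nil => rfl
  | cons c l ih => simp [swapAt, ih]

theorem exists_of_map_eq_middle {α β : Type} {f : α → β} {ν : List α} {Γ Δ : List β} {b : β}
    (h : ν.map f = Γ ++ b :: Δ) :
    ∃ μ x ρ, ν = μ ++ x :: ρ ∧ μ.map f = Γ ∧ f x = b ∧ ρ.map f = Δ := by
  obtain ⟨μ, τ, rfl, h1, h2⟩ := List.map_eq_append_iff.1 h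
  obtain ⟨x, ρ, rfl, h3, h4⟩ := List.map_eq_cons_iff.1 h2
  exact ⟨μ, x, ρ, rfl, h1, h3, h4⟩

theorem exists_of_map_eq_middle₂ {α β : Type} {f : α → β} {ν : List α} {Γ Δ : List β} {b c : β}
    (h : ν.map f = Γ ++ b :: c :: Δ) :
    ∃ μ x y ρ, ν = μ ++ x :: y :: ρ ∧ μ.map f = Γ ∧ f x = b ∧ f y = c ∧ ρ.map f = Δ := by
  obtain ⟨μ, x, τ, rfl, h1, h2, h3⟩ := exists_of_map_eq_middle h
  obtain ⟨y, ρ, rfl, h3, h4⟩ := List.map_eq_cons_iff.1 h3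
  exact ⟨μ, x, y, ρ, rfl, h1, h2, h3, h4⟩

theorem getD_middle {α : Type} {l r : List α} {x d : α} {n : ℕ} (h : l.length = n) :
    (l ++ x :: r).getD n d = x := by
  subst h
  simp [List.getD]

theorem take_middle {α : Type} {l r : List α} {n : ℕ} (h : l.length = n) :
    (l ++ r).take n = l := by
  subst h
  simp

theorem drop_middle {α : Type} {l r : List α} {x : α} {n : ℕ} (h : l.length = n) :
    (l ++ x :: r).drop (n + 1) = r := by
  subst h
  simp

theorem length_eq_of_map {α β : Type} {f : α → β} {l : List α} {r : List β} (h : l.map f = r) :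
    l.length = r.length := by rw [← h, List.length_map]

namespace Proof

theorem ruleTreeAux_ex {Γ Δ : List Formula} {A B : Formula} (p : Proof (Γ ++ A :: B :: Δ))
    {μ ρ : List Occ} {a b : Occ} (h : μ.length = Γ.length) :
    (Proof.ex Γ A B Δ p).ruleTreeAux (μ ++ b :: a :: ρ) = p.ruleTreeAux (μ ++ a :: b :: ρ) := by
  rw [ruleTreeAux, ← h, swapAt_append]

theorem ruleTreeAux_tens {Γ Δ : List Formula} {A B : Formula} (p : Proof (Γ ++ [A]))
    (q : Proof (B :: Δ)) {μ ρ : List Occ} {x : Occ} (h : μ.length = Γ.length) :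
    (Proof.tens Γ A B Δ p q).ruleTreeAux (μ ++ x :: ρ) =
      .tens x (p.ruleTreeAux (μ ++ [x.l])) (q.ruleTreeAux (x.r :: ρ)) := by
  rw [ruleTreeAux]
  simp only [getD_middle h, take_middle h, drop_middle h]

theorem ruleTreeAux_par {Γ : List Formula} {A B : Formula} (p : Proof (Γ ++ [A, B]))
    {μ : List Occ} {x : Occ} (h : μ.length = Γ.length) :
    (Proof.par Γ A B p).ruleTreeAux (μ ++ [x]) = .par x (p.ruleTreeAux (μ ++ [x.l, x.r])) := by
  rw [ruleTreeAux]
  simp only [getD_middle h, take_middle h]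

theorem ruleTreeAux_bot {Γ : List Formula} (p : Proof Γ) {μ : List Occ} {x : Occ}
    (h : μ.length = Γ.length) :
    (Proof.bot Γ p).ruleTreeAux (μ ++ [x]) = .bot x (p.ruleTreeAux μ) := by
  rw [ruleTreeAux]
  simp only [getD_middle h, take_middle h]

/-- The conclusions of `Der` form a multiset, so the exchange rule leaves no trace. -/
theorem der {Γ : List Formula} (p : Proof Γ) : ∀ ν : List Occ, ν.map (ty Θ) = Γ →
    Der Θ ν (p.ruleTreeAux ν) := by
  induction p with
  | ax A =>
    intro ν hν
    obtain ⟨x, τ, rfl, hx, hτ⟩ := List.map_eq_cons_iff.1 hν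
    obtain ⟨y, τ, rfl, hy, hτ⟩ := List.map_eq_cons_iff.1 hτ
    obtain rfl := List.map_eq_nil_iff.1 hτ
    exact .ax x y (by rw [hx, hy])
  | ex Γ A B Δ p ih =>
    intro ν hν
    obtain ⟨μ, x, y, ρ, rfl, rfl, rfl, rfl, rfl⟩ := exists_of_map_eq_middle₂ hν
    rw [ruleTreeAux_ex p (by simp)]
    have := ih (μ ++ y :: x :: ρ) (by simp)
    rwa [Multiset.coe_eq_coe.2 ((List.Perm.swap x y ρ).append_left μ)] at this
  | tens Γ A B Δ p q ihp ihq =>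
    intro ν hν
    obtain ⟨μ, x, ρ, rfl, rfl, hx, rfl⟩ := exists_of_map_eq_middle hν
    rw [ruleTreeAux_tens p q (by simp)]
    have h1 := ihp (μ ++ [x.l]) (by simp [ty_l (Or.inl hx)])
    have h2 := ihq (x.r :: ρ) (by simp [ty_r (Or.inl hx)])
    have := Der.tens x A B μ ρ _ _ hx
      (by rwa [Multiset.cons_coe, ← Multiset.coe_eq_coe.2 (List.perm_append_singleton x.l μ)]) h2
    rwa [Multiset.coe_add, Multiset.cons_coe,
      ← Multiset.coe_eq_coe.2 (List.perm_middle (a := x) (l₁ := μ) (l₂ := ρ))] at this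
  | one =>
    intro ν hν
    obtain ⟨x, τ, rfl, hx, hτ⟩ := List.map_eq_cons_iff.1 hν
    obtain rfl := List.map_eq_nil_iff.1 hτ
    exact .one x hx
  | par Γ A B p ih =>
    intro ν hν
    obtain ⟨μ, x, ρ, rfl, rfl, hx, hρ⟩ := exists_of_map_eq_middle hν
    obtain rfl := List.map_eq_nil_iff.1 hρ
    rw [ruleTreeAux_par p (by simp)]
    have h1 := ih (μ ++ [x.l, x.r]) (by simp [ty_l (Or.inr hx), ty_r (Or.inr hx)])
    rw [Multiset.coe_eq_coe.2 (List.perm_append_comm (l₁ := μ) (l₂ := [x.l, x.r]))] at h1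
    have := Der.par x A B μ _ hx h1
    rwa [Multiset.cons_coe, ← Multiset.coe_eq_coe.2 (List.perm_append_singleton x μ)] at this
  | bot Γ p ih =>
    intro ν hν
    obtain ⟨μ, x, ρ, rfl, rfl, hx, hρ⟩ := exists_of_map_eq_middle hν
    obtain rfl := List.map_eq_nil_iff.1 hρ
    rw [ruleTreeAux_bot p (by simp)]
    have := Der.bot x μ _ hx (ih μ rfl)
    rwa [Multiset.cons_coe, ← Multiset.coe_eq_coe.2 (List.perm_append_singleton x μ)] at this

end Proof

/-- The tree `t` is the rule tree of a proof of the formulae named by `ν`. -/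
def Realized (Θ : List Formula) (ν : List Occ) (t : RuleTree) : Prop :=
  ∃ p : Proof (ν.map (ty Θ)), p.ruleTreeAux ν = t

theorem realized_iff {Γ : List Formula} {ν : List Occ} {t : RuleTree} (h : ν.map (ty Θ) = Γ) :
    Realized Θ ν t ↔ ∃ p : Proof Γ, p.ruleTreeAux ν = t := by
  subst h
  rfl

theorem Realized.swap {μ ρ : List Occ} {a b : Occ} {t : RuleTree}
    (h : Realized Θ (μ ++ a :: b :: ρ) t) : Realized Θ (μ ++ b :: a :: ρ) t := by
  obtain ⟨p, hp⟩ := (realized_iff (by simp; rfl)).1 h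
  refine (realized_iff (by simp)).2 ⟨.ex (μ.map (ty Θ)) (ty Θ a) (ty Θ b) (ρ.map (ty Θ)) p, ?_⟩
  rw [Proof.ruleTreeAux_ex p (by simp), hp]

theorem Realized.perm_append {ν ν' : List Occ} (h : ν.Perm ν') {t : RuleTree} :
    ∀ μ, Realized Θ (μ ++ ν) t → Realized Θ (μ ++ ν') t := by
  induction h with
  | nil => exact fun μ => id
  | cons a _ ih =>
    intro μ h
    have := ih (μ ++ [a]) (by simpa using h)
    simpa using this
  | swap a b l => exact fun μ => Realized.swap
  | trans _ _ ih ih' => exact fun μ h => ih' μ (ih μ h)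

theorem Realized.perm {ν ν' : List Occ} (h : ν.Perm ν') {t : RuleTree}
    (ht : Realized Θ ν t) : Realized Θ ν' t := Realized.perm_append h [] ht

/-- The converse of `Proof.der`. The relation `∼` passes through actual proofs, so the trees met
along a chain of interchanges have to be turned back into proofs. -/
theorem Der.realized {S : Multiset Occ} {t : RuleTree} (h : Der Θ S t) :
    ∀ ν : List Occ, (ν : Multiset Occ) = S → Realized Θ ν t := by
  -- By exchange, one ordering of the conclusions is enough.
  have out : ∀ {S : Multiset Occ} {t : RuleTree},
      (∃ ν : List Occ, (ν : Multiset Occ) = S ∧ Realized Θ ν t) →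
      ∀ ν : List Occ, (ν : Multiset Occ) = S → Realized Θ ν t := by
    rintro S t ⟨ν, rfl, h⟩ ν' h'
    exact h.perm (Multiset.coe_eq_coe.1 h'.symm)
  induction h with
  | ax x y h =>
    refine out ⟨[x, y], rfl, (realized_iff (by simp [h])).2 ⟨.ax (ty Θ x), rfl⟩⟩
  | one x h => exact out ⟨[x], rfl, (realized_iff (by simp [h])).2 ⟨.one, rfl⟩⟩
  | bot x S t hx _ ih =>
    induction S using Quotient.inductionOn with
    | _ μ =>
    obtain ⟨p, rfl⟩ := ih μ rfl
    refine out ⟨μ ++ [x], Multiset.coe_eq_coe.2 (List.perm_append_singleton x μ),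
      (realized_iff (by simp [hx])).2 ⟨.bot _ p, ?_⟩⟩
    rw [Proof.ruleTreeAux_bot p (by simp)]
  | par x A B S t hx _ ih =>
    induction S using Quotient.inductionOn with
    | _ μ =>
    obtain ⟨p, rfl⟩ := (realized_iff (by
      simp [ty_l (Or.inr hx), ty_r (Or.inr hx)]; rfl)).1 (ih (μ ++ [x.l, x.r])
      (Multiset.coe_eq_coe.2 List.perm_append_comm))
    refine out ⟨μ ++ [x], Multiset.coe_eq_coe.2 (List.perm_append_singleton x μ),
      (realized_iff (by simp [hx])).2 ⟨.par (μ.map (ty Θ)) A B p, ?_⟩⟩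
    rw [Proof.ruleTreeAux_par p (by simp)]
  | tens x A B S T t u hx _ _ ih1 ih2 =>
    induction S using Quotient.inductionOn with
    | _ μ =>
    induction T using Quotient.inductionOn with
    | _ ρ =>
    obtain ⟨p, rfl⟩ := (realized_iff (by simp [ty_l (Or.inl hx)]; rfl)).1 (ih1 (μ ++ [x.l])
      (Multiset.coe_eq_coe.2 List.perm_append_comm))
    obtain ⟨q, rfl⟩ := (realized_iff (by simp [ty_r (Or.inl hx)]; rfl)).1 (ih2 (x.r :: ρ) rfl)
    refine out ⟨μ ++ x :: ρ, Multiset.coe_eq_coe.2 List.perm_middle,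
      (realized_iff (by simp [hx])).2 ⟨.tens (μ.map (ty Θ)) A B (ρ.map (ty Θ)) p q, ?_⟩⟩
    rw [Proof.ruleTreeAux_tens p q (by simp)]

/-- The names of the formulae of a sequent. -/
def roots (Γ : List Formula) : List Occ := (List.range Γ.length).map fun i => (i, [])

theorem roots_map (Γ : List Formula) : (roots Γ).map (ty Γ) = Γ := by
  refine List.ext_getElem (by simp [roots]) fun i h1 h2 => ?_
  simp [roots, ty, Formula.subAt, h2]

theorem roots_anti (Γ : List Formula) : Anti (roots Γ) := by
  refine ⟨Multiset.coe_nodup.2 (List.nodup_range.map fun i j h => by simpa using h), ?_⟩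
  intro v hv w hw h
  simp only [roots, Multiset.mem_coe, List.mem_map, List.mem_range] at hv hw
  obtain ⟨i, -, rfl⟩ := hv
  obtain ⟨j, -, rfl⟩ := hw
  exact Prod.ext h.1 rfl

theorem Proof.der_ruleTree {Γ : List Formula} (p : Proof Γ) : Der Γ (roots Γ) p.ruleTree :=
  p.der _ (roots_map Γ)

/-- Only transitivity is at stake: the intermediate tree has to be realized by a proof. -/
theorem permEquiv_of_eqv {Γ : List Formula} {t t' : RuleTree} (h : Eqv Γ (roots Γ) t t') :
    ∀ p p' : Proof Γ, p.ruleTree = t → p'.ruleTree = t' → p.PermEquiv p' := by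
  induction h with
  | rel t t' h =>
    rintro p p' rfl rfl
    exact .rel _ _ ⟨rfl, Or.inr h.2.2⟩
  | refl t =>
    rintro p p' h rfl
    exact .rel _ _ ⟨rfl, Or.inl h⟩
  | symm t t' _ ih => exact fun p p' h h' => .symm _ _ (ih p' p h' h)
  | trans t u v htu huv ih ih' =>
    rintro p p' hp rfl
    have hu : Der Γ (roots Γ) u := by
      rw [← Eqv.der_iff htu, ← hp]
      exact p.der_ruleTree
    obtain ⟨q, hq⟩ := (realized_iff (roots_map Γ)).1 (hu.realized _ rfl)
    exact .trans _ _ _ (ih p q hp hq) (ih' q p' hq rfl)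

theorem PermStep.invariant {p q : Σ Γ : List Formula, Proof Γ}
    (h : Relation.EqvGen PermStep p q) :
    p.1 = q.1 ∧ p.2.ruleTree.links = q.2.ruleTree.links := by
  induction h with
  | rel p q h =>
    refine ⟨h.1, ?_⟩
    rcases h.2 with h | h
    · rw [h]
    · exact h.links_eq
  | refl p => exact ⟨rfl, rfl⟩
  | symm p q _ ih => exact ⟨ih.1.symm, ih.2.symm⟩
  | trans p q r _ _ ih ih' => exact ⟨ih.1.trans ih'.1, ih.2.trans ih'.2⟩

/-! ### Names of the nodes and arcs of proof-structures -/

/-- Names of nodes: `rule a` introduces the occurrence `a`, `ax s` is the axiom with conclusions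
`s`, and `bul a` is the `bullet` node below `a`. -/
inductive Name : Type
  | rule (a : Occ)
  | ax (s : Sym2 Occ)
  | bul (a : Occ)

/-- The occurrence immediately below `x`. -/
def Occ.parent (x : Occ) : Occ := (x.1, x.2.tail)

@[simp] theorem Occ.parent_child (x : Occ) (b : Bool) : (x.child b).parent = x := rfl

/-- The name of the head of the arc named `x`, when `ν` names the conclusions. -/
def headName (ν : List Occ) (x : Occ) : Name := if x ∈ ν then .bul x else .rule x.parent

/-- The label of the node that introduces a formula. -/
def Formula.kind : Formula → Label
  | .tens _ _ => .tens
  | .par _ _ => .par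
  | .bot => .bot
  | .one => .one
  | .atom _ _ => .ax

/-- The label of the node with the given name. -/
def Name.label (Θ : List Formula) : Name → Label
  | .rule a => (ty Θ a).kind
  | .ax _ => .ax
  | .bul _ => .bullet

/-- The name of a premise of the node that introduces `a`. -/
def premOcc (a : Occ) (b : Bool) : Formula → Option Occ
  | .tens _ _ => some (a.child b)
  | .par _ _ => some (a.child b)
  | _ => none

/-- The name of a premise of the node with the given name. -/
def Name.prem (Θ : List Formula) (b : Bool) : Name → Option Occ
  | .rule a => premOcc a b (ty Θ a)
  | .ax _ => none
  | .bul _ => none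

/-- `nA` and `nN` name the arcs and the nodes of the proof-structure `R`, whose conclusions are
named by `ν`; the axioms of `R` are `L`, and `P` is the set of the conclusions of its other nodes.
The jumps are disregarded. -/
structure IsNaming (Θ : List Formula) (ν : List Occ) (L : Set (Sym2 Occ)) (P : Set Occ)
    (R : PreStructure) (nA : R.A → Occ) (nN : R.N → Name) : Prop where
  nA_inj : Function.Injective nA
  nN_inj : Function.Injective nN
  type : ∀ a, R.type a = ty Θ (nA a)
  concl : R.concl.map nA = ν
  label : ∀ n, R.label n = (nN n).label Θ
  head : ∀ a, nN (R.head a) = headName ν (nA a)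
  left : ∀ n, (R.left n).map nA = (nN n).prem Θ false
  right : ∀ n, (R.right n).map nA = (nN n).prem Θ true
  tail_ax : ∀ a, ∀ s ∈ L, nA a ∈ s → nN (R.tail a) = .ax s
  tail_rule : ∀ a, nA a ∈ P → nN (R.tail a) = .rule (nA a)
  mem_occs : ∀ a, nA a ∈ P ∨ ∃ s ∈ L, nA a ∈ s
  exists_rule : ∀ x ∈ P, ∃ a, nA a = x
  exists_ax : ∀ s ∈ L, ∃ a b, a ≠ b ∧ s = s(nA a, nA b)
  node : ∀ n, (∃ a, R.tail a = n) ∨ ∃ a, nA a ∈ ν ∧ R.head a = n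

namespace IsNaming

variable {ν : List Occ} {L : Set (Sym2 Occ)} {P : Set Occ} {R : PreStructure} {nA : R.A → Occ}
  {nN : R.N → Name}

theorem mem_iff (h : IsNaming Θ ν L P R nA nN) (a : R.A) : nA a ∈ ν ↔ a ∈ R.concl := by
  rw [← h.concl, List.mem_map_of_injective h.nA_inj]

theorem tail_cases (h : IsNaming Θ ν L P R nA nN) (a : R.A) :
    (nA a ∈ P ∧ nN (R.tail a) = .rule (nA a)) ∨
      ∃ s ∈ L, nA a ∈ s ∧ nN (R.tail a) = .ax s := by
  rcases h.mem_occs a with ha | ⟨s, hs, ha⟩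
  · exact Or.inl ⟨ha, h.tail_rule a ha⟩
  · exact Or.inr ⟨s, hs, ha, h.tail_ax a s hs ha⟩

theorem node_cases (h : IsNaming Θ ν L P R nA nN) (n : R.N) :
    (∃ a, R.tail a = n ∧ nA a ∈ P ∧ nN n = .rule (nA a)) ∨
    (∃ s ∈ L, nN n = .ax s) ∨
    (∃ a, R.head a = n ∧ nA a ∈ ν ∧ nN n = .bul (nA a)) := by
  rcases h.node n with ⟨a, rfl⟩ | ⟨a, ha, rfl⟩
  · rcases h.tail_cases a with ⟨h1, h2⟩ | ⟨s, hs, h1, h2⟩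
    · exact Or.inl ⟨a, rfl, h1, h2⟩
    · exact Or.inr (Or.inl ⟨s, hs, h2⟩)
  · refine Or.inr (Or.inr ⟨a, rfl, ha, ?_⟩)
    rw [h.head, headName, if_pos ha]

theorem mem_of_rule (h : IsNaming Θ ν L P R nA nN) {n : R.N} {x : Occ} (hn : nN n = .rule x) :
    x ∈ P := by
  rcases h.node_cases n with ⟨a, -, h1, h2⟩ | ⟨s, -, h2⟩ | ⟨a, -, -, h2⟩ <;> rw [hn] at h2 <;>
    cases h2
  exact h1

theorem mem_of_ax (h : IsNaming Θ ν L P R nA nN) {n : R.N} {s : Sym2 Occ} (hn : nN n = .ax s) :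
    s ∈ L := by
  rcases h.node_cases n with ⟨a, -, -, h2⟩ | ⟨s, h1, h2⟩ | ⟨a, -, -, h2⟩ <;> rw [hn] at h2 <;>
    cases h2
  exact h1

theorem of_bul (h : IsNaming Θ ν L P R nA nN) {n : R.N} {x : Occ} (hn : nN n = .bul x) :
    ∃ a, nA a = x ∧ x ∈ ν := by
  rcases h.node_cases n with ⟨a, -, h1, h2⟩ | ⟨s, -, h2⟩ | ⟨a, -, h1, h2⟩ <;> rw [hn] at h2 <;>
    cases h2
  exact ⟨a, rfl, h1⟩

theorem exists_node_rule (h : IsNaming Θ ν L P R nA nN) {x : Occ} (hx : x ∈ P) :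
    ∃ n, nN n = .rule x := by
  obtain ⟨a, rfl⟩ := h.exists_rule x hx
  exact ⟨_, h.tail_rule a hx⟩

theorem exists_node_ax (h : IsNaming Θ ν L P R nA nN) {s : Sym2 Occ} (hs : s ∈ L) :
    ∃ n, nN n = .ax s := by
  obtain ⟨a, b, -, rfl⟩ := h.exists_ax s hs
  exact ⟨_, h.tail_ax a _ hs (Sym2.mem_mk_left _ _)⟩

theorem exists_of_mem_ax (h : IsNaming Θ ν L P R nA nN) {s : Sym2 Occ} {x : Occ} (hs : s ∈ L)
    (hx : x ∈ s) : ∃ a, nA a = x := by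
  obtain ⟨a, b, -, rfl⟩ := h.exists_ax s hs
  rcases Sym2.mem_iff.1 hx with rfl | rfl
  · exact ⟨a, rfl⟩
  · exact ⟨b, rfl⟩

theorem tail_ne_bul (h : IsNaming Θ ν L P R nA nN) (a : R.A) (x : Occ) :
    nN (R.tail a) ≠ .bul x := by
  rcases h.tail_cases a with ⟨-, h2⟩ | ⟨s, -, -, h2⟩ <;> rw [h2] <;> simp

theorem head_eq_bul (h : IsNaming Θ ν L P R nA nN) {a : R.A} {x : Occ}
    (ha : nN (R.head a) = .bul x) : nA a = x ∧ x ∈ ν := by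
  rw [h.head, headName] at ha
  split_ifs at ha with h1
  cases ha
  exact ⟨rfl, h1⟩

theorem ax {x y : Occ} {A : Formula} (hxy : x ≠ y) (hx : ty Θ x = A) (hy : ty Θ y = A.dual) :
    IsNaming Θ [x, y] {s(x, y)} ∅ (PreStructure.ax A) (fun b => cond b y x)
      (fun n => n.elim (.ax s(x, y)) fun b => .bul (cond b y x)) where
  nA_inj := by rintro (_ | _) (_ | _) <;> simp [hxy, hxy.symm]
  nN_inj := by rintro (_ | _ | _) (_ | _ | _) <;> simp [hxy, hxy.symm]
  type := by rintro (_ | _) <;> simp [hx, hy]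
  concl := rfl
  label := by rintro (_ | _) <;> rfl
  head := by rintro (_ | _) <;> simp [headName]
  left := by rintro (_ | _) <;> rfl
  right := by rintro (_ | _) <;> rfl
  tail_ax a s hs _ := by
    rw [Set.mem_singleton_iff] at hs
    simp [hs]
  tail_rule a h := h.elim
  mem_occs := by rintro (_ | _) <;> simp
  exists_rule x h := h.elim
  exists_ax s hs := ⟨false, true, by simp, hs⟩
  node := by
    rintro (_ | b)
    · exact Or.inl ⟨true, rfl⟩
    · exact Or.inr ⟨b, by cases b <;> simp, rfl⟩

theorem one {x : Occ} (hx : ty Θ x = .one) :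
    IsNaming Θ [x] ∅ {x} PreStructure.one (fun _ => x) (fun b => cond b (.bul x) (.rule x)) where
  nA_inj := by rintro ⟨⟩ ⟨⟩ _; rfl
  nN_inj := by rintro (_ | _) (_ | _) <;> simp
  type _ := hx.symm
  concl := rfl
  label := by rintro (_ | _) <;> simp [Name.label, hx, Formula.kind]
  head := by rintro ⟨⟩; simp [headName]
  left := by rintro (_ | _) <;> simp [Name.prem, hx, premOcc]
  right := by rintro (_ | _) <;> simp [Name.prem, hx, premOcc]
  tail_ax a s hs := hs.elim
  tail_rule a _ := rfl
  mem_occs _ := Or.inl rfl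
  exists_rule y hy := ⟨(), hy.symm⟩
  exists_ax s hs := hs.elim
  node := by
    rintro (_ | _)
    · exact Or.inl ⟨(), rfl⟩
    · exact Or.inr ⟨(), by simp, rfl⟩

theorem ex (h : IsNaming Θ ν L P R nA nN) {i : ℕ} {ν' : List Occ} (hν : ∀ x, x ∈ ν ↔ x ∈ ν')
    (hc : (swapAt i R.concl).map nA = ν') : IsNaming Θ ν' L P (R.ex i) nA nN :=
  { h with
    concl := hc
    head := fun a => by rw [h.head, headName, headName]; simp only [hν]
    node := fun n => by simpa only [hν] using h.node n }

theorem same (h : IsNaming Θ ν L P R nA nN) {S : PreStructure} (e : R.BaseIso S) :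
    IsNaming Θ ν L P S (nA ∘ e.arc.symm) (nN ∘ e.node.symm) := by
  have htail : ∀ a, e.node.symm (S.tail a) = R.tail (e.arc.symm a) := fun a => by
    rw [Equiv.symm_apply_eq, ← e.tail, Equiv.apply_symm_apply]
  have hhead : ∀ a, e.node.symm (S.head a) = R.head (e.arc.symm a) := fun a => by
    rw [Equiv.symm_apply_eq, ← e.head, Equiv.apply_symm_apply]
  exact
  { nA_inj := h.nA_inj.comp e.arc.symm.injective
    nN_inj := h.nN_inj.comp e.node.symm.injective
    type := fun a => by rw [Function.comp_apply, ← h.type, ← e.type, Equiv.apply_symm_apply]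
    concl := by rw [e.concl, ← h.concl]; simp
    label := fun n => by rw [Function.comp_apply, ← h.label, ← e.label, Equiv.apply_symm_apply]
    head := fun a => by rw [Function.comp_apply, hhead, h.head]; rfl
    left := fun n => by
      have := e.left (e.node.symm n)
      rw [Equiv.apply_symm_apply] at this
      rw [Function.comp_apply, this, ← h.left, Option.map_map, Function.comp_assoc]
      simp
    right := fun n => by
      have := e.right (e.node.symm n)
      rw [Equiv.apply_symm_apply] at this
      rw [Function.comp_apply, this, ← h.right, Option.map_map, Function.comp_assoc]
      simp
    tail_ax := fun a s hs ha => by rw [Function.comp_apply, htail]; exact h.tail_ax _ s hs ha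
    tail_rule := fun a ha => by rw [Function.comp_apply, htail]; exact h.tail_rule _ ha
    mem_occs := fun a => h.mem_occs _
    exists_rule := fun x hx => by
      obtain ⟨a, rfl⟩ := h.exists_rule x hx
      exact ⟨e.arc a, by simp⟩
    exists_ax := fun s hs => by
      obtain ⟨a, b, hab, rfl⟩ := h.exists_ax s hs
      exact ⟨e.arc a, e.arc b, by simpa using hab, by simp⟩
    node := fun n => by
      rcases h.node (e.node.symm n) with ⟨a, ha⟩ | ⟨a, ha, hn⟩
      · exact Or.inl ⟨e.arc a, by rw [e.tail, ha, Equiv.apply_symm_apply]⟩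
      · exact Or.inr ⟨e.arc a, by simpa using ha, by rw [e.head, hn, Equiv.apply_symm_apply]⟩ }

/-- It is enough that arc names are disjoint: every node name mentions an occurrence that names some
arc of the same structure. -/
theorem union (h : IsNaming Θ ν L P R nA nN) {S : PreStructure} {ν' : List Occ}
    {L' : Set (Sym2 Occ)} {P' : Set Occ} {mA : S.A → Occ} {mN : S.N → Name}
    (h' : IsNaming Θ ν' L' P' S mA mN) (hd : ∀ a b, nA a ≠ mA b) :
    IsNaming Θ (ν ++ ν') (L ∪ L') (P ∪ P') (R.union S) (Sum.elim nA mA) (Sum.elim nN mN) := by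
  have hN : ∀ n m, nN n ≠ mN m := by
    intro n m hnm
    rcases h.node_cases n with ⟨a, -, h1, h2⟩ | ⟨s, h1, h2⟩ | ⟨a, -, h1, h2⟩
    · obtain ⟨b, hb⟩ := h'.exists_rule _ (h'.mem_of_rule (hnm.symm.trans h2))
      exact hd _ _ hb.symm
    · obtain ⟨a, b, -, rfl⟩ := h.exists_ax s h1
      obtain ⟨c, hc⟩ := h'.exists_of_mem_ax (h'.mem_of_ax (hnm.symm.trans h2))
        (Sym2.mem_mk_left _ _)
      exact hd _ _ hc.symm
    · obtain ⟨b, hb, -⟩ := h'.of_bul (hnm.symm.trans h2)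
      exact hd _ _ hb.symm
  have hν' : ∀ a, nA a ∉ ν' := fun a ha => by
    rw [← h'.concl, List.mem_map] at ha
    obtain ⟨b, -, hb⟩ := ha
    exact hd a b hb.symm
  have hν : ∀ b, mA b ∉ ν := fun b hb => by
    rw [← h.concl, List.mem_map] at hb
    obtain ⟨a, -, ha⟩ := hb
    exact hd a b ha
  exact
  { nA_inj := h.nA_inj.sumElim h'.nA_inj hd
    nN_inj := h.nN_inj.sumElim h'.nN_inj hN
    type := by rintro (a | a); exacts [h.type a, h'.type a]
    concl := by simp [← h.concl, ← h'.concl]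
    label := by rintro (a | a); exacts [h.label a, h'.label a]
    head := by
      rintro (a | a)
      · simp [h.head, headName, hν']
      · simp [h'.head, headName, hν]
    left := by
      rintro (n | n)
      · simp only [Sum.elim_inl, Option.map_map, Sum.elim_comp_inl]; exact h.left n
      · simp only [Sum.elim_inr, Option.map_map, Sum.elim_comp_inr]; exact h'.left n
    right := by
      rintro (n | n)
      · simp only [Sum.elim_inl, Option.map_map, Sum.elim_comp_inl]; exact h.right n
      · simp only [Sum.elim_inr, Option.map_map, Sum.elim_comp_inr]; exact h'.right n
    tail_ax := by
      rintro (a | a) s (hs | hs) ha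
      · exact h.tail_ax a s hs ha
      · obtain ⟨b, hb⟩ := h'.exists_of_mem_ax hs ha
        exact (hd a b hb.symm).elim
      · obtain ⟨b, hb⟩ := h.exists_of_mem_ax hs ha
        exact (hd b a hb).elim
      · exact h'.tail_ax a s hs ha
    tail_rule := by
      rintro (a | a) (ha | ha)
      · exact h.tail_rule a ha
      · obtain ⟨b, hb⟩ := h'.exists_rule _ ha
        exact (hd a b hb.symm).elim
      · obtain ⟨b, hb⟩ := h.exists_rule _ ha
        exact (hd b a hb).elim
      · exact h'.tail_rule a ha
    mem_occs := by
      rintro (a | a)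
      · exact (h.mem_occs a).imp Or.inl fun ⟨s, hs, ha⟩ => ⟨s, Or.inl hs, ha⟩
      · exact (h'.mem_occs a).imp Or.inr fun ⟨s, hs, ha⟩ => ⟨s, Or.inr hs, ha⟩
    exists_rule := by
      rintro x (hx | hx)
      · obtain ⟨a, ha⟩ := h.exists_rule x hx
        exact ⟨.inl a, ha⟩
      · obtain ⟨a, ha⟩ := h'.exists_rule x hx
        exact ⟨.inr a, ha⟩
    exists_ax := by
      rintro s (hs | hs)
      · obtain ⟨a, b, hab, h⟩ := h.exists_ax s hs
        exact ⟨.inl a, .inl b, by simpa using hab, h⟩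
      · obtain ⟨a, b, hab, h⟩ := h'.exists_ax s hs
        exact ⟨.inr a, .inr b, by simpa using hab, h⟩
    node := by
      rintro (n | n)
      · rcases h.node n with ⟨a, ha⟩ | ⟨a, ha, hn⟩
        · exact Or.inl ⟨.inl a, by simp [ha]⟩
        · exact Or.inr ⟨.inl a, by simp [ha], by simp [hn]⟩
      · rcases h'.node n with ⟨a, ha⟩ | ⟨a, ha, hn⟩
        · exact Or.inl ⟨.inr a, by simp [ha]⟩
        · exact Or.inr ⟨.inr a, by simp [ha], by simp [hn]⟩ }

/-- The names of the arcs after the addition of a terminal node with conclusion `x`. -/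
abbrev addA (nA : R.A → Occ) (x : Occ) (a : Option R.A) : Occ := a.elim x nA

/-- The names of the nodes after the addition of a terminal node with conclusion `x`. -/
abbrev addN (nN : R.N → Name) (x : Occ) {l r : Option R.A} :
    {n : R.N // ¬ R.Meets l r n} ⊕ Bool → Name :=
  Sum.elim (fun n => nN n.1) fun b => cond b (.bul x) (.rule x)

theorem addN_emb {l r : Option R.A} (x : Occ) {n : R.N} (hn : ¬ R.Meets l r n) :
    addN nN x (R.emb l r n) = nN n := by
  simp [PreStructure.emb, hn]

/-- One statement serves `⊥`, `⅋` and `⊗`: `hl` and `hr` say that the premises are named by the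
children of `x`, or are absent when its formula has none. -/
theorem addNode (h : IsNaming Θ ν L P R nA nN) (hν : ν.Nodup) {x : Occ} {l r : Option R.A}
    {Γ Δ : List R.A} {k : Label} {F : Formula} (j : Option R.N)
    (hc : R.concl = Γ ++ (l.toList ++ r.toList) ++ Δ)
    (hl : l.map nA = premOcc x false (ty Θ x)) (hr : r.map nA = premOcc x true (ty Θ x))
    (hk : k = (ty Θ x).kind) (hF : F = ty Θ x) (hx : ∀ a, nA a ≠ x) :
    IsNaming Θ (Γ.map nA ++ x :: Δ.map nA) L (insert x P) (R.addNode k l r F j Γ Δ)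
      (addA nA x) (addN nN x) := by
  have hprem : ∀ {b y}, premOcc x b (ty Θ x) = some y → y = x.child b := by
    intro b y hy
    cases hF : ty Θ x <;> rw [hF] at hy <;> simp [premOcc] at hy <;> exact hy.symm
  have hD : ∀ a, l = some a ∨ r = some a → ∃ b, nA a = x.child b := by
    rintro a (rfl | rfl)
    · exact ⟨false, hprem hl.symm⟩
    · exact ⟨true, hprem hr.symm⟩
  have hmem : ∀ a, nA a ∈ ν ↔ a ∈ Γ ∨ (l = some a ∨ r = some a) ∨ a ∈ Δ := by
    intro a
    rw [h.mem_iff, hc]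
    simp [or_assoc]
  have hnd : R.concl.Nodup := by
    rw [← h.concl] at hν
    exact hν.of_map _
  have hDΓ : ∀ a, l = some a ∨ r = some a → a ∉ Γ ∧ a ∉ Δ := by
    intro a ha
    rw [hc, List.append_assoc, List.nodup_append, List.nodup_append] at hnd
    have ha' : a ∈ l.toList ++ r.toList := by simpa using ha
    exact ⟨fun h => hnd.2.2 a h a (by simp only [List.mem_append]; left; simpa using ha') rfl,
      fun h => hnd.2.1.2.2 a ha' a h rfl⟩
  have hnew : ∀ a, nA a ∈ Γ.map nA ++ x :: Δ.map nA ↔ a ∈ Γ ∨ a ∈ Δ := by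
    intro a
    rw [List.mem_append, List.mem_cons, List.mem_map_of_injective h.nA_inj,
      List.mem_map_of_injective h.nA_inj]
    simp [hx a]
  -- The nodes that vanish are the `bullet` nodes below the premises. No tail is among them, and no
  -- head of another arc, because the names determine the nodes.
  have hmeet : ∀ {c}, (l = some c ∨ r = some c) → nN (R.head c) = .bul (nA c) := by
    intro c hc
    rw [h.head, headName, if_pos ((hmem c).2 (Or.inr (Or.inl hc)))]
  have hhead : ∀ {a}, ¬ (l = some a ∨ r = some a) → ¬ R.Meets l r (R.head a) := by
    rintro a ha ⟨c, hc, hca⟩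
    have h1 := hmeet hc
    rw [hca] at h1
    have := h.nA_inj (h.head_eq_bul h1).1
    subst this
    exact ha hc
  have htail : ∀ a, ¬ R.Meets l r (R.tail a) := by
    rintro a ⟨c, hc, hca⟩
    have h1 := hmeet hc
    rw [hca] at h1
    exact h.tail_ne_bul a _ h1
  have hrule : ∀ n, nN n ≠ .rule x := fun n hn => by
    obtain ⟨a, ha⟩ := h.exists_rule _ (h.mem_of_rule hn)
    exact hx a ha
  have hbul : ∀ n, nN n ≠ .bul x := fun n hn => by
    obtain ⟨a, ha, -⟩ := h.of_bul hn
    exact hx a ha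
  exact
  { nA_inj := by
      rintro (_ | a) (_ | b) hab
      · rfl
      · exact (hx b hab.symm).elim
      · exact (hx a hab).elim
      · exact congrArg some (h.nA_inj hab)
    nN_inj := by
      rintro (⟨n, hn⟩ | _ | _) (⟨m, hm⟩ | _ | _) hnm
      · have := h.nN_inj hnm
        subst this
        rfl
      · exact (hrule _ hnm).elim
      · exact (hbul _ hnm).elim
      · exact (hrule _ hnm.symm).elim
      · rfl
      · cases hnm
      · exact (hbul _ hnm.symm).elim
      · cases hnm
      · rfl
    type := by
      rintro (_ | a)
      · exact hF
      · exact h.type a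
    concl := by
      simp only [List.map_append, List.map_map, List.map_cons]
      rfl
    label := by
      rintro (⟨n, hn⟩ | _ | _)
      · exact h.label n
      · exact hk
      · rfl
    head := by
      rintro (_ | a)
      · simp [headName]
      · by_cases ha : l = some a ∨ r = some a
        · have hm : R.Meets l r (R.head a) := ⟨a, ha, rfl⟩
          obtain ⟨b, hb⟩ := hD a ha
          have h1 : nA a ∉ Γ.map nA ++ x :: Δ.map nA := by
            rw [hnew]
            have := hDΓ a ha
            tauto
          have h2 : headName (Γ.map nA ++ x :: Δ.map nA) (nA a) = .rule x := by
            rw [headName, if_neg h1, hb, Occ.parent_child]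
          refine Eq.trans ?_ h2.symm
          simp [PreStructure.emb, hm]
        · have h1 := addN_emb (nN := nN) x (hhead ha)
          have h2 : nA a ∈ ν ↔ nA a ∈ Γ.map nA ++ x :: Δ.map nA := by
            rw [hnew, hmem]
            tauto
          refine h1.trans ?_
          rw [h.head]
          exact if_congr h2 rfl rfl
    left := by
      rintro (⟨n, hn⟩ | _ | _)
      · have := h.left n
        simp only [Option.map_map]
        exact this
      · simp only [Option.map_map]
        exact hl
      · rfl
    right := by
      rintro (⟨n, hn⟩ | _ | _)
      · have := h.right n
        simp only [Option.map_map]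
        exact this
      · simp only [Option.map_map]
        exact hr
      · rfl
    tail_ax := by
      rintro (_ | a) s hs ha
      · obtain ⟨b, hb⟩ := h.exists_of_mem_ax hs ha
        exact (hx b hb).elim
      · exact (addN_emb x (htail a)).trans (h.tail_ax a s hs ha)
    tail_rule := by
      rintro (_ | a) ha
      · rfl
      · exact (addN_emb x (htail a)).trans (h.tail_rule a (ha.resolve_left (hx a)))
    mem_occs := by
      rintro (_ | a)
      · exact Or.inl (Or.inl rfl)
      · exact (h.mem_occs a).imp Or.inr id
    exists_rule := by
      rintro y (rfl | hy)
      · exact ⟨none, rfl⟩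
      · obtain ⟨a, ha⟩ := h.exists_rule y hy
        exact ⟨some a, ha⟩
    exists_ax := by
      intro s hs
      obtain ⟨a, b, hab, h⟩ := h.exists_ax s hs
      exact ⟨some a, some b, by simpa using hab, h⟩
    node := by
      rintro (⟨n, hn⟩ | _ | _)
      · rcases h.node n with ⟨a, rfl⟩ | ⟨a, ha, rfl⟩
        · exact Or.inl ⟨some a, by simp [PreStructure.emb, hn]⟩
        · refine Or.inr ⟨some a, ?_, by simp [PreStructure.emb, hn]⟩
          refine (hnew a).2 ?_
          have h1 : ¬ (l = some a ∨ r = some a) := fun ha => hn ⟨a, ha, rfl⟩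
          have := (hmem a).1 ha
          tauto
      · exact Or.inl ⟨none, rfl⟩
      · exact Or.inr ⟨none, by simp, rfl⟩ }

end IsNaming

theorem exists_equiv_of_range_eq {α β γ : Type} {f : α → γ} {g : β → γ}
    (hf : Function.Injective f) (hg : Function.Injective g) (h : ∀ a, ∃ b, g b = f a)
    (h' : ∀ b, ∃ a, f a = g b) : ∃ e : α ≃ β, ∀ a, g (e a) = f a := by
  choose u hu using h
  choose v hv using h'
  exact ⟨⟨u, v, fun a => hf (by rw [hv, hu]), fun b => hg (by rw [hu, hv])⟩, hu⟩

/-- Proof-structures with the same names are isomorphic. -/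
theorem IsNaming.exists_baseIso {ν : List Occ} {L : Set (Sym2 Occ)} {P : Set Occ}
    {R S : PreStructure} {nA : R.A → Occ} {nN : R.N → Name} {mA : S.A → Occ} {mN : S.N → Name}
    (h : IsNaming Θ ν L P R nA nN) (h' : IsNaming Θ ν L P S mA mN) :
    ∃ e : R.BaseIso S, (∀ a, mA (e.arc a) = nA a) ∧ ∀ n, mN (e.node n) = nN n := by
  have key : ∀ {R S : PreStructure} {nA : R.A → Occ} {nN : R.N → Name} {mA : S.A → Occ}
      {mN : S.N → Name}, IsNaming Θ ν L P R nA nN → IsNaming Θ ν L P S mA mN →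
      (∀ a, ∃ b, mA b = nA a) ∧ ∀ n, ∃ m, mN m = nN n := by
    intro R S nA nN mA mN h h'
    refine ⟨fun a => ?_, fun n => ?_⟩
    · rcases h.mem_occs a with ha | ⟨s, hs, ha⟩
      · exact h'.exists_rule _ ha
      · exact h'.exists_of_mem_ax hs ha
    · rcases h.node_cases n with ⟨a, -, h1, h2⟩ | ⟨s, h1, h2⟩ | ⟨a, -, h1, h2⟩
      · rw [h2]; exact h'.exists_node_rule h1
      · rw [h2]; exact h'.exists_node_ax h1
      · rw [h2]
        rw [← h'.concl, List.mem_map] at h1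
        obtain ⟨b, hb, hba⟩ := h1
        exact ⟨S.head b, by rw [h'.head, headName, if_pos ((h'.mem_iff b).2 hb), hba]⟩
  obtain ⟨eA, hA⟩ := exists_equiv_of_range_eq h.nA_inj h'.nA_inj (key h h').1 (key h' h).1
  obtain ⟨eN, hN⟩ := exists_equiv_of_range_eq h.nN_inj h'.nN_inj (key h h').2 (key h' h).2
  have hcomp : mA ∘ eA = nA := funext hA
  refine ⟨⟨eN, eA, ?_, ?_, ?_, ?_, ?_, ?_, ?_⟩, hA, hN⟩
  · intro n; rw [h.label, h'.label, hN]
  -- Names are injective, so the laws of an isomorphism may be checked on names.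
  · intro a
    apply h'.nN_inj
    rw [hN]
    rcases h.tail_cases a with ⟨h1, h2⟩ | ⟨s, hs, h1, h2⟩
    · rw [h2, h'.tail_rule _ (by rwa [hA]), hA]
    · rw [h2, h'.tail_ax _ s hs (by rwa [hA])]
  · intro a
    apply h'.nN_inj
    rw [hN, h.head, h'.head, hA]
  · intro n
    apply Option.map_injective h'.nA_inj
    rw [h'.left, Option.map_map, hcomp, h.left, hN]
  · intro n
    apply Option.map_injective h'.nA_inj
    rw [h'.right, Option.map_map, hcomp, h.right, hN]
  · apply h'.nA_inj.list_map
    rw [h'.concl, List.map_map, hcomp, h.concl]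
  · intro a; rw [h.type, h'.type, hA]

theorem coe_middle (μ ρ : List Occ) (x : Occ) :
    ((μ ++ x :: ρ : List Occ) : Multiset Occ) = x ::ₘ ((μ : Multiset Occ) + ρ) :=
  Multiset.coe_eq_coe.2 List.perm_middle

theorem coe_snoc (μ : List Occ) (x : Occ) :
    ((μ ++ [x] : List Occ) : Multiset Occ) = x ::ₘ (μ : Multiset Occ) :=
  Multiset.coe_eq_coe.2 (List.perm_append_singleton x μ)

theorem coe_snoc₂ (μ : List Occ) (x y : Occ) :
    ((μ ++ [x, y] : List Occ) : Multiset Occ) = x ::ₘ y ::ₘ (μ : Multiset Occ) :=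
  Multiset.coe_eq_coe.2 List.perm_append_comm

/-! ### Targets of jumps -/

namespace RuleTree

/-- The names of the nodes of a rule tree; each of its occurrences `x` has its own node
`Name.bul x`. -/
def names (t : RuleTree) : Set Name
  | .rule a => a ∈ t.rules
  | .ax s => s ∈ t.links
  | .bul x => x ∈ t.occs

/-- The node `m` belongs to the premise of every rule that introduces a `⊥` named `a`. -/
def Tgt : RuleTree → Occ → Name → Prop
  | .ax _, _, _ => True
  | .one _, _, _ => True
  | .bot b t, a, m => (b = a → m ∈ t.names) ∧ t.Tgt a m
  | .par _ t, a, m => t.Tgt a m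
  | .tens _ t u, a, m => t.Tgt a m ∧ u.Tgt a m

/-- The condition bears only on the `⊥` rules that introduce `a`; this disposes of the premise of a
`⊗` that does not contain the source of the jump. -/
theorem tgt_of_not_mem {t : RuleTree} {a : Occ} (h : a ∉ t.rules) (m : Name) : t.Tgt a m := by
  induction t with
  | ax | one => trivial
  | bot b t ih =>
    simp only [rules, Set.mem_insert_iff, not_or] at h
    exact ⟨fun hb => (h.1 hb.symm).elim, ih h.2⟩
  | par b t ih =>
    simp only [rules, Set.mem_insert_iff, not_or] at h
    exact ih h.2
  | tens b t u iht ihu =>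
    simp only [rules, Set.mem_insert_iff, Set.mem_union, not_or] at h
    exact ⟨iht h.2.1, ihu h.2.2⟩

end RuleTree

/-- Every occurrence of a proof is a conclusion or a premise of a rule. -/
theorem Der.occs_cases {S : Multiset Occ} {t : RuleTree} (h : Der Θ S t) :
    ∀ x ∈ t.occs, x ∈ S ∨ ∃ c ∈ t.rules, ∃ b, premOcc c b (ty Θ c) = some x := by
  induction h with
  | ax x y h =>
    rintro z (hz | ⟨s, hs, hz⟩)
    · exact hz.elim
    · rw [RuleTree.links, Set.mem_singleton_iff] at hs
      subst hs
      exact Or.inl (by simpa using hz)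
  | one x h =>
    rintro z (hz | ⟨s, hs, hz⟩)
    · exact Or.inl (by simpa [RuleTree.rules] using hz)
    · exact hs.elim
  | bot x S t hx ht ih =>
    have key : ∀ z ∈ t.occs, z ∈ x ::ₘ S ∨
        ∃ c ∈ (RuleTree.bot x t).rules, ∃ b, premOcc c b (ty Θ c) = some z := fun z hz =>
      (ih z hz).imp (by simp +contextual) fun ⟨c, hc, h⟩ => ⟨c, Or.inr hc, h⟩
    rintro z ((rfl | hz) | hz)
    · exact Or.inl (by simp)
    · exact key z (Or.inl hz)
    · exact key z (Or.inr hz)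
  | par x A B S t hx ht ih =>
    have key : ∀ z ∈ t.occs, z ∈ x ::ₘ S ∨
        ∃ c ∈ (RuleTree.par x t).rules, ∃ b, premOcc c b (ty Θ c) = some z := by
      intro z hz
      rcases ih z hz with h | ⟨c, hc, h⟩
      · simp only [Multiset.mem_cons] at h
        rcases h with rfl | rfl | h
        · exact Or.inr ⟨x, Or.inl rfl, false, by simp [hx, premOcc]; rfl⟩
        · exact Or.inr ⟨x, Or.inl rfl, true, by simp [hx, premOcc]; rfl⟩
        · exact Or.inl (by simp [h])
      · exact Or.inr ⟨c, Or.inr hc, h⟩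
    rintro z ((rfl | hz) | hz)
    · exact Or.inl (by simp)
    · exact key z (Or.inl hz)
    · exact key z (Or.inr hz)
  | tens x A B S T t u hx ht hu ih1 ih2 =>
    have key : ∀ z, z ∈ t.occs ∨ z ∈ u.occs → z ∈ x ::ₘ (S + T) ∨
        ∃ c ∈ (RuleTree.tens x t u).rules, ∃ b, premOcc c b (ty Θ c) = some z := by
      rintro z (hz | hz)
      · rcases ih1 z hz with h | ⟨c, hc, h⟩
        · rcases Multiset.mem_cons.1 h with rfl | h
          · exact Or.inr ⟨x, Or.inl rfl, false, by simp [hx, premOcc]; rfl⟩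
          · exact Or.inl (by simp [h])
        · exact Or.inr ⟨c, Or.inr (Or.inl hc), h⟩
      · rcases ih2 z hz with h | ⟨c, hc, h⟩
        · rcases Multiset.mem_cons.1 h with rfl | h
          · exact Or.inr ⟨x, Or.inl rfl, true, by simp [hx, premOcc]; rfl⟩
          · exact Or.inl (by simp [h])
        · exact Or.inr ⟨c, Or.inr (Or.inr hc), h⟩
    rintro z ((rfl | hz | hz) | ⟨s, hs | hs, hz⟩)
    · exact Or.inl (by simp)
    · exact key z (Or.inl (Or.inl hz))
    · exact key z (Or.inr (Or.inl hz))
    · exact key z (Or.inl (Or.inr ⟨s, hs, hz⟩))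
    · exact key z (Or.inr (Or.inr ⟨s, hs, hz⟩))

/-! ### Names of desequentializations -/

namespace IsNaming

variable {ν : List Occ} {L : Set (Sym2 Occ)} {P : Set Occ} {R : PreStructure} {nA : R.A → Occ}
  {nN : R.N → Name} {t : RuleTree}

theorem mem_cone (h : IsNaming Θ ν t.links t.rules R nA nN) {S : Multiset Occ}
    (ht : Der Θ S t) (a : R.A) : nA a ∈ Cone S := ht.occs_subset (h.mem_occs a)

theorem mem_names (h : IsNaming Θ ν t.links t.rules R nA nN) (n : R.N) : nN n ∈ t.names := by
  rcases h.node_cases n with ⟨a, -, h1, h2⟩ | ⟨s, h1, h2⟩ | ⟨a, -, h1, h2⟩ <;> rw [h2]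
  · exact h1
  · exact h1
  · exact h.mem_occs a

theorem botStep {μ : List Occ} {x : Occ} (h : IsNaming Θ μ t.links t.rules R nA nN)
    (ht : Der Θ μ t) (hA : Anti (μ ++ [x] : List Occ)) (hx : ty Θ x = .bot) (j : Option R.N) :
    IsNaming Θ (μ ++ [x]) (RuleTree.bot x t).links (RuleTree.bot x t).rules (R.bot j)
      (addA nA x) (addN nN x) := by
  rw [coe_snoc] at hA
  have := h.addNode (k := .bot) (F := .bot) (Γ := R.concl) (Δ := []) (l := none) (r := none)
    (Multiset.coe_nodup.1 hA.of_cons.1) (x := x) j (by simp) (by simp [hx, premOcc])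
    (by simp [hx, premOcc]) (by simp [hx, Formula.kind]) hx.symm
    fun a ha => hA.not_mem_cone (ha ▸ h.mem_cone ht a)
  rw [h.concl] at this
  exact this

theorem concl_last₂ {μ : List Occ} {x y : Occ} (h : IsNaming Θ (μ ++ [x, y]) L P R nA nN) :
    ∃ Γ a b, R.concl = Γ ++ [a, b] ∧ Γ.map nA = μ ∧ nA a = x ∧ nA b = y := by
  obtain ⟨Γ, a, b, ρ, h1, h2, h3, h4, h5⟩ := exists_of_map_eq_middle₂ h.concl
  obtain rfl := List.map_eq_nil_iff.1 h5
  exact ⟨Γ, a, b, h1, h2, h3, h4⟩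

theorem parStep {μ : List Occ} {x : Occ} {A B : Formula}
    (h : IsNaming Θ (μ ++ [x.l, x.r]) t.links t.rules R nA nN)
    (ht : Der Θ (μ ++ [x.l, x.r] : List Occ) t) (hA : Anti (μ ++ [x] : List Occ))
    (hx : ty Θ x = .par A B) :
    IsNaming Θ (μ ++ [x]) (RuleTree.par x t).links (RuleTree.par x t).rules (R.par A B)
      (addA nA x) (addN nN x) := by
  obtain ⟨Γ, a, b, hc, hΓ, ha, hb⟩ := h.concl_last₂
  rw [coe_snoc] at hA
  have hl : R.concl.dropLast.getLast? = some a := by simp [hc, List.dropLast_append_of_ne_nil]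
  have hr : R.concl.getLast? = some b := by simp [hc]
  have hd : R.concl.dropLast.dropLast = Γ := by simp [hc, List.dropLast_append_of_ne_nil]
  have := h.addNode (k := .par) (F := .par A B) (Γ := R.concl.dropLast.dropLast) (Δ := [])
    (l := R.concl.dropLast.getLast?) (r := R.concl.getLast?)
    (by rw [← Multiset.coe_nodup, coe_snoc₂]; exact hA.par.1) (x := x) none
    (by rw [hl, hr, hd, hc]; simp) (by rw [hl, hx]; simp [premOcc, ha, Occ.l_eq_child])
    (by rw [hr, hx]; simp [premOcc, hb, Occ.r_eq_child]) (by simp [hx, Formula.kind]) hx.symm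
    fun a ha => hA.not_mem_cone_par (by rw [← coe_snoc₂]; exact ha ▸ h.mem_cone ht a)
  rw [hd, hΓ] at this
  rw [show Γ = R.concl.dropLast.dropLast from hd.symm] at this
  exact this

theorem concl_last {μ : List Occ} {x : Occ} (h : IsNaming Θ (μ ++ [x]) L P R nA nN) :
    ∃ Γ a, R.concl = Γ ++ [a] ∧ Γ.map nA = μ ∧ nA a = x := by
  obtain ⟨Γ, a, ρ, h1, h2, h3, h4⟩ := exists_of_map_eq_middle h.concl
  obtain rfl := List.map_eq_nil_iff.1 h4
  exact ⟨Γ, a, h1, h2, h3⟩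

theorem tensStep {μ ρ : List Occ} {x : Occ} {A B : Formula} {u : RuleTree} {S : PreStructure}
    {mA : S.A → Occ} {mN : S.N → Name}
    (h : IsNaming Θ (μ ++ [x.l]) t.links t.rules R nA nN)
    (h' : IsNaming Θ (x.r :: ρ) u.links u.rules S mA mN)
    (ht : Der Θ (μ ++ [x.l] : List Occ) t) (hu : Der Θ (x.r :: ρ : List Occ) u)
    (hA : Anti (μ ++ x :: ρ : List Occ)) (hx : ty Θ x = .tens A B) :
    IsNaming Θ (μ ++ x :: ρ) (RuleTree.tens x t u).links (RuleTree.tens x t u).rules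
      (PreStructure.tens A B R S) (addA (Sum.elim nA mA) x) (addN (Sum.elim nN mN) x) := by
  rw [coe_middle] at hA
  rw [coe_snoc] at ht
  obtain ⟨Γ, a, hc, hΓ, ha⟩ := h.concl_last
  obtain ⟨b, Δ, hc', hb, hΔ⟩ := List.map_eq_cons_iff.1 h'.concl
  have hU := h.union h' fun a b hab => Set.disjoint_left.1 hA.tens.disjoint (h.mem_cone ht a)
    (hab ▸ h'.mem_cone hu b)
  have hl : R.concl.getLast? = some a := by simp [hc]
  have hr : S.concl.head? = some b := by simp [hc']
  have hd : R.concl.dropLast = Γ := by simp [hc]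
  have hd' : S.concl.tail = Δ := by simp [hc']
  have hν : (μ ++ [x.l] ++ x.r :: ρ).Nodup := by
    have := hA.tens.1
    rw [← coe_snoc] at this
    exact Multiset.coe_nodup.1 this
  have := hU.addNode (k := .tens) (F := .tens A B) (Γ := R.concl.dropLast.map .inl)
    (Δ := S.concl.tail.map .inr) (l := R.concl.getLast?.map .inl) (r := S.concl.head?.map .inr)
    hν (x := x) none (by simp [hc, hc'])
    (by rw [hl, hx]; simp [premOcc, ha, Occ.l_eq_child])
    (by rw [hr, hx]; simp [premOcc, hb, Occ.r_eq_child]) (by simp [hx, Formula.kind]) hx.symm (by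
      rintro (a | a) ha
      · exact hA.not_mem_cone_left (ha ▸ h.mem_cone ht a)
      · exact hA.not_mem_cone_right (ha ▸ h'.mem_cone hu a))
  rw [List.map_map, List.map_map, Sum.elim_comp_inl, Sum.elim_comp_inr] at this
  have e1 : R.concl.dropLast.map nA = μ := by rw [hd, hΓ]
  have e2 : S.concl.tail.map mA = ρ := by rw [hd', hΔ]
  rw [e1, e2] at this
  exact this

theorem exStep {μ ρ : List Occ} {x y : Occ} (h : IsNaming Θ (μ ++ x :: y :: ρ) L P R nA nN) :
    IsNaming Θ (μ ++ y :: x :: ρ) L P (R.ex μ.length) nA nN := by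
  refine h.ex (fun z => by simp; tauto) ?_
  obtain ⟨Γ, a, b, Δ, h1, h2, h3, h4, h5⟩ := exists_of_map_eq_middle₂ h.concl
  rw [h1, ← h2, List.length_map, swapAt_append]
  simp [h3, h4, h5]

end IsNaming

theorem anti_par {μ : List Occ} {x : Occ} (h : Anti (μ ++ [x] : List Occ)) :
    Anti (μ ++ [x.l, x.r] : List Occ) := by
  rw [coe_snoc] at h
  rw [coe_snoc₂]
  exact h.par

theorem anti_tens {μ ρ : List Occ} {x : Occ} (h : Anti (μ ++ x :: ρ : List Occ)) :
    Anti (μ ++ [x.l] : List Occ) ∧ Anti (x.r :: ρ : List Occ) := by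
  rw [coe_middle] at h
  rw [coe_snoc]
  exact ⟨h.tens_left, h.tens_right⟩

theorem anti_ex {μ ρ : List Occ} {x y : Occ} (h : Anti (μ ++ x :: y :: ρ : List Occ)) :
    Anti (μ ++ y :: x :: ρ : List Occ) := by
  rwa [Multiset.coe_eq_coe.2 ((List.Perm.swap x y ρ).append_left μ)]

theorem anti_pair {x y : Occ} (h : Anti ([x, y] : List Occ)) : x ≠ y := by
  have := Multiset.coe_nodup.1 h.1
  simpa using this

/-- The point is that the rule tree enters the naming only through its links and its principal
occurrences, both unaffected by interchanges. -/
theorem Proof.exists_naming {Γ : List Formula} (p : Proof Γ) : ∀ ν : List Occ,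
    ν.map (ty Θ) = Γ → Anti (ν : Multiset Occ) → ∃ nA nN,
      IsNaming Θ ν (p.ruleTreeAux ν).links (p.ruleTreeAux ν).rules p.deseq nA nN := by
  induction p with
  | ax A =>
    intro ν hν hA
    obtain ⟨x, τ, rfl, hx, hτ⟩ := List.map_eq_cons_iff.1 hν
    obtain ⟨y, τ, rfl, hy, hτ⟩ := List.map_eq_cons_iff.1 hτ
    obtain rfl := List.map_eq_nil_iff.1 hτ
    exact ⟨_, _, .ax (anti_pair hA) hx hy⟩
  | ex Γ A B Δ p ih =>
    intro ν hν hA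
    obtain ⟨μ, x, y, ρ, rfl, hμ, rfl, rfl, rfl⟩ := exists_of_map_eq_middle₂ hν
    have hl := length_eq_of_map hμ
    rw [ruleTreeAux_ex p hl]
    obtain ⟨nA, nN, h⟩ := ih (μ ++ y :: x :: ρ) (by simp [hμ]) (anti_ex hA)
    refine ⟨nA, nN, ?_⟩
    change IsNaming Θ _ _ _ (p.deseq.ex Γ.length) nA nN
    rw [← hl]
    exact h.exStep
  | tens Γ A B Δ p q ihp ihq =>
    intro ν hν hA
    obtain ⟨μ, x, ρ, rfl, rfl, hx, rfl⟩ := exists_of_map_eq_middle hν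
    rw [ruleTreeAux_tens p q (by simp)]
    have e1 : (μ ++ [x.l]).map (ty Θ) = μ.map (ty Θ) ++ [A] := by simp [ty_l (Or.inl hx)]
    have e2 : (x.r :: ρ).map (ty Θ) = B :: ρ.map (ty Θ) := by simp [ty_r (Or.inl hx)]
    obtain ⟨nA, nN, h⟩ := ihp _ e1 (anti_tens hA).1
    obtain ⟨mA, mN, h'⟩ := ihq _ e2 (anti_tens hA).2
    exact ⟨_, _, h.tensStep h' (p.der _ e1) (q.der _ e2) hA hx⟩
  | one =>
    intro ν hν hA
    obtain ⟨x, τ, rfl, hx, hτ⟩ := List.map_eq_cons_iff.1 hν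
    obtain rfl := List.map_eq_nil_iff.1 hτ
    exact ⟨_, _, .one hx⟩
  | par Γ A B p ih =>
    intro ν hν hA
    obtain ⟨μ, x, ρ, rfl, rfl, hx, hρ⟩ := exists_of_map_eq_middle hν
    obtain rfl := List.map_eq_nil_iff.1 hρ
    rw [ruleTreeAux_par p (by simp)]
    have e1 : (μ ++ [x.l, x.r]).map (ty Θ) = μ.map (ty Θ) ++ [A, B] := by
      simp [ty_l (Or.inr hx), ty_r (Or.inr hx)]
    obtain ⟨nA, nN, h⟩ := ih _ e1 (anti_par hA)
    exact ⟨_, _, h.parStep (p.der _ e1) hA hx⟩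
  | bot Γ p ih =>
    intro ν hν hA
    obtain ⟨μ, x, ρ, rfl, rfl, hx, hρ⟩ := exists_of_map_eq_middle hν
    obtain rfl := List.map_eq_nil_iff.1 hρ
    rw [ruleTreeAux_bot p (by simp)]
    obtain ⟨nA, nN, h⟩ := ih μ rfl (by rw [coe_snoc] at hA; exact hA.of_cons)
    exact ⟨_, _, h.botStep (p.der _ rfl) hA hx none⟩

/-- The jumps of `R` start from nodes that introduce occurrences, and satisfy `Q`. -/
def JumpsIn (R : PreStructure) (nN : R.N → Name) (Q : Occ → Name → Prop) : Prop :=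
  ∀ n m, R.jump n = some m → ∃ a, nN n = .rule a ∧ Q a (nN m)

theorem JumpsIn.mono {R : PreStructure} {nN : R.N → Name} {Q Q' : Occ → Name → Prop}
    (h : JumpsIn R nN Q) (hQ : ∀ n a m, nN n = .rule a → Q a (nN m) → Q' a (nN m)) :
    JumpsIn R nN Q' := fun n m hnm => by
  obtain ⟨a, h1, h2⟩ := h n m hnm
  exact ⟨a, h1, hQ n a m h1 h2⟩

/-- The `bullet` nodes that vanish are never targets, by `Avoids`, so every target survives with its
name. -/
theorem JumpsIn.addNode {R : PreStructure} {nN : R.N → Name} {Q : Occ → Name → Prop}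
    (h : JumpsIn R nN Q) {l r : Option R.A} (hav : R.Avoids l r) {x : Occ} {k : Label}
    {F : Formula} {j : Option R.N} {Γ Δ : List R.A}
    (hj : ∀ m, j = some m → ¬ R.Meets l r m ∧ Q x (nN m)) :
    JumpsIn (R.addNode k l r F j Γ Δ) (IsNaming.addN nN x) Q := by
  rintro (⟨n, hn⟩ | _ | _) m hnm
  · obtain ⟨m, h1, rfl⟩ := Option.map_eq_some_iff.1 hnm
    obtain ⟨a, h2, h3⟩ := h n m h1
    refine ⟨a, h2, ?_⟩
    rwa [IsNaming.addN_emb x (hav n m h1)]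
  · obtain ⟨m, h1, rfl⟩ := Option.map_eq_some_iff.1 hnm
    obtain ⟨h2, h3⟩ := hj m h1
    refine ⟨x, rfl, ?_⟩
    rwa [IsNaming.addN_emb x h2]
  · cases hnm

theorem JumpsIn.union {R S : PreStructure} {nN : R.N → Name} {mN : S.N → Name}
    {Q : Occ → Name → Prop} (h : JumpsIn R nN Q) (h' : JumpsIn S mN Q) :
    JumpsIn (R.union S) (Sum.elim nN mN) Q := by
  rintro (n | n) m hnm
  · obtain ⟨m, h1, rfl⟩ := Option.map_eq_some_iff.1 hnm
    exact h n m h1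
  · obtain ⟨m, h1, rfl⟩ := Option.map_eq_some_iff.1 hnm
    exact h' n m h1

theorem avoids_union {R S : PreStructure} {l : Option R.A} {r : Option S.A}
    (h : R.Avoids l none) (h' : S.Avoids none r) :
    (R.union S).Avoids (l.map .inl) (r.map .inr) := by
  rintro (n | n) m hnm ⟨c, hc, hcm⟩
  · obtain ⟨m, h1, rfl⟩ := Option.map_eq_some_iff.1 hnm
    rcases c with c | c
    · refine h n m h1 ⟨c, Or.inl ?_, Sum.inl_injective hcm⟩
      simpa using hc
    · cases hcm
  · obtain ⟨m, h1, rfl⟩ := Option.map_eq_some_iff.1 hnm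
    rcases c with c | c
    · cases hcm
    · refine h' n m h1 ⟨c, Or.inr ?_, Sum.inr_injective hcm⟩
      simpa using hc

/-- When a `⊥` rule is applied, every node of the structure is a node of its premise, which is what
`Tgt` asks for; later rules do not change the names of targets. -/
theorem Proof.DeseqJump.exists_naming {Γ : List Formula} {p : Proof Γ} {R : PreStructure}
    (h : p.DeseqJump R) : ∀ ν : List Occ, ν.map (ty Θ) = Γ → Anti (ν : Multiset Occ) →
    ∃ nA nN, IsNaming Θ ν (p.ruleTreeAux ν).links (p.ruleTreeAux ν).rules R nA nN ∧
      JumpsIn R nN (p.ruleTreeAux ν).Tgt := by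
  induction h with
  | ax A =>
    intro ν hν hA
    obtain ⟨x, τ, rfl, hx, hτ⟩ := List.map_eq_cons_iff.1 hν
    obtain ⟨y, τ, rfl, hy, hτ⟩ := List.map_eq_cons_iff.1 hτ
    obtain rfl := List.map_eq_nil_iff.1 hτ
    exact ⟨_, _, .ax (anti_pair hA) hx hy, fun n m h => by cases h⟩
  | ex Γ A B Δ p R _ ih =>
    intro ν hν hA
    obtain ⟨μ, x, y, ρ, rfl, hμ, rfl, rfl, rfl⟩ := exists_of_map_eq_middle₂ hν
    have hl := length_eq_of_map hμ
    rw [ruleTreeAux_ex p hl]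
    obtain ⟨nA, nN, h, hj⟩ := ih (μ ++ y :: x :: ρ) (by simp [hμ]) (anti_ex hA)
    refine ⟨nA, nN, ?_, hj⟩
    rw [← hl]
    exact h.exStep
  | tens Γ A B Δ p q R S _ _ hav hav' ihp ihq =>
    intro ν hν hA
    obtain ⟨μ, x, ρ, rfl, rfl, hx, rfl⟩ := exists_of_map_eq_middle hν
    rw [ruleTreeAux_tens p q (by simp)]
    have e1 : (μ ++ [x.l]).map (ty Θ) = μ.map (ty Θ) ++ [A] := by simp [ty_l (Or.inl hx)]
    have e2 : (x.r :: ρ).map (ty Θ) = B :: ρ.map (ty Θ) := by simp [ty_r (Or.inl hx)]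
    obtain ⟨nA, nN, h, hj⟩ := ihp _ e1 (anti_tens hA).1
    obtain ⟨mA, mN, h', hj'⟩ := ihq _ e2 (anti_tens hA).2
    have d1 := p.der _ e1
    have d2 := q.der _ e2
    refine ⟨_, _, h.tensStep h' d1 d2 hA hx, ?_⟩
    rw [coe_middle] at hA
    rw [coe_snoc] at d1
    have hd := Set.disjoint_left.1 hA.tens.disjoint
    refine JumpsIn.addNode (.union (hj.mono fun n a m hn hQ => ⟨hQ, ?_⟩)
      (hj'.mono fun n a m hn hQ => ⟨?_, hQ⟩)) (avoids_union hav hav') (by simp)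
    · exact RuleTree.tgt_of_not_mem (fun ha => hd (d1.occs_subset (Or.inl (h.mem_of_rule hn)))
        (d2.occs_subset (Or.inl ha))) _
    · exact RuleTree.tgt_of_not_mem (fun ha => hd (d1.occs_subset (Or.inl ha))
        (d2.occs_subset (Or.inl (h'.mem_of_rule hn)))) _
  | one =>
    intro ν hν hA
    obtain ⟨x, τ, rfl, hx, hτ⟩ := List.map_eq_cons_iff.1 hν
    obtain rfl := List.map_eq_nil_iff.1 hτ
    exact ⟨_, _, .one hx, fun n m h => by cases h⟩
  | par Γ A B p R _ hav ih =>
    intro ν hν hA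
    obtain ⟨μ, x, ρ, rfl, rfl, hx, hρ⟩ := exists_of_map_eq_middle hν
    obtain rfl := List.map_eq_nil_iff.1 hρ
    rw [ruleTreeAux_par p (by simp)]
    have e1 : (μ ++ [x.l, x.r]).map (ty Θ) = μ.map (ty Θ) ++ [A, B] := by
      simp [ty_l (Or.inr hx), ty_r (Or.inr hx)]
    obtain ⟨nA, nN, h, hj⟩ := ih _ e1 (anti_par hA)
    exact ⟨_, _, h.parStep (p.der _ e1) hA hx, hj.addNode hav (by simp)⟩
  | bot Γ p R m _ ih =>
    intro ν hν hA
    obtain ⟨μ, x, ρ, rfl, rfl, hx, hρ⟩ := exists_of_map_eq_middle hν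
    obtain rfl := List.map_eq_nil_iff.1 hρ
    rw [ruleTreeAux_bot p (by simp)]
    have hA' := hA
    rw [coe_snoc] at hA'
    obtain ⟨nA, nN, h, hj⟩ := ih μ rfl hA'.of_cons
    have hd := p.der _ rfl
    have hm : ∀ m, ¬ R.Meets none none m := by simp [PreStructure.Meets]
    refine ⟨_, _, h.botStep hd hA hx _, (hj.mono fun n a m' hn hQ =>
      ⟨fun _ => h.mem_names m', hQ⟩).addNode (fun _ m _ => hm m) fun m' _ =>
      ⟨hm m', fun _ => h.mem_names m', RuleTree.tgt_of_not_mem (fun hx' => ?_) _⟩⟩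
    exact hA'.not_mem_cone (hd.occs_subset (Or.inl hx'))
  | same p R S _ hs ih =>
    intro ν hν hA
    obtain ⟨nA, nN, h, hj⟩ := ih ν hν hA
    obtain ⟨e, he⟩ := hs
    refine ⟨_, _, h.same e, fun n m hnm => ?_⟩
    have h1 := he (e.node.symm n)
    rw [Equiv.apply_symm_apply, hnm] at h1
    obtain ⟨m', h2, rfl⟩ := Option.map_eq_some_iff.1 h1.symm
    obtain ⟨a, h3, h4⟩ := hj _ _ h2
    exact ⟨a, h3, by simpa using h4⟩

/-! ### Isomorphic structures have the same axiom links -/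

/-- An isomorphism preserves the order of the conclusions and of the premises. By induction on the
length of paths it preserves the names of all arcs, and axioms are recognized as pairs of distinct
arcs with a common tail. -/
theorem IsNaming.links_subset {ν : List Occ} {t : RuleTree} {L' : Set (Sym2 Occ)} {P' : Set Occ}
    {R S : PreStructure} {nA : R.A → Occ} {nN : R.N → Name} {mA : S.A → Occ} {mN : S.N → Name}
    (ht : Der Θ ν t) (h : IsNaming Θ ν t.links t.rules R nA nN)
    (h' : IsNaming Θ ν L' P' S mA mN) (e : R.BaseIso S) : t.links ⊆ L' := by
  have key : ∀ k : ℕ, ∀ a, (nA a).2.length = k → mA (e.arc a) = nA a := by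
    intro k
    induction k using Nat.strong_induction_on with
    | _ k ih =>
    intro a hk
    rcases ht.occs_cases _ (h.mem_occs a) with ha | ⟨c, hc, b, hb⟩
    · have h1 : R.concl.map (mA ∘ e.arc) = R.concl.map nA := by
        rw [← List.map_map, ← e.concl, h'.concl, h.concl]
      exact List.map_inj_left.1 h1 a ((h.mem_iff a).1 ha)
    · have hbc : nA a = c.child b := by
        cases hF : ty Θ c <;> rw [hF] at hb <;> simp [premOcc] at hb <;> exact hb.symm
      have hkind : (ty Θ c).kind ≠ .ax := by
        cases hF : ty Θ c <;> rw [hF] at hb <;> simp [premOcc, Formula.kind] at hb ⊢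
      obtain ⟨d, hd⟩ := h.exists_rule c hc
      by_cases hν : nA a ∈ ν
      · have h1 : R.concl.map (mA ∘ e.arc) = R.concl.map nA := by
          rw [← List.map_map, ← e.concl, h'.concl, h.concl]
        exact List.map_inj_left.1 h1 a ((h.mem_iff a).1 hν)
      have htd : nN (R.tail d) = .rule c := by rw [h.tail_rule d (by rwa [hd]), hd]
      -- The arc `a` is a premise of the node whose conclusion is `d`, and the name of `d` is
      -- shorter by one step.
      have hda : R.tail d = R.head a := h.nN_inj (by
        rw [htd, h.head, headName, if_neg hν, hbc, Occ.parent_child])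
      have h1 : mA (e.arc d) = c := by
        rw [← hd]
        exact ih _ (by rw [← hk, hbc, hd]; simp [Occ.child]) d rfl
      have h2 : mN (e.node (R.head a)) = .rule c := by
        rw [← hda, ← e.tail]
        rcases h'.tail_cases (e.arc d) with ⟨-, h3⟩ | ⟨s, -, -, h3⟩
        · rw [h3, h1]
        -- An axiom node is impossible here: isomorphisms keep labels, and `c` has premises.
        · exfalso
          have h4 := h'.label (S.tail (e.arc d))
          rw [h3, e.tail, e.label, h.label, htd] at h4
          exact hkind h4
      rw [← hda] at h2
      cases b with
      | false =>
        have h3 := h.left (R.tail d)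
        rw [htd, Name.prem, hb] at h3
        obtain ⟨a', h4, h5⟩ := Option.map_eq_some_iff.1 h3
        obtain rfl := h.nA_inj h5
        have h6 := h'.left (e.node (R.tail d))
        rw [e.left, h4, h2, Name.prem, hb] at h6
        simpa using h6
      | true =>
        have h3 := h.right (R.tail d)
        rw [htd, Name.prem, hb] at h3
        obtain ⟨a', h4, h5⟩ := Option.map_eq_some_iff.1 h3
        obtain rfl := h.nA_inj h5
        have h6 := h'.right (e.node (R.tail d))
        rw [e.right, h4, h2, Name.prem, hb] at h6
        simpa using h6
  intro s hs
  obtain ⟨a, b, hab, rfl⟩ := h.exists_ax s hs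
  have hne : nA a ≠ nA b := fun h1 => hab (h.nA_inj h1)
  have h1 : R.tail a = R.tail b := h.nN_inj (by
    rw [h.tail_ax a _ hs (Sym2.mem_mk_left _ _), h.tail_ax b _ hs (Sym2.mem_mk_right _ _)])
  have h2 : S.tail (e.arc a) = S.tail (e.arc b) := by rw [e.tail, e.tail, h1]
  have ka := key _ a rfl
  have kb := key _ b rfl
  rcases h'.tail_cases (e.arc a) with ⟨-, h3⟩ | ⟨s, h3, h4, h5⟩ <;>
    rcases h'.tail_cases (e.arc b) with ⟨-, h6⟩ | ⟨s', h6, h7, h8⟩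
  · rw [h2, h6] at h3
    injection h3 with h3
    rw [ka, kb] at h3
    exact absurd h3.symm hne
  · rw [h2, h8] at h3
    cases h3
  · rw [h2, h6] at h5
    cases h5
  · rw [h2, h8] at h5
    injection h5 with h5
    subst h5
    rw [ka] at h4
    rw [kb] at h7
    rwa [(Sym2.mem_and_mem_iff hne).1 ⟨h4, h7⟩] at h3

/-! ### Graphs and potentials -/

/-- A graph is acyclic if every weight on its arcs is the difference of a potential. -/
theorem Digr.acyclic_of_potential {G : Digr}
    (h : ∀ w : G.A → ZMod 2, ∃ g : G.N → ZMod 2, ∀ a, g (G.head a) = g (G.tail a) + w a) :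
    G.Acyclic := by
  classical
  rintro ⟨k, n, a, hk, hp, hc⟩
  -- The first arc of a cycle is crossed once: since nodes do not repeat, a second crossing needs a
  -- cycle of length two that returns by the same arc, which `arcs` forbids.
  have hinj : ∀ i : Fin k, i ≠ ⟨0, hk⟩ → a i ≠ a ⟨0, hk⟩ := by
    intro i hi hai
    have hi0 : 0 < i.1 := Nat.pos_of_ne_zero fun h0 => hi (Fin.ext h0)
    have hik := i.2
    have e0 := hp.ends ⟨0, hk⟩
    have ei := hp.ends i
    rw [hai] at ei
    have n0 : n i.castSucc ≠ n (Fin.castSucc ⟨0, hk⟩) := by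
      intro h0
      rcases hp.nodes _ _ (by rw [Ne, Fin.ext_iff]; simp; omega) h0 with ⟨h1, h2⟩ | ⟨h1, h2⟩ <;>
        (rw [Fin.ext_iff] at h1 h2; simp at h1 h2; omega)
    have n1 : n i.castSucc = n (Fin.succ ⟨0, hk⟩) → i.1 = 1 := by
      intro h0
      by_contra hne
      rcases hp.nodes _ _ (by rw [Ne, Fin.ext_iff]; simp; omega) h0 with ⟨h1, h2⟩ | ⟨h1, h2⟩ <;>
        (rw [Fin.ext_iff] at h1 h2; simp at h1 h2 <;> omega)
    have n2 : n i.castSucc = n (Fin.succ ⟨0, hk⟩) ∧ n i.succ = n (Fin.castSucc ⟨0, hk⟩) := by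
      rcases e0 with ⟨h1, h2⟩ | ⟨h1, h2⟩ <;> rcases ei with ⟨h3, h4⟩ | ⟨h3, h4⟩
      · exact (n0 (h3.symm.trans h1)).elim
      · exact ⟨h4.symm.trans h2, h3.symm.trans h1⟩
      · exact ⟨h3.symm.trans h1, h4.symm.trans h2⟩
      · exact (n0 (h4.symm.trans h2)).elim
    have hi1 := n1 n2.1
    have hk2 : k = 2 := by
      rcases hp.nodes _ _ (by rw [Ne, Fin.ext_iff]; simp) n2.2 with ⟨h1, h2⟩ | ⟨h1, h2⟩ <;>
        (rw [Fin.ext_iff] at h1 h2; simp at h1 h2 <;> omega)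
    refine hp.arcs (by omega) (hai.symm.trans (congrArg a (Fin.ext ?_)))
    simp
    omega
  -- For the indicator weight of the first arc, the differences of `g` along the cycle add up to
  -- `1`, yet they telescope to `0`. Modulo `2` the direction of a crossing is irrelevant.
  obtain ⟨g, hg⟩ := h fun x => if x = a ⟨0, hk⟩ then 1 else 0
  have step : ∀ i : Fin k, g (n i.succ) - g (n i.castSucc) =
      if a i = a ⟨0, hk⟩ then (1 : ZMod 2) else 0 := by
    intro i
    have hi := hg (a i)
    rcases hp.ends i with ⟨h1, h2⟩ | ⟨h1, h2⟩ <;> rw [h1, h2] at hi <;> rw [hi]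
    · ring
    · rw [sub_add_cancel_left, CharTwo.neg_eq]
  have hsum : ∑ i : Fin k, (g (n i.succ) - g (n i.castSucc)) = 0 := by
    have := Fin.sum_univ_castSucc fun i => g (n i)
    have h2 := Fin.sum_univ_succ fun i => g (n i)
    rw [Finset.sum_sub_distrib]
    rw [this, ← hc] at h2
    linear_combination -h2
  rw [Finset.sum_congr rfl fun i _ => step i, Finset.sum_eq_single ⟨0, hk⟩] at hsum
  · simp at hsum
  · intro i _ hi
    rw [if_neg (hinj i hi)]
  · simp

/-- A graph is connected if its locally constant functions are constant. -/
theorem Digr.card_CC_eq_one {G : Digr} (hn : Nonempty G.N)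
    (h : ∀ g : G.N → ZMod 2, (∀ a, g (G.head a) = g (G.tail a)) → ∃ k, ∀ n, g n = k) :
    Nat.card G.CC = 1 := by
  classical
  rw [Nat.card_eq_one_iff_unique]
  refine ⟨⟨?_⟩, hn.map (Quot.mk _)⟩
  intro x y
  induction x using Quot.ind with
  | _ m =>
  induction y using Quot.ind with
  | _ n =>
  -- The test function is the indicator of the connected component of `m`.
  obtain ⟨k, hk⟩ := h (fun x => if (Quot.mk _ x : G.CC) = Quot.mk _ m then 1 else 0) (by
    intro a
    have : (Quot.mk _ (G.tail a) : G.CC) = Quot.mk _ (G.head a) := Quot.sound ⟨a, rfl, rfl⟩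
    simp only [this])
  have h1 := (hk m).trans (hk n).symm
  simp only [if_true] at h1
  split_ifs at h1 with h2
  · exact h2.symm
  · exact absurd h1 one_ne_zero

/-! ### Potentials on rule trees -/

namespace RuleTree

theorem names_mono {t u : RuleTree} (h1 : t.rules ⊆ u.rules) (h2 : t.links ⊆ u.links) :
    t.names ⊆ u.names := by
  rintro (a | s | x) hn
  · exact h1 hn
  · exact h2 hn
  · exact hn.imp (fun h => h1 h) fun ⟨s, hs, hx⟩ => ⟨s, h2 hs, hx⟩

theorem mem_names_insert {t u : RuleTree} {b : Occ} (h1 : t.rules = insert b u.rules)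
    (h2 : t.links = u.links) {n : Name} (hn : n ∈ t.names) :
    n = .rule b ∨ n = .bul b ∨ n ∈ u.names := by
  rcases n with a | s | x
  · have : a ∈ t.rules := hn
    rw [h1] at this
    rcases this with rfl | h
    · exact Or.inl rfl
    · exact Or.inr (Or.inr h)
  · have : s ∈ t.links := hn
    rw [h2] at this
    exact Or.inr (Or.inr this)
  · have : x ∈ t.occs := hn
    rw [occs, h1, h2] at this
    rcases this with (rfl | h) | h
    · exact Or.inr (Or.inl rfl)
    · exact Or.inr (Or.inr (Or.inl h))
    · exact Or.inr (Or.inr (Or.inr h))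

theorem mem_names_tens {t u : RuleTree} {b : Occ} {n : Name} (hn : n ∈ (tens b t u).names) :
    n = .rule b ∨ n = .bul b ∨ n ∈ t.names ∨ n ∈ u.names := by
  rcases n with a | s | x
  · rcases hn with rfl | h | h
    · exact Or.inl rfl
    · exact Or.inr (Or.inr (Or.inl h))
    · exact Or.inr (Or.inr (Or.inr h))
  · exact Or.inr (Or.inr hn)
  · rcases hn with (rfl | h | h) | ⟨s, hs | hs, hx⟩
    · exact Or.inr (Or.inl rfl)
    · exact Or.inr (Or.inr (Or.inl (Or.inl h)))
    · exact Or.inr (Or.inr (Or.inr (Or.inl h)))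
    · exact Or.inr (Or.inr (Or.inl (Or.inr ⟨s, hs, hx⟩)))
    · exact Or.inr (Or.inr (Or.inr (Or.inr ⟨s, hs, hx⟩)))

theorem links_nonempty_or_rules_nonempty (t : RuleTree) : t.links.Nonempty ∨ t.rules.Nonempty := by
  cases t with
  | ax => exact Or.inl ⟨_, rfl⟩
  | one => exact Or.inr ⟨_, rfl⟩
  | bot | par | tens => exact Or.inr ⟨_, Or.inl rfl⟩

theorem names_bot (b : Occ) (t : RuleTree) : t.names ⊆ (bot b t).names :=
  names_mono (Set.subset_insert _ _) subset_rfl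

theorem names_par (b : Occ) (t : RuleTree) : t.names ⊆ (par b t).names :=
  names_mono (Set.subset_insert _ _) subset_rfl

theorem names_tens_left (b : Occ) (t u : RuleTree) : t.names ⊆ (tens b t u).names :=
  names_mono (fun _ h => Or.inr (Or.inl h)) Set.subset_union_left

theorem names_tens_right (b : Occ) (t u : RuleTree) : u.names ⊆ (tens b t u).names :=
  names_mono (fun _ h => Or.inr (Or.inr h)) Set.subset_union_right

end RuleTree

theorem Der.mem_names_of_tgt {S : Multiset Occ} {t : RuleTree} (h : Der Θ S t) {a : Occ}
    {m : Name} (ha : ty Θ a = .bot) : a ∈ t.rules → t.Tgt a m → m ∈ t.names := by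
  induction h with
  | ax => exact fun h => h.elim
  | one x hx =>
    rintro rfl
    simp [ha] at hx
  | bot x S t hx ht ih =>
    rintro (rfl | h) hT
    · exact RuleTree.names_bot _ _ (hT.1 rfl)
    · exact RuleTree.names_bot _ _ (ih h hT.2)
  | par x A B S t hx ht ih =>
    rintro (rfl | h) hT
    · simp [ha] at hx
    · exact RuleTree.names_par _ _ (ih h hT)
  | tens x A B S T t u hx ht hu ih1 ih2 =>
    rintro (rfl | h | h) hT
    · simp [ha] at hx
    · exact RuleTree.names_tens_left _ _ _ (ih1 h hT.1)
    · exact RuleTree.names_tens_right _ _ _ (ih2 h hT.2)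

theorem Der.prem_mem_occs {S : Multiset Occ} {t : RuleTree} (h : Der Θ S t) {a x : Occ} {b : Bool}
    (hx : premOcc a b (ty Θ a) = some x) : a ∈ t.rules → Name.bul x ∈ t.names := by
  induction h with
  | ax => exact fun h => h.elim
  | one y hy =>
    rintro rfl
    simp [hy, premOcc] at hx
  | bot y S t hy ht ih =>
    rintro (rfl | h)
    · simp [hy, premOcc] at hx
    · exact RuleTree.names_bot _ _ (ih h)
  | par y A B S t hy ht ih =>
    rintro (rfl | h)
    · refine RuleTree.names_par _ _ (ht.mem_occs x ?_)
      simp only [hy, premOcc, Option.some.injEq] at hx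
      subst hx
      cases b <;> simp [Occ.l_eq_child, Occ.r_eq_child]
    · exact RuleTree.names_par _ _ (ih h)
  | tens y A B S T t u hy ht hu ih1 ih2 =>
    rintro (rfl | h | h)
    · simp only [hy, premOcc, Option.some.injEq] at hx
      subst hx
      cases b
      · exact RuleTree.names_tens_left _ _ _ (ht.mem_occs _ (by simp [Occ.l_eq_child]))
      · exact RuleTree.names_tens_right _ _ _ (hu.mem_occs _ (by simp [Occ.r_eq_child]))
    · exact RuleTree.names_tens_left _ _ _ (ih1 h)
    · exact RuleTree.names_tens_right _ _ _ (ih2 h)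

/-- Two proofs whose conclusions are disjoint have no node in common. -/
theorem Der.names_disjoint {S T : Multiset Occ} {t u : RuleTree} (ht : Der Θ S t)
    (hu : Der Θ T u) (h : Disjoint (Cone S) (Cone T)) {n : Name} (hn : n ∈ t.names) :
    n ∉ u.names := by
  rw [Set.disjoint_left] at h
  rcases n with a | s | x
  · exact fun hn' => h (ht.occs_subset (Or.inl hn)) (hu.occs_subset (Or.inl hn'))
  · intro hn'
    induction s with
    | _ x y =>
      exact h (ht.links_cone hn (Sym2.mem_mk_left x y)) (hu.links_cone hn' (Sym2.mem_mk_left x y))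
  · exact fun hn' => h (ht.occs_subset hn) (hu.occs_subset hn')

section Potential

variable (Θ) (jn : Occ → Name) (c : Occ → Bool) (f h : Occ → ZMod 2)

/-- The equations of a potential `G` around the node that introduces `a`, for the weights `f` of
the arcs and `h` of the jumps, when the premise `c` is chosen. -/
def EqAt (G : Name → ZMod 2) (a : Occ) : Prop :=
  G (.bul a) = G (.rule a) + f a ∧
    ((ty Θ a).kind = .tens → ∀ b, G (.rule a) = G (.bul (a.child b))) ∧
    ((ty Θ a).kind = .par → G (.rule a) = G (.bul (a.child (c a)))) ∧
    ((ty Θ a).kind = .bot → G (jn a) = G (.rule a) + h a)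

/-- The equations of a potential on the nodes of `t`. -/
def Sol (t : RuleTree) (G : Name → ZMod 2) : Prop :=
  (∀ s ∈ t.links, ∀ x ∈ s, G (.bul x) = G (.ax s) + f x) ∧ ∀ a ∈ t.rules, EqAt Θ jn c f h G a

variable {Θ jn c f h}

theorem kind_eq_bot {F : Formula} (hF : F.kind = .bot) : F = .bot := by
  cases F <;> simp [Formula.kind] at hF
  rfl

theorem premOcc_of_kind {a : Occ} {F : Formula} (hF : F.kind = .tens ∨ F.kind = .par) (b : Bool) :
    premOcc a b F = some (a.child b) := by
  cases F <;> simp [Formula.kind] at hF <;> rfl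

theorem kind_of_premOcc {a x : Occ} {F : Formula} {b : Bool} (h : premOcc a b F = some x) :
    x = a.child b ∧ (F.kind = .tens ∨ F.kind = .par) := by
  cases F <;> simp [premOcc] at h <;> simp [Formula.kind, h]

/-- The equations of `t` mention only names of `t`, jump targets included, and are invariant under
translation. A solution may thus be shifted, and modified elsewhere. -/
theorem Der.sol_congr {S : Multiset Occ} {t : RuleTree} (ht : Der Θ S t)
    (hj : ∀ a ∈ t.rules, ty Θ a = .bot → t.Tgt a (jn a)) {G G' : Name → ZMod 2} {k : ZMod 2}
    (hG : ∀ n ∈ t.names, G' n = G n + k) (hs : Sol Θ jn c f h t G) : Sol Θ jn c f h t G' := by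
  refine ⟨fun s hsl x hx => ?_, fun a ha => ?_⟩
  · rw [hG _ (show Name.bul x ∈ t.names from Or.inr ⟨s, hsl, hx⟩), hG _ (show Name.ax s ∈ t.names
      from hsl), hs.1 s hsl x hx]
    ring
  · have hr := hG _ (show Name.rule a ∈ t.names from ha)
    have hp : (ty Θ a).kind = .tens ∨ (ty Θ a).kind = .par → ∀ b,
        G' (.bul (a.child b)) = G (.bul (a.child b)) + k := fun hk b =>
      hG _ (ht.prem_mem_occs (premOcc_of_kind hk b) ha)
    obtain ⟨h1, h2, h3, h4⟩ := hs.2 a ha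
    refine ⟨?_, fun hk b => ?_, fun hk => ?_, fun hk => ?_⟩
    · rw [hG _ (show Name.bul a ∈ t.names from Or.inl ha), hr, h1]
      ring
    · rw [hr, hp (Or.inl hk), h2 hk b]
    · rw [hr, hp (Or.inr hk), h3 hk]
    · have hb := kind_eq_bot hk
      rw [hr, hG _ (ht.mem_names_of_tgt hb ha (hj a ha hb)), h4 hk]
      ring

open Classical in
/-- A potential, extended to a new node. -/
noncomputable def extend (f : Occ → ZMod 2) (G : Name → ZMod 2) (b : Occ) (v : ZMod 2) :
    Name → ZMod 2 :=
  Function.update (Function.update G (.rule b) v) (.bul b) (v + f b)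

theorem extend_rule (f : Occ → ZMod 2) (G : Name → ZMod 2) (b : Occ) (v : ZMod 2) :
    extend f G b v (.rule b) = v := by simp [extend]

theorem extend_bul (f : Occ → ZMod 2) (G : Name → ZMod 2) (b : Occ) (v : ZMod 2) :
    extend f G b v (.bul b) = v + f b := by simp [extend]

theorem extend_of_mem (G : Name → ZMod 2) {b : Occ} {v : ZMod 2} {t : RuleTree}
    (hb : b ∉ t.occs) {n : Name} (hn : n ∈ t.names) : extend f G b v n = G n := by
  have h1 : n ≠ .rule b := by rintro rfl; exact hb (Or.inl hn)
  have h2 : n ≠ .bul b := by rintro rfl; exact hb hn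
  simp [extend, h1, h2]

/-- A `⊥` or `⅋` rule attaches its new node to the rest by a single edge, the jump or the chosen
premise, so its value is forced and no other constraint arises. A `⊗` rule joins two disjoint parts,
one of which is free to be shifted. -/
theorem Der.exists_sol {S : Multiset Occ} {t : RuleTree} (ht : Der Θ S t) : Anti S →
    (∀ a ∈ t.rules, ty Θ a = .bot → t.Tgt a (jn a)) → ∃ G, Sol Θ jn c f h t G := by
  classical
  induction ht with
  | ax x y hxy =>
    intro _ _
    refine ⟨fun n => match n with | .bul z => f z | _ => 0, fun s hs z hz => by simp, ?_⟩
    exact fun a ha => ha.elim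
  | one x hx =>
    intro _ _
    refine ⟨fun n => match n with | .bul z => f z | _ => 0, fun s hs => hs.elim, ?_⟩
    rintro a rfl
    simp [EqAt, hx, Formula.kind]
  | bot b S t hb ht ih =>
    intro hA hj
    have hj' : ∀ a ∈ t.rules, ty Θ a = .bot → t.Tgt a (jn a) := fun a ha hab =>
      (hj a (Or.inr ha) hab).2
    obtain ⟨G, hG⟩ := ih hA.of_cons hj'
    have hbt : b ∉ t.occs := fun hbt => hA.not_mem_cone (ht.occs_subset hbt)
    have hs := ht.sol_congr hj' (G' := extend f G b (G (jn b) - h b)) (k := 0)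
      (fun n hn => by rw [extend_of_mem G hbt hn, add_zero]) hG
    refine ⟨_, hs.1, ?_⟩
    rintro a (rfl | ha)
    · refine ⟨by rw [extend_rule, extend_bul], by simp [hb, Formula.kind],
        by simp [hb, Formula.kind], fun _ => ?_⟩
      rw [extend_rule, extend_of_mem G hbt ((hj a (Or.inl rfl) hb).1 rfl)]
      ring
    · exact hs.2 a ha
  | par b A B S t hb ht ih =>
    intro hA hj
    have hj' : ∀ a ∈ t.rules, ty Θ a = .bot → t.Tgt a (jn a) := fun a ha hab =>
      hj a (Or.inr ha) hab
    obtain ⟨G, hG⟩ := ih hA.par hj'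
    have hbt : b ∉ t.occs := fun hbt => hA.not_mem_cone_par (ht.occs_subset hbt)
    have hs := ht.sol_congr hj' (G' := extend f G b (G (.bul (b.child (c b))))) (k := 0)
      (fun n hn => by rw [extend_of_mem G hbt hn, add_zero]) hG
    refine ⟨_, hs.1, ?_⟩
    rintro a (rfl | ha)
    · refine ⟨by rw [extend_rule, extend_bul], by simp [hb, Formula.kind], fun _ => ?_,
        by simp [hb, Formula.kind]⟩
      rw [extend_rule, extend_of_mem (t := t) G hbt]
      refine ht.mem_occs _ ?_
      cases c a <;> simp [Occ.l_eq_child, Occ.r_eq_child]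
    · exact hs.2 a ha
  | tens b A B S T t u hb ht hu ih1 ih2 =>
    intro hA hj
    have hj1 : ∀ a ∈ t.rules, ty Θ a = .bot → t.Tgt a (jn a) := fun a ha hab =>
      (hj a (Or.inr (Or.inl ha)) hab).1
    have hj2 : ∀ a ∈ u.rules, ty Θ a = .bot → u.Tgt a (jn a) := fun a ha hab =>
      (hj a (Or.inr (Or.inr ha)) hab).2
    obtain ⟨G, hG⟩ := ih1 hA.tens_left hj1
    obtain ⟨G', hG'⟩ := ih2 hA.tens_right hj2
    have hbt : b ∉ t.occs := fun hbt => hA.not_mem_cone_left (ht.occs_subset hbt)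
    have hbu : b ∉ u.occs := fun hbu => hA.not_mem_cone_right (hu.occs_subset hbu)
    set v := G (.bul b.l) with hv
    -- The shift that makes the two premises of the `⊗` agree at the new node.
    set k := v - G' (.bul b.r) with hk
    set H := extend f (fun n => if n ∈ t.names then G n else G' n + k) b v with hH
    have H1 : ∀ n ∈ t.names, H n = G n + 0 := fun n hn => by
      rw [hH, extend_of_mem _ hbt hn, if_pos hn, add_zero]
    have H2 : ∀ n ∈ u.names, H n = G' n + k := fun n hn => by
      rw [hH, extend_of_mem _ hbu hn,
        if_neg (hu.names_disjoint ht hA.tens.disjoint.symm hn)]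
    have s1 := ht.sol_congr hj1 H1 hG
    have s2 := hu.sol_congr hj2 H2 hG'
    refine ⟨H, ?_, ?_⟩
    · rintro s (hs | hs)
      · exact s1.1 s hs
      · exact s2.1 s hs
    · rintro a (rfl | ha | ha)
      · refine ⟨by rw [hH, extend_rule, extend_bul], fun _ d => ?_, by simp [hb, Formula.kind],
          by simp [hb, Formula.kind]⟩
        rw [hH, extend_rule, ← hH]
        cases d
        · rw [H1 _ (ht.mem_occs _ (by simp [Occ.l_eq_child])), hv, Occ.l_eq_child, add_zero]
        · rw [H2 _ (hu.mem_occs _ (by simp [Occ.r_eq_child])), hk, Occ.r_eq_child]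
          ring
      · exact s1.2 a ha
      · exact s2.2 a ha

/-- With zero weights, each new node takes the value of a node that is already there, and a `⊗`
identifies the constants of its two premises. -/
theorem Der.sol_const {S : Multiset Occ} {t : RuleTree} (ht : Der Θ S t) {G : Name → ZMod 2} :
    (∀ a ∈ t.rules, ty Θ a = .bot → t.Tgt a (jn a)) → Sol Θ jn c 0 0 t G →
    ∃ k, ∀ n ∈ t.names, G n = k := by
  induction ht with
  | ax x y hxy =>
    intro _ hs
    refine ⟨G (.ax s(x, y)), ?_⟩
    rintro (a | s | z) hn
    · exact hn.elim
    · rw [show s = s(x, y) from hn]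
    · rcases hn with hn | ⟨s, rfl, hz⟩
      · exact hn.elim
      · simpa using hs.1 _ rfl z hz
  | one x hx =>
    intro _ hs
    refine ⟨G (.rule x), ?_⟩
    rintro (a | s | z) hn
    · rw [show a = x from hn]
    · exact hn.elim
    · rcases hn with rfl | ⟨s, hs, hz⟩
      · simpa using (hs.2 z rfl).1
      · exact hs.elim
  | bot b S t hb ht ih =>
    intro hj hs
    obtain ⟨k, hk⟩ := ih (fun a ha hab => (hj a (Or.inr ha) hab).2)
      ⟨hs.1, fun a ha => hs.2 a (Or.inr ha)⟩
    obtain ⟨h1, -, -, h4⟩ := hs.2 b (Or.inl rfl)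
    have hr : G (.rule b) = k := by
      rw [← hk _ ((hj b (Or.inl rfl) hb).1 rfl), h4 (by simp [hb, Formula.kind])]
      simp
    refine ⟨k, fun n hn => ?_⟩
    rcases RuleTree.mem_names_insert (t := .bot b t) (u := t) (b := b) rfl rfl hn with rfl | rfl | hn
    · exact hr
    · rw [h1, hr]; simp
    · exact hk n hn
  | par b A B S t hb ht ih =>
    intro hj hs
    obtain ⟨k, hk⟩ := ih (fun a ha hab => hj a (Or.inr ha) hab)
      ⟨hs.1, fun a ha => hs.2 a (Or.inr ha)⟩
    obtain ⟨h1, -, h3, -⟩ := hs.2 b (Or.inl rfl)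
    have hr : G (.rule b) = k := by
      rw [h3 (by simp [hb, Formula.kind]), hk]
      refine ht.mem_occs _ ?_
      cases c b <;> simp [Occ.l_eq_child, Occ.r_eq_child]
    refine ⟨k, fun n hn => ?_⟩
    rcases RuleTree.mem_names_insert (t := .par b t) (u := t) (b := b) rfl rfl hn with rfl | rfl | hn
    · exact hr
    · rw [h1, hr]; simp
    · exact hk n hn
  | tens b A B S T t u hb ht hu ih1 ih2 =>
    intro hj hs
    obtain ⟨k, hk⟩ := ih1 (fun a ha hab => (hj a (Or.inr (Or.inl ha)) hab).1)
      ⟨fun s h => hs.1 s (Or.inl h), fun a ha => hs.2 a (Or.inr (Or.inl ha))⟩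
    obtain ⟨k', hk'⟩ := ih2 (fun a ha hab => (hj a (Or.inr (Or.inr ha)) hab).2)
      ⟨fun s h => hs.1 s (Or.inr h), fun a ha => hs.2 a (Or.inr (Or.inr ha))⟩
    obtain ⟨h1, h2, -, -⟩ := hs.2 b (Or.inl rfl)
    have h2 := h2 (by simp [hb, Formula.kind])
    have hr : G (.rule b) = k := by
      rw [h2 false, hk _ (ht.mem_occs _ (by simp [Occ.l_eq_child]))]
    have hr' : G (.rule b) = k' := by
      rw [h2 true, hk' _ (hu.mem_occs _ (by simp [Occ.r_eq_child]))]
    refine ⟨k, fun n hn => ?_⟩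
    rcases RuleTree.mem_names_tens hn with rfl | rfl | hn | hn
    · exact hr
    · rw [h1, hr]; simp
    · exact hk n hn
    · rw [hk' n hn, ← hr', hr]

end Potential

/-! ### Correctness -/

/-- An arc named by a premise of a rule is thus never a conclusion, and its head is the node of that
rule. -/
theorem Anti.child_notMem {S : Multiset Occ} (hS : Anti S) {x : Occ} (hx : x ∈ Cone S) (b : Bool) :
    x.child b ∉ S := by
  intro h
  obtain ⟨v, hv, hvx⟩ := hx
  have := hS.2 v hv _ h (hvx.trans (above_child x b))
  subst this
  exact not_child_above _ _ hvx

theorem exists_comp_eq {α β γ : Type} [Nonempty γ] {f : α → β} (hf : Function.Injective f)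
    (g : α → γ) : ∃ g' : β → γ, ∀ a, g' (f a) = g a :=
  ⟨Function.extend f g fun _ => Classical.arbitrary γ, hf.extend_apply g _⟩

/-- The heads of the arcs in the switching graph of a named proof-structure. -/
theorem IsNaming.exists_choice {ν : List Occ} {t : RuleTree} {R : PreStructure} {nA : R.A → Occ}
    {nN : R.N → Name} (hR : IsNaming Θ ν t.links t.rules R nA nN) (ht : Der Θ ν t)
    (hν : Anti (ν : Multiset Occ)) (φ : R.Switching) : ∃ c : Occ → Bool,
    (∀ a, nA a ∈ ν → (R.switchingGraph φ).head (.inl a) = .inl (R.head a) ∧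
      nN (R.head a) = .bul (nA a)) ∧
    (∀ a x b, nA a = x.child b → x ∈ t.rules → (ty Θ x).kind = .tens →
      (R.switchingGraph φ).head (.inl a) = .inl (R.head a) ∧ nN (R.head a) = .rule x) ∧
    (∀ a x b, nA a = x.child b → x ∈ t.rules → (ty Θ x).kind = .par →
      ∃ n : {n : R.N // R.label n = .par}, nN n = .rule x ∧
        (R.switchingGraph φ).head (.inl a) = if b = c x then .inl n.1 else .inr n) := by
  classical
  have hchild : ∀ {a x b}, nA a = x.child b → x ∈ t.rules → nN (R.head a) = .rule x := by
    intro a x b ha hx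
    rw [hR.head, headName, if_neg, ha, Occ.parent_child]
    rw [ha]
    exact fun h => hν.child_notMem (ht.occs_subset (Or.inl hx)) b (Multiset.mem_coe.2 h)
  -- The arc chosen at a `⅋` node is the left or the right child of its occurrence; this turns the
  -- switching into a choice of sides.
  have hside : ∀ n : {n : R.N // R.label n = .par}, ∃ b, ∃ x, nN n = .rule x ∧
      nA (φ n).1 = x.child b := by
    intro n
    have hhead := (φ n).2
    rcases ht.occs_cases _ (hR.mem_occs (φ n).1) with h | ⟨x, hx, b, h⟩
    · exfalso
      have h1 := hR.head (φ n).1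
      rw [headName, if_pos (Multiset.mem_coe.1 h), hhead] at h1
      have h2 := hR.label n.1
      rw [h1, n.2] at h2
      cases h2
    · have h1 := (kind_of_premOcc h).1
      exact ⟨b, x, by rw [← hhead]; exact hchild h1 hx, h1⟩
  choose side hside using hside
  obtain ⟨C, hC⟩ := exists_comp_eq (f := fun n : {n : R.N // R.label n = .par} => nN n.1)
    (fun n m h => Subtype.ext (hR.nN_inj h)) side
  refine ⟨fun x => C (.rule x), fun a ha => ?_, fun a x b ha hx hk => ?_, fun a x b ha hx hk => ?_⟩
  · have h1 : nN (R.head a) = .bul (nA a) := by rw [hR.head, headName, if_pos ha]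
    refine ⟨?_, h1⟩
    have h2 : R.label (R.head a) ≠ .par := by rw [hR.label, h1]; simp [Name.label]
    simp [h2]
  · have h1 := hchild ha hx
    refine ⟨?_, h1⟩
    have h2 : R.label (R.head a) ≠ .par := by rw [hR.label, h1]; simp [Name.label, hk]
    simp [h2]
  · have h1 := hchild ha hx
    have h2 : R.label (R.head a) = .par := by rw [hR.label, h1]; exact hk
    refine ⟨⟨R.head a, h2⟩, h1, ?_⟩
    obtain ⟨x', h3, h4⟩ := hside ⟨R.head a, h2⟩
    have h5 := hC ⟨R.head a, h2⟩
    simp only [h1] at h3 h5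
    injection h3 with h3
    subst h3
    have h6 : (φ ⟨R.head a, h2⟩).1 = a ↔ b = C (.rule x) := by
      rw [h5, ← hR.nA_inj.eq_iff, h4, ha, Occ.child_inj]
      simp [eq_comm]
    simp only [h2, dif_pos, h6]

/-- A proof-structure whose jumps obey a rule tree is correct. -/
theorem IsNaming.acc {ν : List Occ} {t : RuleTree} {R : PreStructure} {nA : R.A → Occ}
    {nN : R.N → Name} (hR : IsNaming Θ ν t.links t.rules R nA nN) (ht : Der Θ ν t)
    (hν : Anti (ν : Multiset Occ)) (hj : JumpsIn R nN t.Tgt) (htot : R.JumpTotal)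
    (hbot : ∀ n m, R.jump n = some m → R.label n = .bot) : R.ACC := by
  classical
  intro φ
  obtain ⟨c, hc1, hc2, hc3⟩ := hR.exists_choice ht hν φ
  have : Nonempty Name := ⟨.bul (0, [])⟩
  obtain ⟨JN, hJN⟩ := exists_comp_eq
    (f := fun n : {n : R.N // (R.jump n).isSome} => nN n.1)
    (fun n m h => Subtype.ext (hR.nN_inj h)) (fun n => nN ((R.jump n.1).get n.2))
  set jn : Occ → Name := fun x => JN (.rule x) with hjn
  have hjump : ∀ n : {n : R.N // (R.jump n).isSome}, ∃ a, nN n.1 = .rule a ∧ a ∈ t.rules ∧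
      (ty Θ a).kind = .bot ∧ jn a = nN ((R.jump n.1).get n.2) ∧ t.Tgt a (jn a) := by
    intro n
    have h1 : R.jump n.1 = some ((R.jump n.1).get n.2) := by simp
    obtain ⟨a, h2, h3⟩ := hj _ _ h1
    have h4 : jn a = nN ((R.jump n.1).get n.2) := by rw [hjn, ← hJN n, h2]
    refine ⟨a, h2, hR.mem_of_rule h2, ?_, h4, by rwa [h4]⟩
    have h5 := hbot _ _ h1
    rw [hR.label, h2] at h5
    exact h5
  have hnode : ∀ a ∈ t.rules, (ty Θ a).kind = .bot →
      ∃ n : {n : R.N // (R.jump n).isSome}, nN n.1 = .rule a := by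
    intro a ha hk
    obtain ⟨n, hn⟩ := hR.exists_node_rule ha
    exact ⟨⟨n, htot n (by rw [hR.label, hn]; exact hk)⟩, hn⟩
  have hT : ∀ a ∈ t.rules, ty Θ a = .bot → t.Tgt a (jn a) := by
    intro a ha hb
    obtain ⟨n, hn⟩ := hnode a ha (by rw [hb]; rfl)
    obtain ⟨a', h1, -, -, -, h2⟩ := hjump n
    rw [hn] at h1
    injection h1 with h1
    rwa [h1]
  have harc : ∀ a, nA a ∈ ν ∨ ∃ x ∈ t.rules, ∃ b, nA a = x.child b ∧
      ((ty Θ x).kind = .tens ∨ (ty Θ x).kind = .par) := by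
    intro a
    rcases ht.occs_cases _ (hR.mem_occs a) with h | ⟨x, hx, b, h⟩
    · exact Or.inl (Multiset.mem_coe.1 h)
    · obtain ⟨h1, h2⟩ := kind_of_premOcc h
      exact Or.inr ⟨x, hx, b, h1, h2⟩
  have hprem : ∀ x ∈ t.rules, ((ty Θ x).kind = .tens ∨ (ty Θ x).kind = .par) → ∀ b,
      ∃ a, nA a = x.child b := by
    intro x hx hk b
    rcases ht.prem_mem_occs (premOcc_of_kind hk b) hx with h | ⟨s, hs, h⟩
    · exact hR.exists_rule _ h
    · exact hR.exists_of_mem_ax hs h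
  have hparnode : ∀ n : {n : R.N // R.label n = .par}, ∃ x ∈ t.rules, nN n = .rule x ∧
      (ty Θ x).kind = .par := by
    intro n
    have h1 := hR.label n.1
    rw [n.2] at h1
    rcases hR.node_cases n.1 with ⟨a, -, h2, h3⟩ | ⟨s, -, h3⟩ | ⟨a, -, -, h3⟩ <;> rw [h3] at h1
    · exact ⟨nA a, h2, h3, h1.symm⟩
    · cases h1
    · cases h1
  constructor
  · refine Digr.acyclic_of_potential fun w => ?_
    obtain ⟨f, hf⟩ := exists_comp_eq hR.nA_inj fun a => w (.inl a)
    obtain ⟨h, hh⟩ := exists_comp_eq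
      (f := fun n : {n : R.N // (R.jump n).isSome} => nN n.1)
      (fun n m h => Subtype.ext (hR.nN_inj h)) (fun n => w (.inr n))
    obtain ⟨G, hG⟩ := ht.exists_sol (c := c) (f := f) (h := fun x => h (.rule x)) hν hT
    choose other hother using hparnode
    -- The value at `Name.bul x` serves as the potential at the end of the arc named `x`. The fresh
    -- node of a `⅋` ends the premise that is not chosen, hence the negated choice.
    refine ⟨Sum.elim (fun n => G (nN n)) fun n => G (.bul ((other n).child (! c (other n)))), ?_⟩
    rintro (a | n)
    · have h1 : G (.bul (nA a)) = G (nN (R.tail a)) + w (.inl a) := by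
        rw [← hf]
        rcases hR.tail_cases a with ⟨h1, h2⟩ | ⟨s, h1, h2, h3⟩
        · rw [h2, (hG.2 _ h1).1]
        · rw [h3, hG.1 s h1 _ h2]
      refine Eq.trans ?_ h1
      rcases harc a with ha | ⟨x, hx, b, ha, hk⟩
      · rw [(hc1 a ha).1, Sum.elim_inl, (hc1 a ha).2]
      · rcases hk with hk | hk
        · obtain ⟨h2, h3⟩ := hc2 a x b ha hx hk
          rw [h2, Sum.elim_inl, h3, ha]
          exact (hG.2 x hx).2.1 hk b
        · obtain ⟨n, h2, h3⟩ := hc3 a x b ha hx hk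
          rw [h3]
          split_ifs with hb
          · rw [Sum.elim_inl, h2, ha, hb]
            exact (hG.2 x hx).2.2.1 hk
          · obtain ⟨-, h4, -⟩ := hother n
            rw [h2] at h4
            injection h4 with h4
            rw [Sum.elim_inr, ← h4, ha]
            congr 3
            cases b <;> cases hcx : c x <;> simp [hcx] at hb ⊢
    · obtain ⟨a, h1, h2, h3, h4, -⟩ := hjump n
      have h5 := (hG.2 a h2).2.2.2 h3
      simp only [Sum.elim_inl]
      rw [← hh n, h1, ← h4]
      exact h5
  · have hne : Nonempty R.N := by
      rcases t.links_nonempty_or_rules_nonempty with ⟨s, hs⟩ | ⟨x, hx⟩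
      · obtain ⟨n, -⟩ := hR.exists_node_ax hs; exact ⟨n⟩
      · obtain ⟨n, -⟩ := hR.exists_node_rule hx; exact ⟨n⟩
    refine Digr.card_CC_eq_one (hne.map .inl) fun g hg => ?_
    obtain ⟨G0, hG0⟩ := exists_comp_eq hR.nN_inj fun n => g (.inl n)
    obtain ⟨B, hB⟩ := exists_comp_eq hR.nA_inj fun a => g ((R.switchingGraph φ).head (.inl a))
    -- Conversely, `Name.bul x` receives the value of `g` at the head, in the switching graph, of
    -- the arc named `x`; for an actual `bullet` node this is its own value.
    set G : Name → ZMod 2 := fun n => match n with | .bul x => B x | n => G0 n with hGdef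
    have hGN : ∀ n, G (nN n) = g (.inl n) := by
      intro n
      rcases hR.node_cases n with ⟨a, -, h1, h2⟩ | ⟨s, h1, h2⟩ | ⟨a, h0, h1, h2⟩
      · rw [← hG0, h2]
      · rw [← hG0, h2]
      · rw [h2, ← h0, ← (hc1 a h1).1]
        exact hB a
    have hGA : ∀ a, G (.bul (nA a)) = g ((R.switchingGraph φ).head (.inl a)) := hB
    have htail : ∀ a, G (.bul (nA a)) = G (nN (R.tail a)) := fun a => by
      rw [hGA, hGN]
      exact hg (.inl a)
    have hsol : Sol Θ jn c 0 0 t G := by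
      refine ⟨fun s hs x hx => ?_, fun x hx => ⟨?_, fun hk b => ?_, fun hk => ?_, fun hk => ?_⟩⟩
      · obtain ⟨a, rfl⟩ := hR.exists_of_mem_ax hs hx
        rw [htail, hR.tail_ax a s hs hx]
        simp
      · obtain ⟨a, rfl⟩ := hR.exists_rule x hx
        rw [htail, hR.tail_rule a hx]
        simp
      · obtain ⟨a, ha⟩ := hprem x hx (Or.inl hk) b
        obtain ⟨h1, h2⟩ := hc2 a x b ha hx hk
        rw [← ha, hGA, h1, ← hGN, h2]
      · obtain ⟨a, ha⟩ := hprem x hx (Or.inr hk) (c x)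
        obtain ⟨n, h1, h2⟩ := hc3 a x _ ha hx hk
        rw [← ha, hGA, h2, if_pos rfl, ← hGN, h1]
      · obtain ⟨n, hn⟩ := hnode x hx hk
        obtain ⟨a, h1, -, -, h2, -⟩ := hjump n
        rw [hn] at h1
        injection h1 with h1
        subst h1
        rw [h2, ← hn, hGN, hGN]
        simpa using hg (.inr n)
    obtain ⟨k, hk⟩ := ht.sol_const hT hsol
    refine ⟨k, ?_⟩
    rintro (n | n)
    · rw [← hGN]
      exact hk _ (hR.mem_names n)
    · obtain ⟨x, hx, h1, h2⟩ := hparnode n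
      obtain ⟨a, ha⟩ := hprem x hx (Or.inr h2) (! c x)
      obtain ⟨n', h3, h4⟩ := hc3 a x _ ha hx h2
      obtain rfl : n = n' := Subtype.ext (hR.nN_inj (h1.trans h3.symm))
      rw [if_neg (by simp)] at h4
      rw [← h4, ← hGA, ha]
      exact hk _ (ht.prem_mem_occs (premOcc_of_kind (Or.inr h2) _) hx)

/-! ### Common targets of jumps -/

/-- A target lies in the premise of the `⊥` rule, where `a` does not occur. This gives the distinct
ends required of a jump. -/
theorem Der.tgt_ne {S : Multiset Occ} {t : RuleTree} (h : Der Θ S t) {a : Occ} {m : Name}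
    (ha : ty Θ a = .bot) : Anti S → a ∈ t.rules → t.Tgt a m → m ≠ .rule a := by
  induction h with
  | ax => exact fun _ h => h.elim
  | one x hx =>
    rintro _ rfl
    simp [ha] at hx
  | bot x S t hx ht ih =>
    rintro hS (rfl | h) hT
    · rintro rfl
      exact hS.not_mem_cone (ht.occs_subset (Or.inl (hT.1 rfl)))
    · exact ih hS.of_cons h hT.2
  | par x A B S t hx ht ih =>
    rintro hS (rfl | h) hT
    · simp [ha] at hx
    · exact ih hS.par h hT
  | tens x A B S T t u hx ht hu ih1 ih2 =>
    rintro hS (rfl | h | h) hT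
    · simp [ha] at hx
    · exact ih1 hS.tens_left h hT.1
    · exact ih2 hS.tens_right h hT.2

theorem Der.notMem_rules {S T : Multiset Occ} {t u : RuleTree} (ht : Der Θ S t) (hu : Der Θ T u)
    (h : Disjoint (Cone S) (Cone T)) {a : Occ} (ha : a ∈ t.rules) : a ∉ u.rules :=
  ht.names_disjoint hu h (n := .rule a) ha

/-- A node that can be the target of a jump from `a`, and that is not the `bullet` node of an
occurrence. -/
theorem Der.exists_tgt {S : Multiset Occ} {t : RuleTree} (h : Der Θ S t) :
    Anti S → ∀ a, ∃ m ∈ t.names, (∀ x, m ≠ .bul x) ∧ t.Tgt a m := by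
  induction h with
  | ax x y h => exact fun _ a => ⟨.ax s(x, y), rfl, by simp, trivial⟩
  | one x h => exact fun _ a => ⟨.rule x, rfl, by simp, trivial⟩
  | bot x S t hx ht ih =>
    intro hS a
    obtain ⟨m, h1, h2, h3⟩ := ih hS.of_cons a
    exact ⟨m, RuleTree.names_bot _ _ h1, h2, fun _ => h1, h3⟩
  | par x A B S t hx ht ih =>
    intro hS a
    obtain ⟨m, h1, h2, h3⟩ := ih hS.par a
    exact ⟨m, RuleTree.names_par _ _ h1, h2, h3⟩
  | tens x A B S T t u hx ht hu ih1 ih2 =>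
    intro hS a
    -- The occurrence `a` is introduced in at most one premise; a target is chosen there, and the
    -- other premise imposes nothing.
    by_cases ha : a ∈ t.rules
    · obtain ⟨m, h1, h2, h3⟩ := ih1 hS.tens_left a
      exact ⟨m, RuleTree.names_tens_left _ _ _ h1, h2, h3,
        RuleTree.tgt_of_not_mem (ht.notMem_rules hu hS.tens.disjoint ha) m⟩
    · obtain ⟨m, h1, h2, h3⟩ := ih2 hS.tens_right a
      exact ⟨m, RuleTree.names_tens_right _ _ _ h1, h2, RuleTree.tgt_of_not_mem ha m, h3⟩

theorem RuleTree.Swap.names_eq {t t' : RuleTree} (h : t.Swap t') : t.names = t'.names :=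
  (names_mono h.rules_eq.subset h.links_eq.subset).antisymm
    (names_mono h.rules_eq.symm.subset h.links_eq.symm.subset)

/-- Two trees that differ by an interchange of rules have a common target for every jump. -/
theorem RuleTree.Swap.exists_tgt {t t' : RuleTree} (h : t.Swap t') : ∀ {S : Multiset Occ},
    Der Θ S t → Anti S → ∀ c, ∃ m ∈ t.names, (∀ x, m ≠ .bul x) ∧ t.Tgt c m ∧ t'.Tgt c m := by
  induction h with
  | bot_bot a b t =>
    intro S ht hS c
    cases ht with
    | bot _ S _ ha ht =>
    cases ht with
    | bot _ S _ hb ht =>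
    obtain ⟨m, h1, h2, h3⟩ := ht.exists_tgt hS.of_cons.of_cons c
    have h1' := RuleTree.names_bot a _ h1
    have h1'' := RuleTree.names_bot b _ h1
    exact ⟨m, RuleTree.names_bot _ _ h1'', h2, ⟨fun _ => h1'', fun _ => h1, h3⟩,
      fun _ => h1', fun _ => h1, h3⟩
  | bot_par a b t =>
    intro S ht hS c
    cases ht with
    | bot _ S _ ha ht =>
    cases ht with
    | par _ A B S _ hb ht =>
    obtain ⟨m, h1, h2, h3⟩ := ht.exists_tgt hS.of_cons.par c
    have h1' := RuleTree.names_par b _ h1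
    exact ⟨m, RuleTree.names_bot _ _ h1', h2, ⟨fun _ => h1', h3⟩, fun _ => h1, h3⟩
  | bot_tens_left a b t u =>
    intro S ht hS c
    cases ht with
    | bot _ S _ ha ht =>
    have hac : a ∉ (RuleTree.tens b t u).rules :=
      fun h => hS.not_mem_cone (ht.occs_subset (Or.inl h))
    cases ht with
    | tens _ A B S T _ _ hb ht hu =>
    have hS' := hS.of_cons
    -- A `⊥` below the `⊗` could jump to either side, but above it only to the left. A target on the
    -- left suits it in both trees; only sources in the right premise need a target there.
    by_cases hc : c ∈ u.rules
    · obtain ⟨m, h1, h2, h3⟩ := hu.exists_tgt hS'.tens_right c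
      have h1' := RuleTree.names_tens_right b t _ h1
      have h4 := RuleTree.tgt_of_not_mem (hu.notMem_rules ht hS'.tens.disjoint.symm hc) m
      exact ⟨m, RuleTree.names_bot _ _ h1', h2, ⟨fun _ => h1', h4, h3⟩,
        ⟨fun h => (hac (h ▸ Or.inr (Or.inr hc))).elim, h4⟩, h3⟩
    · obtain ⟨m, h1, h2, h3⟩ := ht.exists_tgt hS'.tens_left c
      have h1' := RuleTree.names_tens_left b _ u h1
      have h4 := RuleTree.tgt_of_not_mem hc m
      exact ⟨m, RuleTree.names_bot _ _ h1', h2, ⟨fun _ => h1', h3, h4⟩, ⟨fun _ => h1, h3⟩, h4⟩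
  | bot_tens_right a b t u =>
    intro S ht hS c
    cases ht with
    | bot _ S _ ha ht =>
    have hac : a ∉ (RuleTree.tens b t u).rules :=
      fun h => hS.not_mem_cone (ht.occs_subset (Or.inl h))
    cases ht with
    | tens _ A B S T _ _ hb ht hu =>
    have hS' := hS.of_cons
    by_cases hc : c ∈ t.rules
    · obtain ⟨m, h1, h2, h3⟩ := ht.exists_tgt hS'.tens_left c
      have h1' := RuleTree.names_tens_left b _ u h1
      have h4 := RuleTree.tgt_of_not_mem (ht.notMem_rules hu hS'.tens.disjoint hc) m
      exact ⟨m, RuleTree.names_bot _ _ h1', h2, ⟨fun _ => h1', h3, h4⟩, h3,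
        fun h => (hac (h ▸ Or.inr (Or.inl hc))).elim, h4⟩
    · obtain ⟨m, h1, h2, h3⟩ := hu.exists_tgt hS'.tens_right c
      have h1' := RuleTree.names_tens_right b t _ h1
      have h4 := RuleTree.tgt_of_not_mem hc m
      exact ⟨m, RuleTree.names_bot _ _ h1', h2, ⟨fun _ => h1', h4, h3⟩, h4, fun _ => h1, h3⟩
  -- No `⊥` rule is moved, so the conditions on targets are the same, up to rearrangement.
  | par_par | par_tens_left | par_tens_right =>
    intro S ht hS c
    obtain ⟨m, h1, h2, h3⟩ := ht.exists_tgt hS c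
    exact ⟨m, h1, h2, h3, h3⟩
  | tens_tens_left | tens_tens_middle | tens_tens_right =>
    intro S ht hS c
    obtain ⟨m, h1, h2, h3⟩ := ht.exists_tgt hS c
    refine ⟨m, h1, h2, h3, ?_⟩
    simp only [RuleTree.Tgt] at h3 ⊢
    tauto
  | congr_bot a hs ih =>
    intro S ht hS c
    cases ht with
    | bot _ S _ ha ht =>
    obtain ⟨m, h1, h2, h3, h4⟩ := ih ht hS.of_cons c
    exact ⟨m, RuleTree.names_bot _ _ h1, h2, ⟨fun _ => h1, h3⟩,
      fun _ => by rwa [← hs.names_eq], h4⟩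
  | congr_par a hs ih =>
    intro S ht hS c
    cases ht with
    | par _ A B S _ ha ht =>
    obtain ⟨m, h1, h2, h3, h4⟩ := ih ht hS.par c
    exact ⟨m, RuleTree.names_par _ _ h1, h2, h3, h4⟩
  | congr_tens_left a u hs ih =>
    intro S ht hS c
    cases ht with
    | tens _ A B S T _ _ ha ht hu =>
    by_cases hc : c ∈ u.rules
    · obtain ⟨m, h1, h2, h3⟩ := hu.exists_tgt hS.tens_right c
      have hn := hu.notMem_rules ht hS.tens.disjoint.symm hc
      exact ⟨m, RuleTree.names_tens_right _ _ _ h1, h2, ⟨RuleTree.tgt_of_not_mem hn m, h3⟩,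
        RuleTree.tgt_of_not_mem (by rwa [← hs.rules_eq]) m, h3⟩
    · obtain ⟨m, h1, h2, h3, h4⟩ := ih ht hS.tens_left c
      have h5 := RuleTree.tgt_of_not_mem hc m
      exact ⟨m, RuleTree.names_tens_left _ _ _ h1, h2, ⟨h3, h5⟩, h4, h5⟩
  | congr_tens_right a t hs ih =>
    intro S ht hS c
    cases ht with
    | tens _ A B S T _ _ ha ht hu =>
    by_cases hc : c ∈ t.rules
    · obtain ⟨m, h1, h2, h3⟩ := ht.exists_tgt hS.tens_left c
      have hn := ht.notMem_rules hu hS.tens.disjoint hc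
      exact ⟨m, RuleTree.names_tens_left _ _ _ h1, h2, ⟨h3, RuleTree.tgt_of_not_mem hn m⟩,
        h3, RuleTree.tgt_of_not_mem (by rwa [← hs.rules_eq]) m⟩
    · obtain ⟨m, h1, h2, h3, h4⟩ := ih hu hS.tens_right c
      have h5 := RuleTree.tgt_of_not_mem hc m
      exact ⟨m, RuleTree.names_tens_right _ _ _ h1, h2, ⟨h5, h3⟩, h5, h4⟩

/-! ### Rewiring -/

namespace PreStructure

/-- The structure `R` with another jump function. -/
abbrev withJumps (R : PreStructure) (J : R.N → Option R.N) : PreStructure := { R with jump := J }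

/-- The identity. -/
def BaseIso.withJumps (R : PreStructure) (J J' : R.N → Option R.N) :
    (R.withJumps J).BaseIso (R.withJumps J') where
  node := Equiv.refl _
  arc := Equiv.refl _
  label _ := rfl
  tail _ := rfl
  head _ := rfl
  left _ := by simp
  right _ := by simp
  concl := by simp
  type _ := rfl

/-- The inverse of an isomorphism. -/
def BaseIso.symm {R S : PreStructure} (e : R.BaseIso S) : S.BaseIso R where
  node := e.node.symm
  arc := e.arc.symm
  label n := by rw [← e.label, Equiv.apply_symm_apply]
  tail a := by rw [Equiv.eq_symm_apply, ← e.tail, Equiv.apply_symm_apply]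
  head a := by rw [Equiv.eq_symm_apply, ← e.head, Equiv.apply_symm_apply]
  left n := by
    have := e.left (e.node.symm n)
    rw [Equiv.apply_symm_apply] at this
    simp [this, Option.map_map]
  right n := by
    have := e.right (e.node.symm n)
    rw [Equiv.apply_symm_apply] at this
    simp [this, Option.map_map]
  concl := by simp [e.concl]
  type a := by rw [← e.type, Equiv.apply_symm_apply]

/-- The composition of two isomorphisms. -/
def BaseIso.trans {R S T : PreStructure} (e : R.BaseIso S) (e' : S.BaseIso T) : R.BaseIso T where
  node := e.node.trans e'.node
  arc := e.arc.trans e'.arc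
  label n := (e'.label _).trans (e.label n)
  tail a := by simp [e.tail, e'.tail]
  head a := by simp [e.head, e'.head]
  left n := by simp [e.left, e'.left, Option.map_map]
  right n := by simp [e.right, e'.right, Option.map_map]
  concl := by simp [e.concl, e'.concl]
  type a := (e'.type _).trans (e.type a)

theorem RewireEquiv.nonempty_baseIso {R S : {R : PreStructure // R.JumpCorrect}}
    (h : RewireEquiv R S) : Nonempty (R.1.BaseIso S.1) := by
  induction h with
  | rel R S h =>
    rcases h with ⟨e, -⟩ | ⟨e, -⟩ <;> exact ⟨e⟩
  | refl R => exact ⟨.withJumps R.1 R.1.jump R.1.jump⟩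
  | symm R S _ ih => exact ih.map BaseIso.symm
  | trans R S T _ _ ih ih' => exact ⟨ih.some.trans ih'.some⟩

/-- Equivalence by rewiring, with the correctness of the two structures. -/
def RewireRel (R S : PreStructure) : Prop :=
  ∃ (c : R.JumpCorrect) (c' : S.JumpCorrect), RewireEquiv ⟨R, c⟩ ⟨S, c'⟩

theorem RewireRel.symm {R S : PreStructure} (h : RewireRel R S) : RewireRel S R := by
  obtain ⟨c, c', h⟩ := h
  exact ⟨c', c, .symm _ _ h⟩

theorem RewireRel.trans {R S T : PreStructure} (h : RewireRel R S) (h' : RewireRel S T) :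
    RewireRel R T := by
  obtain ⟨c, c', h⟩ := h
  obtain ⟨_, d', h'⟩ := h'
  exact ⟨c, d', .trans _ _ _ h h'⟩

theorem RewireRel.of_same {R S : PreStructure} (c : R.JumpCorrect) (c' : S.JumpCorrect)
    (h : R.Same S) : RewireRel R S := ⟨c, c', .rel _ _ (Or.inl h)⟩

theorem IsPS.univ {F : Set Formula} {R : PreStructure} (h : R.IsPS F) : R.IsPS Set.univ :=
  { h with type_mem := fun _ => trivial }

end PreStructure

open PreStructure

/-- The jumps `J` of `R` are total and obey the rule tree `t`. -/
def Good (R : PreStructure) (nN : R.N → Name) (t : RuleTree) (J : R.N → Option R.N) : Prop :=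
  (∀ n m, J n = some m → R.label n = .bot ∧ ∃ a, nN n = .rule a ∧ t.Tgt a (nN m)) ∧
    ∀ n, R.label n = .bot → (J n).isSome

section Rewiring

variable {ν : List Occ} {t t' : RuleTree} {R : PreStructure} {nA : R.A → Occ}
  {nN : R.N → Name} {J J' : R.N → Option R.N}

theorem Good.jumpCorrect (hR : IsNaming Θ ν t.links t.rules R nA nN) (hPS : R.IsPS Set.univ)
    (ht : Der Θ ν t) (hν : Anti (ν : Multiset Occ)) (hJ : Good R nN t J) :
    (R.withJumps J).JumpCorrect := by
  have hR' : IsNaming Θ ν t.links t.rules (R.withJumps J) nA nN := { hR with }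
  refine ⟨{ hPS with jump_bot := fun n m h => ?_ }, fun n => hJ.2 n,
    hR'.acc ht hν (fun n m h => (hJ.1 n m h).2) (fun n => hJ.2 n) fun n m h => (hJ.1 n m h).1⟩
  obtain ⟨h1, a, h2, h3⟩ := hJ.1 n m h
  refine ⟨h1, ?_⟩
  rintro rfl
  rw [hR.label, h2] at h1
  exact ht.tgt_ne (kind_eq_bot h1) hν (hR.mem_of_rule h2) h3 h2

theorem Good.rewireRel (hR : IsNaming Θ ν t.links t.rules R nA nN) (hPS : R.IsPS Set.univ)
    (ht : Der Θ ν t) (hν : Anti (ν : Multiset Occ)) (hJ : Good R nN t J) (hJ' : Good R nN t J') :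
    RewireRel (R.withJumps J) (R.withJumps J') := by
  classical
  have := hPS.finite_N
  have := Fintype.ofFinite R.N
  -- The condition bears on each jump separately, so any mixture of the two jump functions obeys `t`
  -- and is correct; this provides the intermediate structures.
  have hgood : ∀ s : Finset R.N, Good R nN t fun n => if n ∈ s then J' n else J n := by
    intro s
    refine ⟨fun n m h => ?_, fun n hn => ?_⟩
    · dsimp only at h
      split_ifs at h
      · exact hJ'.1 n m h
      · exact hJ.1 n m h
    · dsimp only
      split_ifs
      · exact hJ'.2 n hn
      · exact hJ.2 n hn
  have key : ∀ s : Finset R.N,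
      RewireRel (R.withJumps J) (R.withJumps fun n => if n ∈ s then J' n else J n) := by
    intro s
    induction s using Finset.induction_on with
    | empty =>
      simp only [Finset.notMem_empty, if_false]
      exact ⟨hJ.jumpCorrect hR hPS ht hν, hJ.jumpCorrect hR hPS ht hν, .refl _⟩
    | insert n s hn ih =>
      refine ih.trans ⟨(hgood s).jumpCorrect hR hPS ht hν,
        (hgood (insert n s)).jumpCorrect hR hPS ht hν, .rel _ _ ?_⟩
      have hne : ∀ n', n' ≠ n → (if n' ∈ insert n s then J' n' else J n') =
          if n' ∈ s then J' n' else J n' := fun n' h => by simp [h]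
      by_cases heq : J' n = J n
      · left
        refine ⟨.withJumps R _ _, fun n' => ?_⟩
        change (if n' ∈ insert n s then J' n' else J n') =
          (if n' ∈ s then J' n' else J n').map id
        rw [Option.map_id]
        by_cases h : n' = n
        · subst h; simp [hn, heq]
        · exact hne n' h
      · right
        have hlab : R.label n = .bot := by
          by_contra hlab
          refine heq ?_
          have h1 : J n = none := Option.eq_none_iff_forall_ne_some.2
            fun m h => hlab (hJ.1 n m h).1
          have h2 : J' n = none := Option.eq_none_iff_forall_ne_some.2
            fun m h => hlab (hJ'.1 n m h).1
          rw [h1, h2]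
        refine ⟨.withJumps R _ _, n, (hgood s).2 n hlab, (hgood (insert n s)).2 n hlab, ?_, ?_⟩
        · change (if n ∈ insert n s then J' n else J n) ≠ (if n ∈ s then J' n else J n).map id
          rw [Option.map_id]
          simpa [hn] using heq
        · intro n' h
          change (if n' ∈ insert n s then J' n' else J n') =
            (if n' ∈ s then J' n' else J n').map id
          rw [Option.map_id]
          exact hne n' h
  have := key Finset.univ
  simpa using this

theorem exists_good {L : Set (Sym2 Occ)} {P : Set Occ} (hR : IsNaming Θ ν L P R nA nN)
    {Q : Occ → Name → Prop} (h : ∀ a, ∃ n, Q a (nN n)) : ∃ J : R.N → Option R.N,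
      (∀ n, R.label n = .bot → (J n).isSome) ∧
      ∀ n m, J n = some m → R.label n = .bot ∧ ∃ a, nN n = .rule a ∧ Q a (nN m) := by
  classical
  choose f hf using h
  refine ⟨fun n => match nN n with
    | .rule a => if R.label n = .bot then some (f a) else none
    | _ => none, fun n hn => ?_, fun n m hnm => ?_⟩
  · rcases hR.node_cases n with ⟨a, -, h1, h2⟩ | ⟨s, h1, h2⟩ | ⟨a, h0, h1, h2⟩
    · simp [h2, hn]
    · rw [hR.label, h2] at hn; cases hn
    · rw [hR.label, h2] at hn; cases hn
  · rcases hR.node_cases n with ⟨a, -, h1, h2⟩ | ⟨s, h1, h2⟩ | ⟨a, h0, h1, h2⟩ <;>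
      simp only [h2] at hnm
    · split_ifs at hnm with hl
      cases hnm
      exact ⟨hl, nA a, h2, hf _⟩
    · cases hnm
    · cases hnm

theorem IsNaming.exists_node (hR : IsNaming Θ ν t.links t.rules R nA nN) {m : Name}
    (hm : m ∈ t.names) (hb : ∀ x, m ≠ .bul x) : ∃ n, nN n = m := by
  rcases m with a | s | x
  · exact hR.exists_node_rule hm
  · exact hR.exists_node_ax hm
  · exact (hb x rfl).elim

/-- Jumps that obey equivalent trees are equivalent by rewiring. -/
theorem Eqv.rewireRel (hPS : R.IsPS Set.univ) (hν : Anti (ν : Multiset Occ)) (h : Eqv Θ ν t t') :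
    ∀ J J' : R.N → Option R.N, IsNaming Θ ν t.links t.rules R nA nN → Der Θ ν t →
    Good R nN t J → Good R nN t' J' → RewireRel (R.withJumps J) (R.withJumps J') := by
  induction h with
  | rel t t' h =>
    obtain ⟨ht, ht', hs⟩ := h
    intro J J' hR _ hJ hJ'
    -- The bridge between the two trees: jumps that obey both. Targets that are not `bullet` nodes
    -- are used, because `names` contains a `bullet` name for every occurrence, not only for the
    -- conclusions.
    obtain ⟨J'', h1, h2⟩ := exists_good hR (Q := fun a m => t.Tgt a m ∧ t'.Tgt a m) fun a => by
      obtain ⟨m, h1, h2, h3⟩ := hs.exists_tgt ht hν a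
      obtain ⟨n, rfl⟩ := hR.exists_node h1 h2
      exact ⟨n, h3⟩
    have g1 : Good R nN t J'' := ⟨fun n m h => by
      obtain ⟨h3, a, h4, h5, h6⟩ := h2 n m h
      exact ⟨h3, a, h4, h5⟩, h1⟩
    have g2 : Good R nN t' J'' := ⟨fun n m h => by
      obtain ⟨h3, a, h4, h5, h6⟩ := h2 n m h
      exact ⟨h3, a, h4, h6⟩, h1⟩
    refine (hJ.rewireRel hR hPS ht hν g1).trans (g2.rewireRel (nA := nA) ?_ hPS ht' hν hJ')
    rwa [← hs.links_eq, ← hs.rules_eq]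
  | refl t => exact fun J J' hR ht hJ hJ' => hJ.rewireRel hR hPS ht hν hJ'
  | symm t t' h ih =>
    intro J J' hR ht hJ hJ'
    refine (ih J' J ?_ ?_ hJ' hJ).symm
    · rwa [Eqv.links_eq h, Eqv.rules_eq h]
    · rwa [Eqv.der_iff h]
  | trans t u v h h' ih ih' =>
    intro J J' hR ht hJ hJ'
    have hu : Der Θ ν u := by rwa [← Eqv.der_iff h]
    have hR' := hR
    rw [Eqv.links_eq h, Eqv.rules_eq h] at hR'
    -- Any jump function that obeys the intermediate tree will do.
    obtain ⟨J'', h1, h2⟩ := exists_good hR' (Q := u.Tgt) fun a => by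
      obtain ⟨m, h1, h2, h3⟩ := hu.exists_tgt hν a
      obtain ⟨n, rfl⟩ := hR'.exists_node h1 h2
      exact ⟨n, h3⟩
    exact (ih J J'' hR ht hJ ⟨h2, h1⟩).trans (ih' J'' J' hR' hu ⟨h2, h1⟩ hJ')

end Rewiring

/-! ### Jumps and conclusions of desequentializations -/

theorem Proof.deseq_jump {Γ : List Formula} (p : Proof Γ) (n : p.deseq.N) :
    p.deseq.jump n = none := by
  induction p with
  | ax A => rfl
  | ex Γ A B Δ p ih => exact ih n
  | tens Γ A B Δ p q ihp ihq =>
    rcases n with ⟨n | n, hn⟩ | _ | _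
    · have := ihp n
      simp [deseq, this]
    · have := ihq n
      simp [deseq, this]
    · rfl
    · rfl
  | one => rfl
  | par Γ A B p ih =>
    rcases n with ⟨n, hn⟩ | _ | _
    · have := ih n
      simp [deseq, this]
    · rfl
    · rfl
  | bot Γ p ih =>
    rcases n with ⟨n, hn⟩ | _ | _
    · have := ih n
      simp [deseq, this]
    · rfl
    · rfl

/-- Proofs with isomorphic desequentializations have the same conclusions. -/
theorem Proof.deseq_concl_type {Γ : List Formula} (p : Proof Γ) :
    p.deseq.concl.map p.deseq.type = Γ := by
  obtain ⟨nA, nN, h⟩ := p.exists_naming _ (roots_map Γ) (roots_anti Γ)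
  conv_rhs => rw [← roots_map Γ, ← h.concl, List.map_map]
  exact List.map_congr_left fun a _ => h.type a

theorem PreStructure.BaseIso.concl_type {R S : PreStructure} (e : R.BaseIso S) :
    S.concl.map S.type = R.concl.map R.type := by
  rw [e.concl, List.map_map]
  exact List.map_congr_left fun a _ => e.type a

end MLL

/-! ### The corollary -/

theorem mainTheorem3 {Γ₁ Γ₂ : List Formula} (π₁ : Proof Γ₁) (π₂ : Proof Γ₂)
    (hπ₁ : π₁.InFragment NBTLL) (hπ₂ : π₂.InFragment NBTLL)
    (R₁ R₂ : PreStructure) (hR₁ : R₁.IsPS NBTLL) (hR₂ : R₂.IsPS NBTLL)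
    (ht₁ : R₁.JumpTotal) (ht₂ : R₂.JumpTotal)
    (h₁ : π₁.DeseqJump R₁) (h₂ : π₂.DeseqJump R₂) :
    ∃ (c₁ : R₁.JumpCorrect) (c₂ : R₂.JumpCorrect),
      (π₁.PermEquiv π₂ ↔ PreStructure.RewireEquiv ⟨R₁, c₁⟩ ⟨R₂, c₂⟩) ∧
      (PreStructure.RewireEquiv ⟨R₁, c₁⟩ ⟨R₂, c₂⟩ ↔ π₁.deseq.Same π₂.deseq) := by
  have correct : ∀ {Γ : List Formula} {π : Proof Γ} {R : PreStructure}, R.IsPS NBTLL →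
      R.JumpTotal → π.DeseqJump R → ∃ nA nN,
        IsNaming Γ (roots Γ) π.ruleTree.links π.ruleTree.rules R nA nN ∧
        Good R nN π.ruleTree R.jump ∧ R.JumpCorrect := by
    intro Γ π R hR ht h
    obtain ⟨nA, nN, hn, hj⟩ := h.exists_naming _ (roots_map Γ) (roots_anti Γ)
    have hg : Good R nN π.ruleTree R.jump := ⟨fun n m h => ⟨(hR.jump_bot n m h).1, hj n m h⟩, ht⟩
    exact ⟨nA, nN, hn, hg, hg.jumpCorrect hn hR.univ π.der_ruleTree (roots_anti Γ)⟩
  obtain ⟨nA, nN, n₁, g₁, c₁⟩ := correct hR₁ ht₁ h₁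
  obtain ⟨mA, mN, n₂, g₂, c₂⟩ := correct hR₂ ht₂ h₂
  obtain ⟨dA, dN, d₁⟩ := π₁.exists_naming _ (roots_map Γ₁) (roots_anti Γ₁)
  obtain ⟨eA, eN, d₂⟩ := π₂.exists_naming _ (roots_map Γ₂) (roots_anti Γ₂)
  -- Equality of conclusions and links is the hub: it yields both equivalences, and each of the
  -- three relations implies it.
  have hperm : Γ₁ = Γ₂ ∧ π₁.ruleTree.links = π₂.ruleTree.links →
      π₁.PermEquiv π₂ ∧ PreStructure.RewireEquiv ⟨R₁, c₁⟩ ⟨R₂, c₂⟩ := by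
    rintro ⟨rfl, hl⟩
    -- The conclusions are types of arcs of `R₁`, hence formulae of the fragment.
    have hfr : ∀ C ∈ Γ₁, C ∈ NBTLL := by
      intro C hC
      have := n₁.concl
      rw [← roots_map Γ₁, ← n₁.concl, List.map_map] at hC
      obtain ⟨a, -, rfl⟩ := List.mem_map.1 hC
      rw [Function.comp_apply, ← n₁.type]
      exact hR₁.type_mem a
    have he := eqv_of_links_eq (ty_mem_NBTLL hfr) π₁.der_ruleTree _ π₂.der_ruleTree
      (roots_anti Γ₁) hl
    refine ⟨permEquiv_of_eqv he _ _ rfl rfl, ?_⟩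
    have n₂' := n₂
    rw [← hl, ← he.rules_eq] at n₂'
    obtain ⟨e, -, heN⟩ := n₁.exists_baseIso n₂'
    have hm : ∀ n, mN n = nN (e.node.symm n) := fun n => by rw [← heN, Equiv.apply_symm_apply]
    -- The jumps of `R₂` are carried over to `R₁` along an isomorphism that respects the names, so
    -- that both jump functions live on the same structure.
    set J : R₁.N → Option R₁.N := fun n => (R₂.jump (e.node n)).map e.node.symm with hJ
    have hg : Good R₁ nN π₂.ruleTree J := by
      refine ⟨fun n m h => ?_, fun n hn => ?_⟩
      · obtain ⟨m', h1, rfl⟩ := Option.map_eq_some_iff.1 h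
        obtain ⟨h2, a, h3, h4⟩ := g₂.1 _ _ h1
        rw [e.label] at h2
        rw [heN] at h3
        rw [hm] at h4
        exact ⟨h2, a, h3, h4⟩
      · simpa [hJ] using g₂.2 (e.node n) (by rw [e.label, hn])
    have n₁' := n₁
    rw [hl, he.rules_eq] at n₁'
    have hc := hg.jumpCorrect n₁' hR₁.univ π₂.der_ruleTree (roots_anti Γ₁)
    have hs : (R₁.withJumps J).Same R₂ := by
      refine ⟨{ e with }, fun n => ?_⟩
      simp [hJ, Option.map_map]
    obtain ⟨_, _, h⟩ := (he.rewireRel hR₁.univ (roots_anti Γ₁) _ _ n₁ π₁.der_ruleTree g₁ hg).trans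
      (.of_same hc c₂ hs)
    exact h
  have hsame : PreStructure.RewireEquiv ⟨R₁, c₁⟩ ⟨R₂, c₂⟩ → π₁.deseq.Same π₂.deseq := by
    intro h
    obtain ⟨e⟩ := h.nonempty_baseIso
    obtain ⟨e₁, -⟩ := d₁.exists_baseIso n₁
    obtain ⟨e₂, -⟩ := n₂.exists_baseIso d₂
    -- Each structure with jumps has the same names, hence the same underlying structure, as the
    -- desequentialization of its proof; there are no jumps to compare.
    exact ⟨(e₁.trans e).trans e₂, fun n => by simp [Proof.deseq_jump]⟩
  have hlinks : π₁.deseq.Same π₂.deseq → Γ₁ = Γ₂ ∧ π₁.ruleTree.links = π₂.ruleTree.links := by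
    rintro ⟨e, -⟩
    obtain rfl : Γ₁ = Γ₂ := by
      rw [← π₁.deseq_concl_type, ← π₂.deseq_concl_type, e.concl_type]
    exact ⟨rfl, (d₁.links_subset π₁.der_ruleTree d₂ e).antisymm
      (d₂.links_subset π₂.der_ruleTree d₁ e.symm)⟩
  exact ⟨c₁, c₂, ⟨fun h => (hperm (PermStep.invariant h)).2,
    fun h => (hperm (hlinks (hsame h))).1⟩, hsame, fun h => (hperm (hlinks h)).2⟩
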